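/- Let $G=(V,E)$ be a finite simple connected graph with maximum degree $\Delta$, and let $\kappa_v\in\mathbb{N}_{\ge 0}$ ($v\in V$) be node capacities. A star coloring $C$ of $G$ assigns to each edge one of its two endpoints as its color; the associated orientation directs an edge $\{u,v\}$ with color $u$ from $u$ to $v$. Let $x(G,C,v)$ be the number of distinct colors on the edges incident to $v$; $C$ is valid if $x(G,C,v)\le\kappa_v$ for all $v$, and $x^*(G)$ is the minimum of $\max_{v} x(G,C,v)$ over all valid star colorings $C$. An orientation is valid if every node $v$ has indegree at most $\kappa_v$, and $k^*(G)$ is the minimum, over all valid orientations, of the maximum indegree (both minima are $\infty$ if nothing is valid). An optimal solution of MinMaxStar is a valid star coloring attaining $x^*(G)$; an optimal solution of MinMaxInd is a valid orientation attaining $k^*(G)$. Theorem. Suppose that there are no node capacity constraints, i.e. $\kappa_v\ge\delta(v)$ for all $v\in V$, where $\delta(v)$ is the degree of $v$. Then there is a star coloring that is an optimal solution of MinMaxStar and whose associated orientation is an optimal solution of MinMaxInd, and $k^*(G)\le x^*(G)\le k^*(G)+1$. Moreover, there is an algorithm that computes such a star coloring from a list of the edges of $G$ in $$\mathcal{O}\bigl(\log(\Delta)\cdot|E|\cdot\min\{|V|^{2/3},|E|^{1/2}\}\bigr)$$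 steps on a word RAM with words of $\mathcal{O}(\log(|V|+|E|+2))$ bits. (For the two graphs with $\Delta\le 1$, a single node and a single edge, where the expression in the bound is $0$ or undefined, the running time is $\mathcal{O}(1)$.) -/

import Mathlib

namespace StarPartition

/-! ### Star colorings, orientations, and the two optimization problems -/

section Graphs

variable {V : Type*}

/-- A star coloring of `G`. The color of a node is the node itself, and every edge carries the
color of one of its two endpoints. -/
structure StarColoring (G : SimpleGraph V) where
  color : G.edgeSet → V
  color_mem : ∀ e : G.edgeSet, color e ∈ (e : Sym2 V)

/-- An orientation of `G`: `arc u v` means that the edge `{u, v}` is directed from `u` to `v`. -/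
structure Orientation (G : SimpleGraph V) where
  arc : V → V → Prop
  adj_of_arc : ∀ u v, arc u v → G.Adj u v
  arc_or_arc : ∀ u v, G.Adj u v → arc u v ∨ arc v u
  not_arc_of_arc : ∀ u v, arc u v → ¬ arc v u

namespace StarColoring

variable {G : SimpleGraph V}

/-- The number of distinct colors of the edges incident to `v`. -/
noncomputable def numColors (C : StarColoring G) (v : V) : ℕ :=
  (C.color '' {e : G.edgeSet | v ∈ (e : Sym2 V)}).ncard

/-- No node sees more colors than its capacity. -/
def Valid (C : StarColoring G) (κ : V → ℕ) : Prop :=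
  ∀ v, C.numColors v ≤ κ v

/-- The star partitioning number of a coloring: the maximum of `numColors` over all nodes. -/
noncomputable def starNumber [Fintype V] (C : StarColoring G) : ℕ :=
  Finset.univ.sup C.numColors

/-- The orientation of a star coloring: an edge `{u, v}` with the color of `u` is directed
from `u` to `v`. -/
def toOrientation (C : StarColoring G) : Orientation G where
  arc u v := ∃ h : G.Adj u v, C.color ⟨s(u, v), h⟩ = u
  adj_of_arc _ _ h := h.1
  arc_or_arc u v h := by
    have h1 := C.color_mem ⟨s(u, v), h⟩
    rcases Sym2.mem_iff.1 h1 with h2 | h2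
    · exact Or.inl ⟨h, h2⟩
    · refine Or.inr ⟨h.symm, ?_⟩
      have h3 : (⟨s(v, u), h.symm⟩ : G.edgeSet) = ⟨s(u, v), h⟩ := Subtype.ext Sym2.eq_swap
      rw [h3, h2]
  not_arc_of_arc u v h h' := by
    obtain ⟨h1, h2⟩ := h
    obtain ⟨h3, h4⟩ := h'
    have h5 : (⟨s(v, u), h3⟩ : G.edgeSet) = ⟨s(u, v), h1⟩ := Subtype.ext Sym2.eq_swap
    rw [h5, h2] at h4
    exact h1.ne h4

end StarColoring

namespace Orientation

variable {G : SimpleGraph V}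

/-- The number of edges directed to `v`. -/
noncomputable def indegree (Λ : Orientation G) (v : V) : ℕ :=
  {u | Λ.arc u v}.ncard

/-- No node has an indegree larger than its capacity. -/
def Valid (Λ : Orientation G) (κ : V → ℕ) : Prop :=
  ∀ v, Λ.indegree v ≤ κ v

/-- The maximum indegree over all nodes. -/
noncomputable def maxIndegree [Fintype V] (Λ : Orientation G) : ℕ :=
  Finset.univ.sup Λ.indegree

end Orientation

variable [Fintype V]

/-- The min-max star partitioning number `x*(G)`; it is `⊤` if there is no valid star coloring. -/
noncomputable def minMaxStar (G : SimpleGraph V) (κ : V → ℕ) : ℕ∞ :=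
  ⨅ C : {C : StarColoring G // C.Valid κ}, (C.1.starNumber : ℕ∞)

/-- The min-max indegree `k*(G)`; it is `⊤` if there is no valid orientation. -/
noncomputable def minMaxInd (G : SimpleGraph V) (κ : V → ℕ) : ℕ∞ :=
  ⨅ Λ : {Λ : Orientation G // Λ.Valid κ}, (Λ.1.maxIndegree : ℕ∞)

/-- `C` is an optimal solution of MinMaxStar on `G` with node capacities `κ`. -/
def StarColoring.IsOptimal {G : SimpleGraph V} (C : StarColoring G) (κ : V → ℕ) : Prop :=
  C.Valid κ ∧ (C.starNumber : ℕ∞) = minMaxStar G κ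

/-- `Λ` is an optimal solution of MinMaxInd on `G` with node capacities `κ`. -/
def Orientation.IsOptimal {G : SimpleGraph V} (Λ : Orientation G) (κ : V → ℕ) : Prop :=
  Λ.Valid κ ∧ (Λ.maxIndegree : ℕ∞) = minMaxInd G κ

end Graphs

/-! ### A word RAM with a step count

The machine has variables and arrays of natural numbers, named by numerals. A program is a fixed
piece of syntax, so it mentions only finitely many of them and finitely many constants.
The arithmetic is addition and truncated subtraction. -/

/-- The memory: `var x` is the content of variable `x`, and `arr a i` is entry `i` of array `a`. -/
structure Store where
  var : ℕ → ℕ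
  arr : ℕ → ℕ → ℕ

namespace Store

def setVar (σ : Store) (x k : ℕ) : Store :=
  { σ with var := Function.update σ.var x k }

def setArr (σ : Store) (a i k : ℕ) : Store :=
  { σ with arr := Function.update σ.arr a (Function.update (σ.arr a) i k) }

end Store

inductive Expr where
  | const (k : ℕ)
  | var (x : ℕ)
  | get (a : ℕ) (i : Expr)
  | add (e f : Expr)
  | sub (e f : Expr)

namespace Expr

def eval (σ : Store) : Expr → ℕ
  | const k => k
  | var x => σ.var x
  | get a i => σ.arr a (i.eval σ)
  | add e f => e.eval σ + f.eval σ
  | sub e f => e.eval σ - f.eval σ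

/-- The number of operations performed by an evaluation. -/
def cost : Expr → ℕ
  | const _ => 1
  | var _ => 1
  | get _ i => i.cost + 1
  | add e f => e.cost + f.cost + 1
  | sub e f => e.cost + f.cost + 1

/-- Every value that occurs in the evaluation, addresses included, is smaller than `W`. -/
def Fits (W : ℕ) (σ : Store) : Expr → Prop
  | const k => k < W
  | var x => σ.var x < W
  | get a i => i.Fits W σ ∧ σ.arr a (i.eval σ) < W
  | add e f => e.Fits W σ ∧ f.Fits W σ ∧ e.eval σ + f.eval σ < W
  | sub e f => e.Fits W σ ∧ f.Fits W σ

end Expr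

/-- Programs. In `ite` and `loop`, the condition holds if the expression is not zero. -/
inductive Prog where
  | skip
  | assign (x : ℕ) (e : Expr)
  | put (a : ℕ) (i e : Expr)
  | seq (p q : Prog)
  | ite (e : Expr) (p q : Prog)
  | loop (e : Expr) (p : Prog)

/-- `Exec W p σ τ t`: on a machine whose words hold the numbers smaller than `W`, the program `p`
started in `σ` halts in `τ` after `t` steps. A run in which a value does not fit into a word is
stuck, and has no result. -/
inductive Exec (W : ℕ) : Prog → Store → Store → ℕ → Prop
  | skip (σ : Store) : Exec W .skip σ σ 1
  | assign (σ : Store) (x : ℕ) (e : Expr) (he : e.Fits W σ) :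
      Exec W (.assign x e) σ (σ.setVar x (e.eval σ)) (e.cost + 1)
  | put (σ : Store) (a : ℕ) (i e : Expr) (hi : i.Fits W σ) (he : e.Fits W σ) :
      Exec W (.put a i e) σ (σ.setArr a (i.eval σ) (e.eval σ)) (i.cost + e.cost + 1)
  | seq {σ τ ρ : Store} {p q : Prog} {t u : ℕ} (hp : Exec W p σ τ t) (hq : Exec W q τ ρ u) :
      Exec W (.seq p q) σ ρ (t + u)
  | ite_true {σ τ : Store} {e : Expr} {p q : Prog} {t : ℕ} (hf : e.Fits W σ)
      (he : e.eval σ ≠ 0) (hp : Exec W p σ τ t) :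
      Exec W (.ite e p q) σ τ (e.cost + 1 + t)
  | ite_false {σ τ : Store} {e : Expr} {p q : Prog} {t : ℕ} (hf : e.Fits W σ)
      (he : e.eval σ = 0) (hq : Exec W q σ τ t) :
      Exec W (.ite e p q) σ τ (e.cost + 1 + t)
  | loop_true {σ τ ρ : Store} {e : Expr} {p : Prog} {t u : ℕ} (hf : e.Fits W σ)
      (he : e.eval σ ≠ 0) (hp : Exec W p σ τ t) (hl : Exec W (.loop e p) τ ρ u) :
      Exec W (.loop e p) σ ρ (e.cost + 1 + t + u)
  | loop_false {σ : Store} {e : Expr} {p : Prog} (hf : e.Fits W σ) (he : e.eval σ = 0) :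
      Exec W (.loop e p) σ σ (e.cost + 1)

/-- The machine is deterministic: the final memory and the number of steps are determined. -/
theorem Exec.deterministic {W : ℕ} {p : Prog} {σ τ τ' : Store} {t t' : ℕ}
    (h : Exec W p σ τ t) (h' : Exec W p σ τ' t') : τ = τ' ∧ t = t' := by
  induction h generalizing τ' t' with
  | skip σ => cases h'; exact ⟨rfl, rfl⟩
  | assign σ x e he => cases h'; exact ⟨rfl, rfl⟩
  | put σ a i e hi he => cases h'; exact ⟨rfl, rfl⟩
  | seq hp hq ihp ihq =>
    cases h' with
    | seq hp' hq' =>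
      obtain ⟨rfl, rfl⟩ := ihp hp'
      obtain ⟨rfl, rfl⟩ := ihq hq'
      exact ⟨rfl, rfl⟩
  | ite_true hf he hp ih =>
    cases h' with
    | ite_true _ _ hp' => obtain ⟨rfl, rfl⟩ := ih hp'; exact ⟨rfl, rfl⟩
    | ite_false _ he' _ => exact absurd he' he
  | ite_false hf he hp ih =>
    cases h' with
    | ite_true _ he' _ => exact absurd he he'
    | ite_false _ _ hp' => obtain ⟨rfl, rfl⟩ := ih hp'; exact ⟨rfl, rfl⟩
  | loop_true hf he hp hl ihp ihl =>
    cases h' with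
    | loop_true _ _ hp' hl' =>
      obtain ⟨rfl, rfl⟩ := ihp hp'
      obtain ⟨rfl, rfl⟩ := ihl hl'
      exact ⟨rfl, rfl⟩
    | loop_false _ he' => exact absurd he' he
  | loop_false hf he =>
    cases h' with
    | loop_true _ he' _ _ => exact absurd he he'
    | loop_false _ _ => exact ⟨rfl, rfl⟩

/-! ### Input and output -/

/-- `L` lists every edge of `G` exactly once, in any order, with its endpoints in any order. -/
def IsEdgeList {V : Type*} (G : SimpleGraph V) (L : List (V × V)) : Prop :=
  (L.map fun p => s(p.1, p.2)).Nodup ∧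
    ∀ e : Sym2 V, e ∈ (L.map fun p => s(p.1, p.2)) ↔ e ∈ G.edgeSet

/-- The memory at the start: variables `0` and `1` hold the number of nodes and the number of
edges, arrays `0` and `1` hold the first and the second endpoints of the edges of the list,
and everything else is `0`. -/
def input (n : ℕ) (L : List (Fin n × Fin n)) : Store where
  var x := if x = 0 then n else if x = 1 then L.length else 0
  arr a i :=
    if a = 0 then (L.map fun p => (p.1 : ℕ)).getD i 0
    else if a = 1 then (L.map fun p => (p.2 : ℕ)).getD i 0
    else 0

/-- In the memory `τ`, entry `i` of array `2` is the color that `C` gives to the `i`-th edge of the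
list, i.e. the tail of this edge in the orientation of `C`. -/
def Outputs {n : ℕ} {G : SimpleGraph (Fin n)} (τ : Store) (L : List (Fin n × Fin n))
    (C : StarColoring G) : Prop :=
  ∀ (i : ℕ) (hi : i < L.length) (e : G.edgeSet),
    (e : Sym2 (Fin n)) = s((L[i]).1, (L[i]).2) → τ.arr 2 i = (C.color e : ℕ)

end StarPartition

/-! A node sees the color of each of its in-neighbours and, if it has an outgoing edge, also its own
color. So `numColors` is the indegree plus one exactly when the indegree is below the degree
(`StarColoring.numColors_eq`). This gives k* ≤ x* ≤ k* + 1 and turns both problems into orientation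
problems with upper bounds on the indegrees: maximum indegree at most k is the bound k everywhere;
at most k ≥ 1 colors is the bound k at nodes of degree at most k and k - 1 elsewhere. The bounds
interleave into one increasing chain of levels (`levelCap`), and an orientation on the lowest
feasible level is optimal for both problems (`StarColoring.isOptimal_of_level`). Without capacity
constraints everything is valid and level 2Δ is feasible.

The lowest level is found by binary search with O(log Δ) feasibility tests. A test is a
unit-capacity flow computation in the manner of Dinic: reversing a directed path moves one unit of
indegree from its end to its start. A phase computes the distances from the nodes below their bounds
by breadth-first search; then a depth-first search from the nodes above their bounds reverses
shortest paths until none is left, in linear time. If a phase moves nothing and some node is still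
above its bound, the nodes out of reach form a set that no edge enters. Its indegree sum is then the
least possible and still exceeds the bounds, so the level is infeasible (`PhaseEnd.exists_gt`).

The phases are counted as follows. Every phase increases the distance between the two kinds of nodes
(`Far.step`). Once it is at least D, some level set separating them is entered by at most M edges
(`CutBound`), and every further phase that moves something lowers this number (`Separates.step`).
Hence there are at most D + M + 1 phases. The cuts at different levels are disjoint, which allows M
of order m/D; without parallel edges, the sizes of consecutive levels allow M of order n²/D².
Balancing gives m^(1/2) and n^(2/3) (`exists_cutBound`).

All of this is proved for an explicit program. Loop invariants carry a credit of steps (`wp_loop`),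
which is a constant times a potential or a number of remaining rounds. -/

namespace StarPartition

/-! ### A program logic for the word RAM -/

namespace Store

@[simp] theorem setVar_var_self (σ : Store) (x k : ℕ) : (σ.setVar x k).var x = k := by
  simp [setVar]

@[simp] theorem setVar_var_ne (σ : Store) {x y : ℕ} (k : ℕ) (h : y ≠ x) :
    (σ.setVar x k).var y = σ.var y := by
  simp [setVar, h]

@[simp] theorem setVar_arr (σ : Store) (x k : ℕ) : (σ.setVar x k).arr = σ.arr := rfl

@[simp] theorem setArr_var (σ : Store) (a i k : ℕ) : (σ.setArr a i k).var = σ.var := rfl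

@[simp] theorem setArr_arr_self (σ : Store) (a i k : ℕ) :
    (σ.setArr a i k).arr a = Function.update (σ.arr a) i k := by
  simp [setArr]

@[simp] theorem setArr_arr_ne (σ : Store) {a a' : ℕ} (i k : ℕ) (h : a' ≠ a) :
    (σ.setArr a i k).arr a' = σ.arr a' := by
  simp [setArr, h]

end Store

namespace Prog

/-- Does the program assign to variable `x`? -/
def writesVar (x : ℕ) : Prog → Bool
  | skip => false
  | assign y _ => x == y
  | put _ _ _ => false
  | seq p q => p.writesVar x || q.writesVar x
  | ite _ p q => p.writesVar x || q.writesVar x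
  | loop _ p => p.writesVar x

/-- Does the program write to array `a`? -/
def writesArr (a : ℕ) : Prog → Bool
  | skip => false
  | assign _ _ => false
  | put b _ _ => a == b
  | seq p q => p.writesArr a || q.writesArr a
  | ite _ p q => p.writesArr a || q.writesArr a
  | loop _ p => p.writesArr a

end Prog

/-- `τ` differs from `σ` only in variables and arrays that `p` writes to. -/
structure Frame (p : Prog) (σ τ : Store) : Prop where
  var : ∀ x, p.writesVar x = false → τ.var x = σ.var x
  arr : ∀ a, p.writesArr a = false → τ.arr a = σ.arr a

theorem Frame.refl (p : Prog) (σ : Store) : Frame p σ σ := ⟨fun _ _ => rfl, fun _ _ => rfl⟩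

theorem Frame.trans {p : Prog} {σ τ ρ : Store} (h : Frame p σ τ) (h' : Frame p τ ρ) :
    Frame p σ ρ :=
  ⟨fun x hx => (h'.var x hx).trans (h.var x hx), fun a ha => (h'.arr a ha).trans (h.arr a ha)⟩

/-- The write sets are computable, so for concrete programs the side conditions of a frame are
closed by `rfl`. -/
theorem Exec.frame {W : ℕ} {p : Prog} {σ τ : Store} {t : ℕ} (h : Exec W p σ τ t) :
    Frame p σ τ := by
  induction h with
  | skip σ => exact Frame.refl _ _
  | assign σ x e he =>
    refine ⟨fun y hy => ?_, fun a _ => rfl⟩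
    have : y ≠ x := by simpa [Prog.writesVar] using hy
    simp [this]
  | put σ a i e hi he =>
    refine ⟨fun y _ => rfl, fun b hb => ?_⟩
    have : b ≠ a := by simpa [Prog.writesArr] using hb
    simp [this]
  | seq hp hq ihp ihq =>
    constructor
    · intro x hx
      simp only [Prog.writesVar, Bool.or_eq_false_iff] at hx
      exact (ihq.var x hx.2).trans (ihp.var x hx.1)
    · intro x hx
      simp only [Prog.writesArr, Bool.or_eq_false_iff] at hx
      exact (ihq.arr x hx.2).trans (ihp.arr x hx.1)
  | ite_true hf he hp ih =>
    constructor
    · intro x hx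
      simp only [Prog.writesVar, Bool.or_eq_false_iff] at hx
      exact ih.var x hx.1
    · intro x hx
      simp only [Prog.writesArr, Bool.or_eq_false_iff] at hx
      exact ih.arr x hx.1
  | ite_false hf he hp ih =>
    constructor
    · intro x hx
      simp only [Prog.writesVar, Bool.or_eq_false_iff] at hx
      exact ih.var x hx.2
    · intro x hx
      simp only [Prog.writesArr, Bool.or_eq_false_iff] at hx
      exact ih.arr x hx.2
  | loop_true hf he hp hl ihp ihl =>
    exact ⟨fun x hx => (ihl.var x hx).trans (ihp.var x hx),
      fun a ha => (ihl.arr a ha).trans (ihp.arr a ha)⟩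
  | loop_false hf he => exact Frame.refl _ _

/-- The program `p`, started in `σ`, halts in a memory and after a number of steps that
satisfy `Q`. -/
def wp (W : ℕ) (p : Prog) (Q : Store → ℕ → Prop) (σ : Store) : Prop :=
  ∃ τ t, Exec W p σ τ t ∧ Q τ t

section wp

variable {W : ℕ} {Q Q' : Store → ℕ → Prop} {σ : Store}

/-- The frame is handed over together with the postcondition, so specifications only need to mention
memory that the program writes. -/
theorem wp.mono {p : Prog} (h : wp W p Q σ) (hQ : ∀ τ t, Frame p σ τ → Q τ t → Q' τ t) :
    wp W p Q' σ := by
  obtain ⟨τ, t, he, hq⟩ := h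
  exact ⟨τ, t, he, hQ τ t he.frame hq⟩

theorem wp_skip : wp W .skip Q σ ↔ Q σ 1 := by
  constructor
  · rintro ⟨τ, t, h, hq⟩
    cases h
    exact hq
  · exact fun h => ⟨_, _, .skip σ, h⟩

theorem wp_assign {x : ℕ} {e : Expr} :
    wp W (.assign x e) Q σ ↔ e.Fits W σ ∧ Q (σ.setVar x (e.eval σ)) (e.cost + 1) := by
  constructor
  · rintro ⟨τ, t, h, hq⟩
    cases h with
    | assign _ _ _ he => exact ⟨he, hq⟩
  · exact fun h => ⟨_, _, .assign σ x e h.1, h.2⟩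

theorem wp_put {a : ℕ} {i e : Expr} :
    wp W (.put a i e) Q σ ↔
      i.Fits W σ ∧ e.Fits W σ ∧ Q (σ.setArr a (i.eval σ) (e.eval σ)) (i.cost + e.cost + 1) := by
  constructor
  · rintro ⟨τ, t, h, hq⟩
    cases h with
    | put _ _ _ _ hi he => exact ⟨hi, he, hq⟩
  · exact fun h => ⟨_, _, .put σ a i e h.1 h.2.1, h.2.2⟩

theorem wp_seq {p q : Prog} :
    wp W (.seq p q) Q σ ↔ wp W p (fun τ t => wp W q (fun ρ u => Q ρ (t + u)) τ) σ := by
  constructor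
  · rintro ⟨τ, t, h, hq⟩
    cases h with
    | seq hp hq' => exact ⟨_, _, hp, _, _, hq', hq⟩
  · rintro ⟨τ, t, hp, ρ, u, hq', hq⟩
    exact ⟨_, _, .seq hp hq', hq⟩

theorem wp_ite {e : Expr} {p q : Prog} :
    wp W (.ite e p q) Q σ ↔ e.Fits W σ ∧
      (e.eval σ ≠ 0 → wp W p (fun τ t => Q τ (e.cost + 1 + t)) σ) ∧
      (e.eval σ = 0 → wp W q (fun τ t => Q τ (e.cost + 1 + t)) σ) := by
  constructor
  · rintro ⟨τ, t, h, hq⟩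
    cases h with
    | ite_true hf he hp => exact ⟨hf, fun _ => ⟨_, _, hp, hq⟩, fun h => absurd h he⟩
    | ite_false hf he hp => exact ⟨hf, fun h => absurd he h, fun _ => ⟨_, _, hp, hq⟩⟩
  · rintro ⟨hf, h1, h2⟩
    by_cases he : e.eval σ = 0
    · obtain ⟨τ, t, hp, hq⟩ := h2 he
      exact ⟨_, _, .ite_false hf he hp, hq⟩
    · obtain ⟨τ, t, hp, hq⟩ := h1 he
      exact ⟨_, _, .ite_true hf he hp, hq⟩

/-- The rule for loops: `I k` is an invariant that comes with a credit of `k` steps. -/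
theorem wp_loop {e : Expr} {p : Prog} (I : ℕ → Store → Prop) {k : ℕ} (h0 : I k σ)
    (hstep : ∀ k τ, Frame p σ τ → I k τ → e.Fits W τ ∧ (e.eval τ ≠ 0 →
      wp W p (fun ρ t => ∃ k', k' + (e.cost + 1) + t ≤ k ∧ I k' ρ) τ)) :
    wp W (.loop e p) (fun τ t => ∃ k', k' + t ≤ k + (e.cost + 1) ∧ I k' τ ∧ e.eval τ = 0) σ := by
  have key : ∀ k τ, Frame p σ τ → I k τ →
      wp W (.loop e p) (fun τ t => ∃ k', k' + t ≤ k + (e.cost + 1) ∧ I k' τ ∧ e.eval τ = 0) τ := by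
    intro k
    -- Each pass costs at least one step, so the credit strictly falls: termination and the time
    -- bound come from the same induction.
    induction k using Nat.strong_induction_on with
    | _ k ih =>
      intro τ hf hI
      obtain ⟨hfit, hb⟩ := hstep k τ hf hI
      by_cases he : e.eval τ = 0
      · exact ⟨τ, _, .loop_false hfit he, k, le_rfl, hI, he⟩
      · obtain ⟨ρ, t, hp, k', hk', hI'⟩ := hb he
        obtain ⟨ρ', u, hl, k'', hk'', hI'', he''⟩ :=
          ih k' (by omega) ρ (hf.trans hp.frame) hI'
        exact ⟨ρ', _, .loop_true hfit he hp hl, k'', by omega, hI'', he''⟩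
  exact key k σ (Frame.refl _ _) h0

end wp

end StarPartition

namespace StarPartition

/-! ### Orientations of edge lists -/

/-- A loopless multigraph with nodes `0, …, n - 1`, given by the endpoints `a e` and `b e` of the
edges `e = 0, …, m - 1`. -/
structure Net where
  n : ℕ
  m : ℕ
  a : ℕ → ℕ
  b : ℕ → ℕ
  a_lt : ∀ e < m, a e < n
  b_lt : ∀ e < m, b e < n
  ne : ∀ e < m, a e ≠ b e

namespace Net

open Finset

variable (N : Net)

/-- The head of the edge `e` if its tail is `c e`. -/
def hd (c : ℕ → ℕ) (e : ℕ) : ℕ := N.a e + N.b e - c e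

/-- `c` selects one endpoint of every edge, its tail. -/
def Ori (c : ℕ → ℕ) : Prop := ∀ e < N.m, c e = N.a e ∨ c e = N.b e

def indeg (c : ℕ → ℕ) (v : ℕ) : ℕ := #{e ∈ range N.m | N.hd c e = v}

variable {N}

theorem Ori.lt {c : ℕ → ℕ} (h : N.Ori c) {e : ℕ} (he : e < N.m) : c e < N.n := by
  rcases h e he with h | h <;> rw [h]
  exacts [N.a_lt e he, N.b_lt e he]

theorem Ori.hd_eq {c : ℕ → ℕ} (h : N.Ori c) {e : ℕ} (he : e < N.m) :
    (c e = N.a e ∧ N.hd c e = N.b e) ∨ (c e = N.b e ∧ N.hd c e = N.a e) := by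
  unfold hd
  rcases h e he with h | h
  · left; omega
  · right; omega

theorem Ori.hd_lt {c : ℕ → ℕ} (h : N.Ori c) {e : ℕ} (he : e < N.m) : N.hd c e < N.n := by
  have := N.a_lt e he
  have := N.b_lt e he
  rcases h.hd_eq he with h | h <;> omega

theorem Ori.hd_ne {c : ℕ → ℕ} (h : N.Ori c) {e : ℕ} (he : e < N.m) : N.hd c e ≠ c e := by
  have := N.ne e he
  rcases h.hd_eq he with h | h <;> omega

theorem indeg_le (c : ℕ → ℕ) (v : ℕ) : N.indeg c v ≤ N.m :=
  (card_filter_le _ _).trans (card_range _).le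

theorem hd_update_self {c : ℕ → ℕ} (h : N.Ori c) {e : ℕ} (he : e < N.m) :
    N.hd (Function.update c e (N.hd c e)) e = c e := by
  unfold hd
  simp only [Function.update_self]
  rcases h e he with h | h <;> omega

theorem hd_update_ne (c : ℕ → ℕ) {e e' : ℕ} (x : ℕ) (he : e' ≠ e) :
    N.hd (Function.update c e x) e' = N.hd c e' := by
  simp [hd, Function.update_of_ne he]

theorem Ori.flip {c : ℕ → ℕ} (h : N.Ori c) {e : ℕ} (he : e < N.m) :
    N.Ori (Function.update c e (N.hd c e)) := by
  intro e' he'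
  by_cases hee : e' = e
  · subst hee
    simp only [Function.update_self]
    rcases h.hd_eq he with h | h <;> omega
  · rw [Function.update_of_ne hee]
    exact h e' he'

/-- One unit of indegree moves from the old head to the old tail; terms are added on both sides to
avoid truncated subtraction. -/
theorem indeg_flip {c : ℕ → ℕ} (h : N.Ori c) {e : ℕ} (he : e < N.m) (v : ℕ) :
    N.indeg (Function.update c e (N.hd c e)) v + (if v = N.hd c e then 1 else 0) =
      N.indeg c v + (if v = c e then 1 else 0) := by
  unfold indeg
  have hmem : e ∈ range N.m := mem_range.2 he
  have h1 : ∀ f : ℕ → ℕ, #{e ∈ range N.m | f e = v} =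
      #{e' ∈ (range N.m).erase e | f e' = v} + (if v = f e then 1 else 0) := by
    intro f
    rw [card_filter, card_filter, ← Finset.add_sum_erase _ _ hmem, add_comm]
    simp only [eq_comm (a := v)]
  rw [h1, h1 (N.hd c), hd_update_self h he]
  have h2 : ({e' ∈ (range N.m).erase e | N.hd (Function.update c e (N.hd c e)) e' = v} : Finset ℕ) =
      {e' ∈ (range N.m).erase e | N.hd c e' = v} := by
    apply filter_congr
    intro e' he'
    rw [hd_update_ne _ _ (ne_of_mem_erase he')]
  rw [h2]
  omega

/-! ### Half-edges and incidence lists -/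

variable (N) in
/-- The half-edges are `1, …, 2 * m`; the edge `e` has the half-edges `2 * e + 1` at `a e` and
`2 * e + 2` at `b e`. -/
def own (h : ℕ) : ℕ := if h % 2 = 1 then N.a (h / 2) else N.b (h / 2 - 1)

variable (N) in
/-- The linked lists of the half-edges `1, …, k` at the nodes, with decreasing half-edges, ending
in `0`. -/
structure ListsUpTo (k : ℕ) (eid nxt fst : ℕ → ℕ) : Prop where
  eid_eq : ∀ h, 1 ≤ h → h ≤ k → eid h = (h - 1) / 2
  nxt_lt : ∀ h, 1 ≤ h → h ≤ k → nxt h < h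
  own_nxt : ∀ h, 1 ≤ h → h ≤ k → nxt h ≠ 0 → N.own (nxt h) = N.own h
  nxt_gap : ∀ h, 1 ≤ h → h ≤ k → ∀ h', nxt h < h' → h' < h → N.own h' ≠ N.own h
  fst_le : ∀ v < N.n, fst v ≤ k
  own_fst : ∀ v < N.n, fst v ≠ 0 → N.own (fst v) = v
  fst_gap : ∀ v < N.n, ∀ h, fst v < h → h ≤ k → N.own h ≠ v

variable (N) in
abbrev Lists (eid nxt fst : ℕ → ℕ) : Prop := N.ListsUpTo (2 * N.m) eid nxt fst

variable (N) in
/-- `cur v` is a half-edge at `v`, or `0`. -/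
def IsPtr (cur : ℕ → ℕ) : Prop :=
  ∀ v < N.n, cur v ≤ 2 * N.m ∧ (cur v ≠ 0 → N.own (cur v) = v)

variable (N) in
/-- The pointer of its node has moved past the half-edge `h`. -/
def Passed (cur : ℕ → ℕ) (h : ℕ) : Prop := 1 ≤ h ∧ h ≤ 2 * N.m ∧ cur (N.own h) < h

variable (N) in
/-- The number of half-edges that the pointers have not passed. -/
def rest (cur : ℕ → ℕ) : ℕ := #{h ∈ Icc 1 (2 * N.m) | h ≤ cur (N.own h)}

theorem rest_le (cur : ℕ → ℕ) : N.rest cur ≤ 2 * N.m :=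
  (card_filter_le _ _).trans (by simp)

theorem own_lt {h : ℕ} (h1 : 1 ≤ h) (h2 : h ≤ 2 * N.m) : N.own h < N.n := by
  unfold own
  split_ifs with h3
  · exact N.a_lt _ (by omega)
  · exact N.b_lt _ (by omega)

theorem own_mem {h : ℕ} (h1 : 1 ≤ h) :
    N.own h = N.a ((h - 1) / 2) ∨ N.own h = N.b ((h - 1) / 2) := by
  unfold own
  split_ifs with h3
  · left; congr 1; omega
  · right; congr 1; omega

theorem exists_half {e v : ℕ} (he : e < N.m) (hv : v = N.a e ∨ v = N.b e) :
    ∃ h, 1 ≤ h ∧ h ≤ 2 * N.m ∧ (h - 1) / 2 = e ∧ N.own h = v := by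
  rcases hv with rfl | rfl
  · refine ⟨2 * e + 1, by omega, by omega, by omega, ?_⟩
    unfold own
    rw [if_pos (by omega)]
    congr 1; omega
  · refine ⟨2 * e + 2, by omega, by omega, by omega, ?_⟩
    unfold own
    rw [if_neg (by omega)]
    congr 1; omega

theorem Ori.own_eq {c : ℕ → ℕ} (hc : N.Ori c) {h : ℕ} (h1 : 1 ≤ h) (h2 : h ≤ 2 * N.m)
    (hne : c ((h - 1) / 2) ≠ N.own h) : N.hd c ((h - 1) / 2) = N.own h := by
  rcases hc.hd_eq (e := (h - 1) / 2) (by omega) with h3 | h3 <;>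
    rcases N.own_mem h1 with h4 | h4 <;> omega

/-! ### Moving the pointer of a node along its incidence list -/

namespace Lists

variable {eid nxt fst : ℕ → ℕ} (L : N.Lists eid nxt fst)
include L

theorem isPtr_fst : N.IsPtr fst := fun v hv => ⟨L.fst_le v hv, L.own_fst v hv⟩

/-- Makes every condition on passed half-edges vacuous at the start of a search. -/
theorem not_passed_fst (h : ℕ) : ¬ N.Passed fst h := fun ⟨h1, h2, h3⟩ =>
  L.fst_gap _ (N.own_lt h1 h2) h h3 h2 rfl

variable {cur : ℕ → ℕ} (hc : N.IsPtr cur) {v : ℕ} (hv : v < N.n) (h0 : cur v ≠ 0)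
include hc hv h0

theorem isPtr_next : N.IsPtr (Function.update cur v (nxt (cur v))) := by
  intro w hw
  by_cases hvw : w = v
  · subst hvw
    simp only [Function.update_self]
    obtain ⟨h1, h2⟩ := hc w hw
    have h3 := L.nxt_lt (cur w) (by omega) h1
    exact ⟨by omega, fun h => (L.own_nxt (cur w) (by omega) h1 h).trans (h2 h0)⟩
  · rw [Function.update_of_ne hvw]
    exact hc w hw

/-- The list of `v` skips no half-edge at `v` (`nxt_gap`), so one move passes only the half-edge on
which the pointer stood. -/
theorem passed_next {h : ℕ} (hp : N.Passed (Function.update cur v (nxt (cur v))) h) :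
    N.Passed cur h ∨ h = cur v := by
  obtain ⟨h1, h2, h3⟩ := hp
  by_cases hvw : N.own h = v
  · rw [hvw, Function.update_self] at h3
    by_contra hcon
    push Not at hcon
    have h4 : ¬ cur v < h := fun h5 => hcon.1 ⟨h1, h2, by rwa [hvw]⟩
    obtain ⟨h5, h6⟩ := hc v hv
    exact L.nxt_gap (cur v) (by omega) h5 h h3 (by omega) (by rw [hvw, h6 h0])
  · rw [Function.update_of_ne hvw] at h3
    exact Or.inl ⟨h1, h2, h3⟩

theorem rest_next : N.rest (Function.update cur v (nxt (cur v))) + 1 ≤ N.rest cur := by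
  obtain ⟨h1, h2⟩ := hc v hv
  have h3 := L.nxt_lt (cur v) (by omega) h1
  apply Nat.succ_le_of_lt
  apply card_lt_card
  rw [Finset.ssubset_iff_of_subset]
  · refine ⟨cur v, ?_, ?_⟩
    · simp only [mem_filter, mem_Icc]
      rw [h2 h0]
      omega
    · simp only [mem_filter, mem_Icc, not_and, not_le]
      rw [h2 h0, Function.update_self]
      intros
      exact h3
  · intro h
    simp only [mem_filter, mem_Icc]
    rintro ⟨h4, h5⟩
    refine ⟨h4, ?_⟩
    by_cases hvw : N.own h = v
    · rw [hvw, Function.update_self] at h5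
      rw [hvw]
      omega
    · rwa [Function.update_of_ne hvw] at h5

end Lists

/-! ### The search for augmenting paths -/

variable (N) in
/-- `c` arises from `cb` by reversing the edges of a path that ends in `s` and that starts in `x`;
`par` stores the edges of the path, and the labels `d` increase by one along the path. All nodes
of the path but `s` satisfy `P`. -/
inductive Chain (par d : ℕ → ℕ) (P : ℕ → Prop) (s : ℕ) (cb : ℕ → ℕ) : (ℕ → ℕ) → ℕ → Prop
  | nil : Chain par d P s cb cb s
  | step {c : ℕ → ℕ} {x y e : ℕ} (h : Chain par d P s cb c y) (he : e < N.m)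
      (ho : x = N.a e ∨ x = N.b e) (ht : c e = x)
      (hh : N.hd c e = y) (hd : d x + 1 = d y) (hp : par x = e) (hP : P x) :
      Chain par d P s cb (Function.update c e y) x

namespace Chain

variable {par par' d cb c : ℕ → ℕ} {P : ℕ → Prop} {s x : ℕ}

/-- All labels on the path are at least `d x`, so writing to `par` at a node with a smaller label
does not disturb the path. -/
theorem congr_par (h : N.Chain par d P s cb c x) (hp : ∀ v, d x ≤ d v → par' v = par v) :
    N.Chain par' d P s cb c x := by
  induction h with
  | nil => exact .nil
  | step h he ho ht hh hd hpar hP ih =>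
    exact .step (ih fun v hv => hp v (by omega)) he ho ht hh hd ((hp _ le_rfl).trans hpar) hP

theorem eq_or_lt (h : N.Chain par d P s cb c x) : (x = s ∧ c = cb) ∨ (d x < d s ∧ P x) := by
  induction h with
  | nil => exact Or.inl ⟨rfl, rfl⟩
  | step h he ho ht hh hd hpar hP ih =>
    right
    refine ⟨?_, hP⟩
    rcases ih with ⟨rfl, rfl⟩ | h <;> omega

theorem le (h : N.Chain par d P s cb c x) : d x ≤ d s := by
  rcases h.eq_or_lt with ⟨rfl, -⟩ | h
  exacts [le_rfl, h.1.le]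

theorem pop (h : N.Chain par d P s cb c x) (hx : x ≠ s) :
    ∃ c' y, N.Chain par d P s cb c' y ∧ par x < N.m ∧ (x = N.a (par x) ∨ x = N.b (par x)) ∧
      c' (par x) = x ∧ N.hd c' (par x) = y ∧
      d x + 1 = d y ∧ c = Function.update c' (par x) y := by
  cases h with
  | nil => exact absurd rfl hx
  | step h he ho ht hh hd hpar hP =>
    subst hpar
    exact ⟨_, _, h, he, ho, ht, hh, hd, rfl⟩

end Chain

variable (N) in
/-- The value of `g` lies between the capacity and the indegree for `c₀`. -/
def Toward (cap c₀ g : ℕ → ℕ) : Prop :=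
  ∀ v, (cap v ≤ g v ∧ g v ≤ N.indeg c₀ v) ∨ (N.indeg c₀ v ≤ g v ∧ g v ≤ cap v)

variable (N) in
/-- The labels `d` increase by at most one along each edge. -/
def Valid (d c : ℕ → ℕ) : Prop := ∀ e < N.m, d (N.hd c e) ≤ d (c e) + 1

/-- The search only reverses edges whose end labels differ by one, so the labels stay valid for the
whole phase although the orientation changes. -/
theorem Valid.flip {d c : ℕ → ℕ} (h : N.Valid d c) (hc : N.Ori c) {e : ℕ} (he : e < N.m)
    (hd : d (c e) ≤ d (N.hd c e) + 1) : N.Valid d (Function.update c e (N.hd c e)) := by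
  intro e' he'
  by_cases hee : e' = e
  · subst hee
    rw [hd_update_self hc he, Function.update_self]
    exact hd
  · rw [hd_update_ne _ _ hee, Function.update_of_ne hee]
    exact h e' he'

variable (N) in
/-- A node is exhausted if its list is finished and if it is not below its capacity. Every passed
half-edge that could be used leads to an exhausted node. -/
def Blocked (cap d c cur : ℕ → ℕ) : Prop :=
  ∀ h, N.Passed cur h → d (c ((h - 1) / 2)) + 1 = d (N.own h) →
    cur (c ((h - 1) / 2)) = 0 ∧ cap (c ((h - 1) / 2)) ≤ N.indeg c (c ((h - 1) / 2))

variable (N) in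
/-- The invariant of the search from the nodes above their capacities. The current root is `s`, the
current path leads from `x` to `s` and has been reversed, and `b` holds the indegrees before
this reversal. -/
structure SearchInv (cap d c₀ c cur par : ℕ → ℕ) (s x abs : ℕ) (b : ℕ → ℕ) : Prop where
  ori : N.Ori c
  ptr : N.IsPtr cur
  s_le : s ≤ N.n
  x_lt : s < N.n → x < N.n
  x_eq : s = N.n → x = s
  valid : N.Valid d c
  blocked : N.Blocked cap d c cur
  chain : ∃ cb, N.Chain par d (fun v => cap v ≤ b v) s cb c x ∧ (abs = 0 → cb = c₀)
  base : ∀ v, N.indeg c v + (if v = s then 1 else 0) = b v + (if v = x then 1 else 0)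
  root : x ≠ s → cap s < b s
  toward : N.Toward cap c₀ b
  done : ∀ v < s, b v ≤ cap v ∨ cur v = 0
  absorbed : abs ≠ 0 → ∃ v < N.n, cap v ≤ b v ∧ b v < N.indeg c₀ v
  abs_le : abs ≤ 1

variable (N) in
/-- The potential of the search. -/
def searchPot (d cur : ℕ → ℕ) (s x : ℕ) : ℕ := (N.n - s) + 2 * N.rest cur + (d s - d x)

/-- The form in which the program updates its array of indegrees, by two writes. -/
theorem indeg_flip_eq {c : ℕ → ℕ} (h : N.Ori c) {e : ℕ} (he : e < N.m) :
    N.indeg (Function.update c e (N.hd c e)) =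
      Function.update (Function.update (N.indeg c) (N.hd c e) (N.indeg c (N.hd c e) - 1))
        (c e) (N.indeg c (c e) + 1) := by
  funext v
  have h1 := indeg_flip h he v
  have h2 := h.hd_ne he
  simp only [Function.update_apply]
  split_ifs at h1 ⊢ <;> subst_vars <;> omega

/-- The edge `e` itself is not counted at its tail. This keeps the increment of that indegree within
a word. -/
theorem indeg_tail_lt {c : ℕ → ℕ} (h : N.Ori c) {e : ℕ} (he : e < N.m) :
    N.indeg c (c e) + 1 ≤ N.m := by
  have h1 := indeg_flip h he (c e)
  have h2 := N.indeg_le (Function.update c e (N.hd c e)) (c e)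
  rw [if_pos rfl, if_neg (h.hd_ne he).symm] at h1
  omega

/-! ### The moves of the depth-first search -/

namespace SearchInv

variable {eid nxt fst cap d c₀ c cur par b : ℕ → ℕ} {s x abs : ℕ}

theorem start (L : N.Lists eid nxt fst) (ho : N.Ori c₀) (hv : N.Valid d c₀)
    (hcur : ∀ v < N.n, cur v = fst v) :
    N.SearchInv cap d c₀ c₀ cur par 0 0 0 (N.indeg c₀) where
  ori := ho
  ptr := fun v h => by rw [hcur v h]; exact L.isPtr_fst v h
  s_le := Nat.zero_le _
  x_lt := id
  x_eq := fun _ => rfl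
  valid := hv
  blocked := by
    rintro h ⟨h1, h2, h3⟩
    rw [hcur _ (own_lt h1 h2)] at h3
    exact absurd ⟨h1, h2, h3⟩ (L.not_passed_fst h)
  chain := ⟨c₀, .nil, fun _ => rfl⟩
  base := fun _ => rfl
  root := fun h => absurd rfl h
  toward := by
    intro v
    rcases le_total (cap v) (N.indeg c₀ v) with h | h
    · exact Or.inl ⟨h, le_rfl⟩
    · exact Or.inr ⟨le_rfl, h⟩
  done := fun v h => by omega
  absorbed := fun h => absurd rfl h
  abs_le := Nat.zero_le _

variable (I : N.SearchInv cap d c₀ c cur par s x abs b)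
include I

/-- Reversing the current path has carried one unit of indegree from `s` to `x`, and `x` had at
least `cap x` before. -/
theorem token (hx : x ≠ s) : cap x < N.indeg c x := by
  obtain ⟨cb, h1, -⟩ := I.chain
  have h2 := I.base x
  rw [if_pos rfl, if_neg hx] at h2
  rcases h1.eq_or_lt with h | h
  · exact absurd h.1 hx
  · have := h.2
    omega

theorem next (hs : s < N.n) (hx : x = s) (hd : N.indeg c s ≤ cap s ∨ cur s = 0) :
    N.SearchInv cap d c₀ c cur par (s + 1) (s + 1) abs b ∧
      N.searchPot d cur (s + 1) (s + 1) + 1 ≤ N.searchPot d cur s x := by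
  subst hx
  have hb : ∀ v, N.indeg c v = b v := fun v => by
    have := I.base v
    omega
  constructor
  · refine ⟨I.ori, I.ptr, hs, id, fun _ => rfl, I.valid, I.blocked, ?_, fun v => by rw [hb],
      fun h => absurd rfl h, I.toward, fun v hv => ?_, I.absorbed, I.abs_le⟩
    · obtain ⟨cb, h1, h2⟩ := I.chain
      rcases h1.eq_or_lt with ⟨-, rfl⟩ | h
      · exact ⟨_, .nil, h2⟩
      · omega
    · rcases Nat.lt_succ_iff_lt_or_eq.1 hv with h | rfl
      · exact I.done v h
      · rwa [hb] at hd
  · unfold searchPot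
    omega

theorem retreat (hx : x ≠ s) (h0 : cur x = 0) :
    par x < N.m ∧ x = N.hd c (par x) ∧
    N.SearchInv cap d c₀ (Function.update c (par x) x) cur par s (c (par x)) abs b ∧
      N.searchPot d cur s (c (par x)) + 1 ≤ N.searchPot d cur s x := by
  have htok := I.token hx
  obtain ⟨cb, hch, hcb⟩ := I.chain
  obtain ⟨c', y, h1, h2, h2', h3, h4, h5, h6⟩ := hch.pop hx
  set e := par x with he
  have hcy : c e = y := by rw [h6, Function.update_self]
  have hc' : Function.update c e x = c' := by
    rw [h6, Function.update_idem, ← h3, Function.update_eq_self]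
  have hhd : x = N.hd c e := by
    rw [hd, hcy, ← h4, hd, h3]
    omega
  have hflip := indeg_flip I.ori h2
  have hori := I.ori.flip h2
  have hval := I.valid.flip I.ori h2 (by rw [hcy, ← hhd]; omega)
  rw [← hhd] at hflip hori hval
  have hyn : y < N.n := by rw [← hcy]; exact I.ori.lt h2
  have hyx : y ≠ x := fun h => by rw [h] at h5; omega
  -- Undoing the last reversal takes a unit from `x` only, which by `token` has one to spare. So
  -- exhausted nodes stay exhausted.
  have hind : ∀ v, cap v ≤ N.indeg c v → cap v ≤ N.indeg (Function.update c e x) v := by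
    intro v hv
    have h7 := hflip v
    split_ifs at h7 <;> subst_vars <;> omega
  rw [hcy] at hflip ⊢
  refine ⟨h2, hhd, ⟨hori, I.ptr, I.s_le, fun _ => hyn, fun hs => absurd (I.x_eq hs) hx, hval, ?_,
    ?_, fun v => ?_, fun _ => I.root hx, I.toward, I.done, I.absorbed, I.abs_le⟩, ?_⟩
  · intro h hp hlab
    by_cases hee : (h - 1) / 2 = e
    · rw [hee, Function.update_self]
      exact ⟨h0, hind x htok.le⟩
    · rw [Function.update_of_ne hee] at hlab ⊢
      obtain ⟨h7, h8⟩ := I.blocked h hp hlab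
      exact ⟨h7, hind _ h8⟩
  · rw [hc']
    exact ⟨cb, h1, hcb⟩
  · have := I.base v
    have := hflip v
    omega
  · unfold searchPot
    have := h1.le
    omega

section scan

variable (L : N.Lists eid nxt fst) (hs : s < N.n) (hroot : x = s → cap s < N.indeg c s)
  (h0 : cur x ≠ 0)
include L hs hroot h0

theorem skip (hd : d (c (eid (cur x))) + 1 ≠ d x) :
    N.SearchInv cap d c₀ c (Function.update cur x (nxt (cur x))) par s x abs b ∧
      N.searchPot d (Function.update cur x (nxt (cur x))) s x + 1 ≤ N.searchPot d cur s x := by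
  have hxn := I.x_lt hs
  have hrest := L.rest_next I.ptr hxn h0
  constructor
  · refine ⟨I.ori, L.isPtr_next I.ptr hxn h0, I.s_le, I.x_lt, I.x_eq, I.valid, ?_, I.chain, I.base,
      I.root, I.toward, fun v hv => ?_, I.absorbed, I.abs_le⟩
    · intro h hp hlab
      obtain ⟨hx1, hx2⟩ := I.ptr x hxn
      rcases L.passed_next I.ptr hxn h0 hp with h1 | rfl
      · obtain ⟨h2, h3⟩ := I.blocked h h1 hlab
        refine ⟨?_, h3⟩
        rwa [Function.update_of_ne]
        intro h4
        exact h0 (by rwa [← h4])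
      · rw [← L.eid_eq _ (by omega) hx1, hx2 h0] at hlab
        exact absurd hlab hd
    · rcases I.done v hv with h | h
      · exact Or.inl h
      · right
        rwa [Function.update_of_ne]
        rintro rfl
        exact h0 h
  · unfold searchPot
    omega

/-- Passing a half-edge releases two units of potential and lengthening the path takes one back;
hence the factor 2 in `searchPot`. The indegree of `u` is compared after its increment, so `≤ cap u`
means that `u` was below its capacity and the path is complete. -/
theorem advance (hd : d (c (eid (cur x))) + 1 = d x) :
    eid (cur x) < N.m ∧ x = N.hd c (eid (cur x)) ∧
    let c' := Function.update c (eid (cur x)) x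
    let u := c (eid (cur x))
    let cur' := Function.update cur x (nxt (cur x))
    let par' := Function.update par u (eid (cur x))
    (N.indeg c' u ≤ cap u → (∃ b', N.SearchInv cap d c₀ c' cur' par' s s 1 b') ∧
      N.searchPot d cur' s s + 1 ≤ N.searchPot d cur s x) ∧
    (cap u < N.indeg c' u → N.SearchInv cap d c₀ c' cur' par' s u abs b ∧
      N.searchPot d cur' s u + 1 ≤ N.searchPot d cur s x) := by
  have hxn := I.x_lt hs
  have hrest := L.rest_next I.ptr hxn h0
  obtain ⟨hx1, hx2⟩ := I.ptr x hxn
  have hx2 := hx2 h0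
  have heid := L.eid_eq (cur x) (by omega) hx1
  have hem : eid (cur x) < N.m := by omega
  set e := eid (cur x) with he
  have hhd : x = N.hd c e := by
    rw [heid]
    rw [heid] at hd
    refine (hx2.symm.trans (I.ori.own_eq (by omega) hx1 fun h => ?_).symm)
    rw [h, hx2] at hd
    omega
  refine ⟨hem, hhd, ?_⟩
  intro c' u cur' par'
  change N.rest cur' + 1 ≤ _ at hrest
  have hflip := indeg_flip I.ori hem
  have hori := I.ori.flip hem
  have hval := I.valid.flip I.ori hem (by rw [← hhd]; omega)
  rw [← hhd] at hflip hori hval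
  have hue : c e = u := rfl
  rw [hue] at hd hflip
  change ∀ v, N.indeg c' v + _ = _ at hflip
  have hun : u < N.n := I.ori.lt hem
  have hux : u ≠ x := fun h => by rw [h] at hd; omega
  obtain ⟨cb, hch, hcb⟩ := I.chain
  have hxs := hch.le
  have hus : u ≠ s := fun h => by rw [h] at hd; omega
  have htok : cap x < N.indeg c x := by
    by_cases h : x = s
    · rw [h] at hroot ⊢
      exact hroot rfl
    · exact I.token h
  have hbs : cap s < b s := by
    by_cases h : x = s
    · have := I.base s
      rw [if_pos rfl, if_pos h.symm] at this
      have := hroot h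
      omega
    · exact I.root h
  -- The reversed edge now descends from `x` to `u`, so neither of its half-edges is usable. The
  -- only node that loses indegree is `x`, whose pointer is not `0`, so no exhausted node is
  -- affected.
  have hblocked : N.Blocked cap d c' cur' := by
    intro h hp hlab
    by_cases hee : (h - 1) / 2 = e
    · have h1 : c' ((h - 1) / 2) = x := by rw [hee]; exact Function.update_self _ _ _
      rw [h1] at hlab
      have h2 := own_mem (N := N) hp.1
      rw [hee] at h2
      have h3 := I.ori.hd_eq hem
      rw [← hhd] at h3
      have h4 : N.own h = x ∨ N.own h = u := by omega
      rcases h4 with h4 | h4 <;> rw [h4] at hlab <;> omega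
    · have h1 : c' ((h - 1) / 2) = c ((h - 1) / 2) := Function.update_of_ne hee _ _
      rw [h1] at hlab ⊢
      rcases L.passed_next I.ptr hxn h0 hp with h2 | rfl
      · obtain ⟨h3, h4⟩ := I.blocked h h2 hlab
        have h5 : c ((h - 1) / 2) ≠ x := fun h => h0 (by rwa [← h])
        refine ⟨(Function.update_of_ne h5 _ _).trans h3, ?_⟩
        have h6 := hflip (c ((h - 1) / 2))
        rw [if_neg h5] at h6
        omega
      · exact absurd heid.symm hee
  have hdone : ∀ v < s, b v ≤ cap v ∨ cur' v = 0 := by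
    intro v hv
    rcases I.done v hv with h | h
    · exact Or.inl h
    · right
      change Function.update cur x (nxt (cur x)) v = 0
      rwa [Function.update_of_ne]
      rintro rfl
      exact h0 h
  have hb : ∀ v, N.indeg c' v + (if v = s then 1 else 0) = b v + (if v = u then 1 else 0) := by
    intro v
    have := I.base v
    have := hflip v
    omega
  constructor
  · intro hcap
    have h1 : ∀ v, v ≠ s → v ≠ u → N.indeg c' v = b v := by
      intro v h2 h3
      have := hb v
      rwa [if_neg h2, if_neg h3] at this
    have h2 := hb s
    rw [if_pos rfl, if_neg hus.symm] at h2
    have h3 := hb u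
    rw [if_pos rfl, if_neg hus] at h3
    constructor
    -- The reversal becomes final: the actual indegrees are the new base, and the root `s`, which
    -- has lost a unit, witnesses `absorbed`.
    · refine ⟨N.indeg c', hori, L.isPtr_next I.ptr hxn h0, I.s_le, fun _ => hs, fun _ => rfl, hval,
        hblocked, ⟨c', .nil, fun h => absurd h one_ne_zero⟩, fun v => rfl, fun h => absurd rfl h,
        fun v => ?_, fun v hv => ?_, fun _ => ⟨s, hs, ?_, ?_⟩, le_rfl⟩
      · have h4 := I.toward v
        by_cases h5 : v = s
        · subst h5
          omega
        by_cases h6 : v = u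
        · rw [h6] at h4 ⊢
          omega
        · rw [h1 v h5 h6]
          exact h4
      · by_cases h6 : v = u
        · left
          rw [h6]
          exact hcap
        · rw [h1 v hv.ne h6]
          exact hdone v hv
      · omega
      · have := I.toward s
        omega
    · unfold searchPot
      omega
  · intro hcap
    have h3 := hb u
    rw [if_pos rfl, if_neg hus] at h3
    constructor
    · refine ⟨hori, L.isPtr_next I.ptr hxn h0, I.s_le, fun _ => hun, ?_, hval, hblocked, ?_, hb,
        fun _ => hbs, I.toward, hdone, I.absorbed, I.abs_le⟩
      · intro h
        omega
      · refine ⟨cb, .step (hch.congr_par fun v hv => ?_) hem (I.ori e hem) rfl hhd.symm hd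
          (Function.update_self _ _ _) (by omega), hcb⟩
        change Function.update par u e v = par v
        rw [Function.update_of_ne]
        rintro rfl
        omega
    · unfold searchPot
      omega

end scan

end SearchInv

end Net
end StarPartition

namespace StarPartition
namespace Net

open Finset

variable {N : Net}

/-! ### Distances from the nodes below their capacities -/

variable (N) in
/-- The loop invariant of the breadth-first search, with the queue `q 0, …, q (k - 1)` whose first
`i` nodes are finished. The label of a node that has not been reached is `n`. -/
structure BfsInv (cap c cur d q : ℕ → ℕ) (i k : ℕ) : Prop where
  ptr : N.IsPtr cur
  i_le : i ≤ k
  q_lt : ∀ j < k, q j < N.n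
  card : k = #{v ∈ range N.n | d v < N.n}
  le : ∀ v < N.n, d v ≤ N.n
  mem : ∀ v < N.n, d v < N.n → ∃ j < k, q j = v
  q_le : ∀ j < k, d (q j) ≤ j
  mono : ∀ j j', j ≤ j' → j' < k → d (q j) ≤ d (q j')
  near : ∀ j < k, i < k → d (q j) ≤ d (q i) + 1
  zero : ∀ v < N.n, d v = 0 ↔ N.indeg c v < cap v
  tight : ∀ v < N.n, d v < N.n → d v ≠ 0 → ∃ e < N.m, N.hd c e = v ∧ d (c e) + 1 = d v
  passed : ∀ h, N.Passed cur h → d (N.own h) < N.n ∧ (c ((h - 1) / 2) = N.own h →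
    d (N.hd c ((h - 1) / 2)) ≤ d (N.own h) + 1 ∧ d (N.hd c ((h - 1) / 2)) < N.n)
  fin : ∀ j < i, cur (q j) = 0

variable (N) in
/-- `d` holds the distances from the nodes below their capacities, and `n` if there is none. -/
structure IsDist (cap d c : ℕ → ℕ) : Prop where
  le : ∀ v < N.n, d v ≤ N.n
  zero : ∀ v < N.n, d v = 0 ↔ N.indeg c v < cap v
  tight : ∀ v < N.n, d v < N.n → d v ≠ 0 → ∃ e < N.m, N.hd c e = v ∧ d (c e) + 1 = d v
  valid : N.Valid d c
  closed : ∀ e < N.m, d (c e) < N.n → d (N.hd c e) < N.n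

variable (N) in
/-- The loop invariant of the initialization of the breadth-first search. -/
structure BfsStart (cap fst c cur d q : ℕ → ℕ) (i k : ℕ) : Prop where
  i_le : i ≤ N.n
  cur_eq : ∀ v < i, cur v = fst v
  d_eq : ∀ v < i, d v = if N.indeg c v < cap v then 0 else N.n
  q_lt : ∀ j < k, q j < i ∧ N.indeg c (q j) < cap (q j)
  mem : ∀ v < i, N.indeg c v < cap v → ∃ j < k, q j = v
  card : k = #{v ∈ range i | N.indeg c v < cap v}

namespace BfsStart

variable {cap eid nxt fst c cur d q : ℕ → ℕ} {i k : ℕ}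

theorem zero : N.BfsStart cap fst c cur d q 0 0 :=
  ⟨Nat.zero_le _, by simp, by simp, by simp, by simp, by simp⟩

variable (I : N.BfsStart cap fst c cur d q i k)
include I

theorem k_le : k ≤ i := by
  rw [I.card]
  exact (card_filter_le _ _).trans (by simp)

theorem push (hi : i < N.n) (h : N.indeg c i < cap i) :
    N.BfsStart cap fst c (Function.update cur i (fst i)) (Function.update d i 0)
      (Function.update q k i) (i + 1) (k + 1) := by
  refine ⟨hi, fun v hv => ?_, fun v hv => ?_, fun j hj => ?_, fun v hv hd => ?_, ?_⟩
  · rcases Nat.lt_succ_iff_lt_or_eq.1 hv with hv | rfl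
    · rw [Function.update_of_ne hv.ne, I.cur_eq v hv]
    · rw [Function.update_self]
  · rcases Nat.lt_succ_iff_lt_or_eq.1 hv with hv | rfl
    · rw [Function.update_of_ne hv.ne, I.d_eq v hv]
    · rw [Function.update_self, if_pos h]
  · rcases Nat.lt_succ_iff_lt_or_eq.1 hj with hj | rfl
    · rw [Function.update_of_ne hj.ne]
      have := I.q_lt j hj
      omega
    · rw [Function.update_self]
      exact ⟨by omega, h⟩
  · rcases Nat.lt_succ_iff_lt_or_eq.1 hv with hv | rfl
    · obtain ⟨j, hj, h1⟩ := I.mem v hv hd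
      exact ⟨j, by omega, by rwa [Function.update_of_ne hj.ne]⟩
    · exact ⟨k, by omega, Function.update_self _ _ _⟩
  · rw [range_add_one, filter_insert, if_pos h, card_insert_of_notMem (by simp), ← I.card]

theorem pass (hi : i < N.n) (h : ¬ N.indeg c i < cap i) :
    N.BfsStart cap fst c (Function.update cur i (fst i)) (Function.update d i N.n) q (i + 1) k := by
  refine ⟨hi, fun v hv => ?_, fun v hv => ?_, fun j hj => ?_, fun v hv hd => ?_, ?_⟩
  · rcases Nat.lt_succ_iff_lt_or_eq.1 hv with hv | rfl
    · rw [Function.update_of_ne hv.ne, I.cur_eq v hv]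
    · rw [Function.update_self]
  · rcases Nat.lt_succ_iff_lt_or_eq.1 hv with hv | rfl
    · rw [Function.update_of_ne hv.ne, I.d_eq v hv]
    · rw [Function.update_self, if_neg h]
  · have := I.q_lt j hj
    omega
  · rcases Nat.lt_succ_iff_lt_or_eq.1 hv with hv | rfl
    · exact I.mem v hv hd
    · exact absurd hd h
  · rw [range_add_one, filter_insert, if_neg h, ← I.card]

theorem bfsInv (L : N.Lists eid nxt fst) (hi : i = N.n) : N.BfsInv cap c cur d q 0 k := by
  subst hi
  have hd : ∀ v < N.n, d v < N.n ↔ N.indeg c v < cap v := by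
    intro v hv
    rw [I.d_eq v hv]
    split_ifs with h <;> omega
  have hq : ∀ j < k, d (q j) = 0 := by
    intro j hj
    obtain ⟨h1, h2⟩ := I.q_lt j hj
    rw [I.d_eq _ h1, if_pos h2]
  refine ⟨fun v hv => ?_, Nat.zero_le _, fun j hj => (I.q_lt j hj).1, ?_, fun v hv => ?_,
    fun v hv h => I.mem v hv ((hd v hv).1 h), fun j hj => by rw [hq j hj]; omega,
    fun j j' h1 h2 => by rw [hq j (by omega)]; omega, fun j hj _ => by rw [hq j hj]; omega,
    fun v hv => ?_, fun v hv h1 h2 => ?_, fun h hp => ?_, by simp⟩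
  · rw [I.cur_eq v hv]
    exact L.isPtr_fst v hv
  · rw [I.card]
    congr 1
    exact filter_congr fun v hv => (hd v (mem_range.1 hv)).symm
  · rw [I.d_eq v hv]
    split_ifs <;> omega
  · rw [I.d_eq v hv]
    split_ifs with h <;> simp [h]
    omega
  · rw [I.d_eq v hv, if_pos ((hd v hv).1 h1)] at h2
    exact absurd rfl h2
  · exfalso
    obtain ⟨h1, h2, h3⟩ := hp
    rw [I.cur_eq _ (own_lt h1 h2)] at h3
    exact L.not_passed_fst h ⟨h1, h2, h3⟩

end BfsStart

variable (N) in
/-- The potential of the breadth-first search. -/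
def bfsPot (cur : ℕ → ℕ) (i : ℕ) : ℕ := (N.n - i) + N.rest cur

namespace BfsInv

variable {cap eid nxt fst c cur d q : ℕ → ℕ} {i k : ℕ} (I : N.BfsInv cap c cur d q i k)
include I

theorem k_le : k ≤ N.n := by
  rw [I.card]
  exact (card_filter_le _ _).trans (by simp)

theorem q_d_lt {j : ℕ} (hj : j < k) : d (q j) < N.n :=
  (I.q_le j hj).trans_lt (hj.trans_le I.k_le)

/-- All reached nodes are finished, so every edge leaving one has been passed and its head is
labelled. -/
theorem isDist (ho : N.Ori c) (hi : i = k) : N.IsDist cap d c := by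
  have key : ∀ e < N.m, d (c e) < N.n →
      d (N.hd c e) ≤ d (c e) + 1 ∧ d (N.hd c e) < N.n := by
    intro e he hd
    obtain ⟨j, hj, hq⟩ := I.mem _ (ho.lt he) hd
    have h1 := I.fin j (hi ▸ hj)
    rw [hq] at h1
    obtain ⟨h, h2, h3, h4, h5⟩ := exists_half he (ho e he)
    have h6 := (I.passed h ⟨h2, h3, by rw [h5, h1]; omega⟩).2 (by rw [h4, h5])
    rwa [h4, h5] at h6
  refine ⟨I.le, I.zero, I.tight, fun e he => ?_, fun e he h => (key e he h).2⟩
  by_cases h : d (c e) < N.n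
  · exact (key e he h).1
  · have := I.le _ (ho.hd_lt he)
    omega

theorem finish (hi : i < k) (h0 : cur (q i) = 0) :
    N.BfsInv cap c cur d q (i + 1) k ∧ N.bfsPot cur (i + 1) + 1 ≤ N.bfsPot cur i := by
  constructor
  · refine ⟨I.ptr, hi, I.q_lt, I.card, I.le, I.mem, I.q_le, I.mono, fun j hj h => ?_, I.zero,
      I.tight, I.passed, fun j hj => ?_⟩
    · have := I.near j hj hi
      have := I.mono i (i + 1) (by omega) h
      omega
    · rcases Nat.lt_succ_iff_lt_or_eq.1 hj with hj | rfl
      · exact I.fin j hj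
      · exact h0
  · have := I.k_le
    unfold bfsPot
    omega

variable (L : N.Lists eid nxt fst) (hi : i < k) (h0 : cur (q i) ≠ 0)
include L hi h0

theorem half : eid (cur (q i)) = (cur (q i) - 1) / 2 ∧ eid (cur (q i)) < N.m ∧
    N.own (cur (q i)) = q i := by
  obtain ⟨hx1, hx2⟩ := I.ptr _ (I.q_lt i hi)
  have := L.eid_eq (cur (q i)) (by omega) hx1
  exact ⟨this, by omega, hx2 h0⟩

theorem skip (h : c (eid (cur (q i))) = q i → d (N.hd c (eid (cur (q i)))) < N.n) (ho : N.Ori c) :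
    N.BfsInv cap c (Function.update cur (q i) (nxt (cur (q i)))) d q i k ∧
      N.bfsPot (Function.update cur (q i) (nxt (cur (q i)))) i + 1 ≤ N.bfsPot cur i := by
  have hrest := L.rest_next I.ptr (I.q_lt i hi) h0
  obtain ⟨h1, h2, h3⟩ := I.half L hi h0
  constructor
  · refine ⟨L.isPtr_next I.ptr (I.q_lt i hi) h0, I.i_le, I.q_lt, I.card, I.le, I.mem, I.q_le,
      I.mono, I.near, I.zero, I.tight, fun g hp => ?_, fun j hj => ?_⟩
    · rcases L.passed_next I.ptr (I.q_lt i hi) h0 hp with h4 | rfl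
      · exact I.passed g h4
      · rw [h3, ← h1]
        refine ⟨I.q_d_lt hi, fun h5 => ⟨?_, h h5⟩⟩
        -- A head that has been reached is in the queue, where `near` bounds its label.
        obtain ⟨j, hj, h6⟩ := I.mem _ (ho.hd_lt h2) (h h5)
        rw [← h6]
        exact I.near j hj hi
    · rw [Function.update_of_ne]
      · exact I.fin j hj
      · intro h4
        rw [← h4] at h0
        exact h0 (I.fin j hj)
  · unfold bfsPot
    omega

theorem push (h : c (eid (cur (q i))) = q i) (hd : ¬ d (N.hd c (eid (cur (q i)))) < N.n)
    (ho : N.Ori c) :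
    let v := N.hd c (eid (cur (q i)))
    let cur' := Function.update cur (q i) (nxt (cur (q i)))
    k < N.n ∧ N.BfsInv cap c cur' (Function.update d v (d (q i) + 1)) (Function.update q k v) i
      (k + 1) ∧ N.bfsPot cur' i + 1 ≤ N.bfsPot cur i := by
  intro v cur'
  have hrest := L.rest_next I.ptr (I.q_lt i hi) h0
  obtain ⟨h1, h2, h3⟩ := I.half L hi h0
  have hvn : v < N.n := ho.hd_lt h2
  have hdv : d v = N.n := by
    have := I.le v hvn
    change ¬ d v < N.n at hd
    omega
  -- Labels are bounded by queue positions, which keeps the new label below the value `n` reserved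
  -- for unreached nodes.
  have hdi := I.q_le i hi
  have hcard : k + 1 = #{w ∈ range N.n | Function.update d v (d (q i) + 1) w < N.n} ∧ k < N.n := by
    have h4 : k < N.n := by
      rw [I.card]
      calc _ < #(range N.n) := by
            apply card_lt_card
            rw [filter_ssubset]
            exact ⟨v, mem_range.2 hvn, hd⟩
        _ = N.n := card_range _
    refine ⟨?_, h4⟩
    have h5 : ({w ∈ range N.n | Function.update d v (d (q i) + 1) w < N.n} : Finset ℕ) =
        insert v {w ∈ range N.n | d w < N.n} := by
      ext w
      simp only [mem_filter, mem_insert, mem_range]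
      by_cases hw : w = v
      · subst hw
        simp only [Function.update_self, true_or, iff_true]
        exact ⟨hvn, by omega⟩
      · simp [hw]
    rw [h5, card_insert_of_notMem, ← I.card]
    simp [hdv]
  obtain ⟨hcard, hkn⟩ := hcard
  have hqv : ∀ j < k, q j ≠ v := by
    intro j hj h4
    have := I.q_d_lt hj
    rw [h4] at this
    exact hd this
  refine ⟨hkn, ?_, ?_⟩
  · have hdq : ∀ j < k, Function.update d v (d (q i) + 1) (Function.update q k v j) = d (q j) := by
      intro j hj
      rw [Function.update_of_ne hj.ne, Function.update_of_ne (hqv j hj)]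
    have hdk : Function.update d v (d (q i) + 1) (Function.update q k v k) = d (q i) + 1 := by
      simp
    refine ⟨L.isPtr_next I.ptr (I.q_lt i hi) h0, by omega, fun j hj => ?_, hcard, fun w hw => ?_,
      fun w hw hwd => ?_, fun j hj => ?_, fun j j' hjj hj' => ?_, fun j hj _ => ?_, fun w hw => ?_,
      fun w hw hwd hwd' => ?_, fun g hp => ?_, fun j hj => ?_⟩
    · rcases Nat.lt_succ_iff_lt_or_eq.1 hj with hj | rfl
      · rw [Function.update_of_ne hj.ne]
        exact I.q_lt j hj
      · rwa [Function.update_self]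
    · by_cases hwv : w = v
      · rw [hwv, Function.update_self]
        omega
      · rw [Function.update_of_ne hwv]
        exact I.le w hw
    · by_cases hwv : w = v
      · exact ⟨k, by omega, by rw [hwv, Function.update_self]⟩
      · rw [Function.update_of_ne hwv] at hwd
        obtain ⟨j, hj, h4⟩ := I.mem w hw hwd
        exact ⟨j, by omega, by rwa [Function.update_of_ne hj.ne]⟩
    · rcases Nat.lt_succ_iff_lt_or_eq.1 hj with hj | rfl
      · rw [hdq j hj]
        exact I.q_le j hj
      · rw [hdk]
        omega
    · rcases Nat.lt_succ_iff_lt_or_eq.1 hj' with hj' | rfl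
      · rw [hdq j (by omega), hdq j' hj']
        exact I.mono j j' hjj hj'
      · rw [hdk]
        rcases hjj.lt_or_eq with hj | rfl
        · rw [hdq j hj]
          exact I.near j hj hi
        · rw [hdk]
    · rw [hdq i hi]
      rcases Nat.lt_succ_iff_lt_or_eq.1 hj with hj | rfl
      · rw [hdq j hj]
        exact I.near j hj hi
      · rw [hdk]
    · by_cases hwv : w = v
      · rw [hwv, Function.update_self, ← I.zero v hvn]
        omega
      · rw [Function.update_of_ne hwv]
        exact I.zero w hw
    · by_cases hwv : w = v
      · refine ⟨_, h2, hwv.symm, ?_⟩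
        rw [h, hwv, Function.update_self, Function.update_of_ne (hqv i hi)]
      · rw [Function.update_of_ne hwv] at hwd hwd' ⊢
        obtain ⟨e, he, h4, h5⟩ := I.tight w hw hwd hwd'
        refine ⟨e, he, h4, ?_⟩
        rwa [Function.update_of_ne]
        intro h6
        rw [h6] at h5
        omega
    · rcases L.passed_next I.ptr (I.q_lt i hi) h0 hp with h4 | rfl
      · obtain ⟨h5, h6⟩ := I.passed g h4
        have h7 : N.own g ≠ v := fun h => by rw [h] at h5; omega
        rw [Function.update_of_ne h7]
        refine ⟨h5, fun h8 => ?_⟩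
        obtain ⟨h9, h10⟩ := h6 h8
        rw [Function.update_of_ne]
        · exact ⟨h9, h10⟩
        · intro h
          rw [h] at h10
          omega
      · rw [h3, ← h1, Function.update_of_ne (hqv i hi)]
        refine ⟨I.q_d_lt hi, fun _ => ?_⟩
        change Function.update d v (d (q i) + 1) v ≤ _ ∧ Function.update d v (d (q i) + 1) v < _
        rw [Function.update_self]
        omega
    · rw [Function.update_of_ne (by omega)]
      change Function.update cur (q i) (nxt (cur (q i))) (q j) = 0
      rw [Function.update_of_ne]
      · exact I.fin j hj
      · intro h4
        rw [← h4] at h0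
        exact h0 (I.fin j hj)
  · change N.rest cur' + 1 ≤ _ at hrest
    unfold bfsPot
    omega

end BfsInv

/-! ### The number of phases -/

variable (N) in
/-- The result of a phase that starts with `c₀` and the distances `d` and ends with `c`. -/
structure PhaseEnd (cap d c₀ c cur : ℕ → ℕ) (abs : ℕ) : Prop where
  ori : N.Ori c
  valid : N.Valid d c
  blocked : N.Blocked cap d c cur
  toward : N.Toward cap c₀ (N.indeg c)
  done : ∀ v < N.n, N.indeg c v ≤ cap v ∨ cur v = 0
  eq : abs = 0 → c = c₀
  absorbed : abs ≠ 0 → ∃ v < N.n, cap v ≤ N.indeg c v ∧ N.indeg c v < N.indeg c₀ v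
  abs_le : abs ≤ 1

theorem SearchInv.phaseEnd {cap d c₀ c cur par b : ℕ → ℕ} {s x abs : ℕ}
    (I : N.SearchInv cap d c₀ c cur par s x abs b) (hs : s = N.n) :
    N.PhaseEnd cap d c₀ c cur abs := by
  have hx := I.x_eq hs
  subst hx
  have hb : N.indeg c = b := funext fun v => by
    have := I.base v
    omega
  have h1 := I.toward
  have h2 := I.done
  have h3 := I.absorbed
  rw [← hb, hs] at h2
  rw [← hb] at h1 h3
  refine ⟨I.ori, I.valid, I.blocked, h1, h2, fun h => ?_, h3, I.abs_le⟩
  obtain ⟨cb, h4, h5⟩ := I.chain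
  rcases h4.eq_or_lt with ⟨-, h6⟩ | h6
  · rw [h6, h5 h]
  · omega

/-! ### Edges entering a set of nodes, and infeasibility -/

variable (N) in
def cut (S : Finset ℕ) (c : ℕ → ℕ) : ℕ := #{e ∈ range N.m | N.hd c e ∈ S ∧ c e ∉ S}

variable (N) in
def inside (S : Finset ℕ) : ℕ := #{e ∈ range N.m | N.a e ∈ S ∧ N.b e ∈ S}

/-- An edge inside `S` counts once whichever way it points, so the orientation matters only through
the cut. -/
theorem sum_indeg {c : ℕ → ℕ} (ho : N.Ori c) (S : Finset ℕ) :
    ∑ v ∈ S, N.indeg c v = N.cut S c + N.inside S := by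
  have h1 : ∑ v ∈ S, N.indeg c v = #{e ∈ range N.m | N.hd c e ∈ S} := by
    unfold indeg
    rw [card_eq_sum_card_fiberwise (s := {e ∈ range N.m | N.hd c e ∈ S}) (f := N.hd c) (t := S)
      (fun e he => (mem_filter.1 (mem_coe.1 he)).2)]
    refine sum_congr rfl fun v hv => ?_
    rw [filter_filter]
    congr 1
    refine filter_congr fun e _ => ⟨fun h => ⟨h ▸ hv, h⟩, fun h => h.2⟩
  rw [h1, cut, inside, ← card_union_of_disjoint]
  · congr 1
    ext e
    simp only [mem_filter, mem_union, mem_range]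
    by_cases he : e < N.m
    · rcases ho.hd_eq he with ⟨h2, h3⟩ | ⟨h2, h3⟩ <;> rw [h2, h3] <;> tauto
    · tauto
  · rw [disjoint_filter]
    intro e he h2 h3
    rcases ho.hd_eq (mem_range.1 he) with ⟨h4, h5⟩ | ⟨h4, h5⟩ <;> rw [h4] at h2 <;> tauto

namespace PhaseEnd

variable {cap d c₀ c cur : ℕ → ℕ} {abs : ℕ}

/-- The nodes at distance `n` form a set `S` that no edge enters, so its indegree sum is minimal
among all orientations. No node of `S` is below its capacity, and `w` is above; hence every
orientation exceeds a capacity in `S`. -/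
theorem exists_gt (h : N.PhaseEnd cap d c₀ c cur 0) (hd : N.IsDist cap d c₀)
    (hex : ∃ v < N.n, cap v < N.indeg c v) {c' : ℕ → ℕ} (ho : N.Ori c') :
    ∃ v < N.n, cap v < N.indeg c' v := by
  obtain rfl := h.eq rfl
  -- Exhaustion spreads backwards along tight edges by `Blocked`. From a reachable node it would
  -- arrive at distance `0`, where nodes are below their capacities.
  have key : ∀ k, ∀ v < N.n, d v = k → cap v ≤ N.indeg c v → cur v = 0 → d v = N.n := by
    intro k
    induction k with
    | zero =>
      intro v hv h1 h2 h3
      have := (hd.zero v hv).1 h1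
      omega
    | succ k ih =>
      intro v hv h1 h2 h3
      by_contra hne
      have hle := hd.le v hv
      obtain ⟨e, he, h4, h5⟩ := hd.tight v hv (by omega) (by omega)
      obtain ⟨g, g1, g2, g3, g4⟩ := exists_half (v := v) he (by
        rcases h.ori.hd_eq he with h6 | h6 <;> omega)
      have h6 := h.blocked g ⟨g1, g2, by rw [g4, h3]; omega⟩ (by rw [g3, g4, h5])
      rw [g3] at h6
      have := ih _ (h.ori.lt he) (by omega) h6.2 h6.1
      omega
  set S : Finset ℕ := {v ∈ range N.n | d v = N.n} with hS
  have hcut : N.cut S c = 0 := by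
    rw [cut, card_eq_zero, filter_eq_empty_iff]
    rintro e he ⟨h1, h2⟩
    rw [mem_range] at he
    rw [hS, mem_filter] at h1 h2
    have h3 := h.ori.lt he
    have h4 := hd.le _ h3
    have h5 := hd.closed e he
    rw [mem_range] at h2
    have : d (c e) ≠ N.n := fun h => h2 ⟨h3, h⟩
    omega
  have h1 := sum_indeg h.ori S
  have h2 := sum_indeg ho S
  obtain ⟨w, hw, hcw⟩ := hex
  have hwS : w ∈ S := by
    rw [hS, mem_filter]
    refine ⟨mem_range.2 hw, key _ w hw rfl hcw.le ?_⟩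
    have := h.done w hw
    omega
  have h3 : ∑ v ∈ S, cap v < ∑ v ∈ S, N.indeg c v := by
    refine sum_lt_sum (fun v hv => ?_) ⟨w, hwS, hcw⟩
    rw [hS, mem_filter, mem_range] at hv
    have := hd.zero v hv.1
    omega
  obtain ⟨v, hv, h4⟩ := exists_lt_of_sum_lt (show ∑ v ∈ S, cap v < ∑ v ∈ S, N.indeg c' v by omega)
  exact ⟨v, mem_range.1 (mem_filter.1 hv).1, h4⟩

end PhaseEnd

/-! ### Growth of the distance -/

variable (N) in
/-- The nodes above their capacities have at least the distance `t` from the nodes below. -/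
def Far (cap : ℕ → ℕ) (t : ℕ) (c : ℕ → ℕ) : Prop :=
  ∃ l : ℕ → ℕ, N.Valid l c ∧ (∀ v < N.n, N.indeg c v < cap v → l v = 0) ∧
    ∀ v < N.n, cap v < N.indeg c v → t ≤ l v

/-- Along a tight path from a node of label `0`, a valid labelling cannot grow faster than the
distance. -/
theorem IsDist.le_of_valid {cap d l c : ℕ → ℕ} (hd : N.IsDist cap d c) (ho : N.Ori c)
    (hl : N.Valid l c) (h0 : ∀ v < N.n, N.indeg c v < cap v → l v = 0) :
    ∀ k, ∀ v < N.n, d v = k → d v < N.n → l v ≤ d v := by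
  intro k
  induction k with
  | zero =>
    intro v hv h1 h2
    rw [h0 v hv ((hd.zero v hv).1 h1)]
    omega
  | succ k ih =>
    intro v hv h1 h2
    obtain ⟨e, he, h4, h5⟩ := hd.tight v hv (by omega) (by omega)
    have := ih (c e) (ho.lt he) (by omega) (by omega)
    have := hl e he
    rw [h4] at this
    omega

/-- The new labelling adds one to `d` at the exhausted nodes. It is valid because `Blocked` makes
the tail of a tight edge exhausted whenever its head is. By `done` every node still above its
capacity is exhausted, and by `toward` no node changes sides. -/
theorem Far.step {cap d c₀ c cur : ℕ → ℕ} {abs t : ℕ} (h : N.Far cap t c₀) (ht : t ≤ N.n)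
    (ho : N.Ori c₀) (hd : N.IsDist cap d c₀) (hp : N.PhaseEnd cap d c₀ c cur abs) :
    N.Far cap (t + 1) c := by
  obtain ⟨l, h1, h2, h3⟩ := h
  refine ⟨fun v => d v + if cur v = 0 ∧ cap v ≤ N.indeg c v then 1 else 0, fun e he => ?_,
    fun v hv hcap => ?_, fun v hv hcap => ?_⟩
  · have h4 := hp.valid e he
    dsimp only
    by_cases h5 : cur (N.hd c e) = 0 ∧ cap (N.hd c e) ≤ N.indeg c (N.hd c e)
    · rw [if_pos h5]
      by_cases h6 : d (c e) + 1 = d (N.hd c e)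
      · obtain ⟨g, g1, g2, g3, g4⟩ := exists_half (v := N.hd c e) he (by
          rcases hp.ori.hd_eq he with h6 | h6 <;> omega)
        have h7 := hp.blocked g ⟨g1, g2, by rw [g4, h5.1]; omega⟩ (by rw [g3, g4, h6])
        rw [g3] at h7
        rw [if_pos h7]
        omega
      · omega
    · rw [if_neg h5]
      omega
  · have h4 := hp.toward v
    dsimp only
    rw [if_neg (by omega), (hd.zero v hv).2 (by omega)]
  · have h4 := hp.toward v
    have h5 := hp.done v hv
    dsimp only
    rw [if_pos (by omega)]
    by_cases h6 : d v < N.n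
    · have := hd.le_of_valid ho h1 h2 _ v hv rfl h6
      have := h3 v hv (by omega)
      omega
    · omega

/-! ### Shrinking cuts and the count of the phases -/

variable (N) in
/-- `S` separates the nodes above their capacities from those below, and at most `r` edges
enter `S`. -/
structure Separates (cap : ℕ → ℕ) (S : Finset ℕ) (r : ℕ) (c : ℕ → ℕ) : Prop where
  subset : S ⊆ range N.n
  below : ∀ v < N.n, N.indeg c v < cap v → v ∉ S
  above : ∀ v < N.n, cap v < N.indeg c v → v ∈ S
  cut_le : N.cut S c ≤ r

/-- By `toward` only nodes below their capacities can gain indegree, so no node of `S` does. The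
node from `absorbed` was above its capacity, hence lies in `S`, and loses. By `sum_indeg` the cut
shrinks. -/
theorem Separates.step {cap d c₀ c cur : ℕ → ℕ} {abs r : ℕ} {S : Finset ℕ}
    (h : N.Separates cap S r c₀) (ho : N.Ori c₀) (hp : N.PhaseEnd cap d c₀ c cur abs)
    (habs : abs ≠ 0) : ∃ r', r' + 1 = r ∧ N.Separates cap S r' c := by
  have h1 := sum_indeg ho S
  have h2 := sum_indeg hp.ori S
  have h3 : ∑ v ∈ S, N.indeg c v < ∑ v ∈ S, N.indeg c₀ v := by
    obtain ⟨w, hw, h4, h5⟩ := hp.absorbed habs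
    refine sum_lt_sum (fun v hv => ?_) ⟨w, h.above w hw (by omega), h5⟩
    have h6 := h.below v (mem_range.1 (h.subset hv))
    have h7 := hp.toward v
    by_contra h8
    exact h6 (by omega) hv
  have h4 := h.cut_le
  refine ⟨r - 1, by omega, h.subset, fun v hv hcap => ?_, fun v hv hcap => ?_, by omega⟩
  · have := hp.toward v
    exact h.below v hv (by omega)
  · have := hp.toward v
    exact h.above v hv (by omega)

variable (N) in
/-- Some level set among `D` consecutive ones is entered by at most `M` edges. -/
def CutBound (D M : ℕ) : Prop :=
  ∀ c l : ℕ → ℕ, N.Ori c → N.Valid l c →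
    ∃ i, 1 ≤ i ∧ i ≤ D ∧ N.cut {v ∈ range N.n | i ≤ l v} c ≤ M

theorem Far.separates {cap c : ℕ → ℕ} {D M : ℕ} (h : N.Far cap D c) (ho : N.Ori c)
    (hM : N.CutBound D M) : ∃ S, N.Separates cap S M c := by
  obtain ⟨l, h1, h2, h3⟩ := h
  obtain ⟨i, hi, hiD, hcut⟩ := hM c l ho h1
  refine ⟨_, filter_subset _ _, fun v hv hcap => ?_, fun v hv hcap => ?_, hcut⟩
  · rw [mem_filter, h2 v hv hcap]
    omega
  · rw [mem_filter, mem_range]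
    exact ⟨hv, hiD.trans (h3 v hv hcap)⟩

variable (N) in
/-- A reason why at most `k` phases are still to come. -/
def Remaining (cap : ℕ → ℕ) (D M k : ℕ) (c : ℕ → ℕ) : Prop :=
  (∃ t, t ≤ D ∧ k = D - t + M + 1 ∧ N.Far cap t c) ∨ ∃ S r, k = r + 1 ∧ N.Separates cap S r c

theorem Remaining.start (cap : ℕ → ℕ) (D M : ℕ) (c : ℕ → ℕ) :
    N.Remaining cap D M (D + M + 1) c :=
  Or.inl ⟨0, Nat.zero_le _, rfl, fun _ => 0, fun _ _ => by simp, fun _ _ _ => rfl,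
    fun _ _ _ => le_rfl⟩

theorem Remaining.pos {cap : ℕ → ℕ} {D M k : ℕ} {c : ℕ → ℕ} (h : N.Remaining cap D M k c) :
    1 ≤ k := by
  rcases h with ⟨t, -, h, -⟩ | ⟨S, r, h, -⟩ <;> omega

/-- At `t = D` both alternatives count `M + 1`, so changing from distances to cuts is free. The `+
1` stands for the last phase, which moves nothing. -/
theorem Remaining.step {cap d c₀ c cur : ℕ → ℕ} {D M k abs : ℕ}
    (h : N.Remaining cap D M k c₀) (hD : D ≤ N.n) (hM : N.CutBound D M) (ho : N.Ori c₀)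
    (hd : N.IsDist cap d c₀) (hp : N.PhaseEnd cap d c₀ c cur abs) (habs : abs ≠ 0) :
    ∃ k', k' + 1 = k ∧ N.Remaining cap D M k' c := by
  have key : ∀ S r, N.Separates cap S r c₀ →
      ∃ k', k' + 1 = r + 1 ∧ N.Remaining cap D M k' c := by
    intro S r hS
    obtain ⟨r', h1, h2⟩ := hS.step ho hp habs
    exact ⟨r, rfl, Or.inr ⟨S, r', h1.symm, h2⟩⟩
  rcases h with ⟨t, ht, hk, hf⟩ | ⟨S, r, hk, hS⟩
  · rcases ht.lt_or_eq with ht | rfl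
    · exact ⟨D - (t + 1) + M + 1, by omega,
        Or.inl ⟨t + 1, ht, rfl, hf.step (ht.le.trans hD) ho hd hp⟩⟩
    · obtain ⟨S, hS⟩ := hf.separates ho hM
      obtain ⟨k', h1, h2⟩ := key S M hS
      exact ⟨k', by omega, h2⟩
  · rw [hk]
    exact key S r hS

end Net
end StarPartition

namespace StarPartition
set_option linter.unusedSimpArgs false

namespace Net

open StarPartition.Expr Prog

variable {N : Net}

/-! ### The program of a phase

Variables `0` and `1` hold the numbers of nodes and edges. The arrays are: `0` and `1` the endpoints
of the edges, `2` their tails, `3`, `4`, `5` the edge of a half-edge, the next half-edge, and the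
first half-edge of a node, `6` the degrees, `7` the indegrees, `8` the capacities, `9` the
distances, `10` the queue, `11` the current half-edges, `12` the edges of the path. -/

variable (N) in
/-- The part of the memory that does not change after the initialization. -/
structure Static (eid nxt fst deg : ℕ → ℕ) (σ : Store) : Prop where
  n : σ.var 0 = N.n
  m : σ.var 1 = N.m
  a : σ.arr 0 = N.a
  b : σ.arr 1 = N.b
  eid : σ.arr 3 = eid
  nxt : σ.arr 4 = nxt
  fst : σ.arr 5 = fst
  deg : σ.arr 6 = deg

/-- Does the program keep the part of the memory that `Static` describes? -/
def keepsStatic (p : Prog) : Bool :=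
  !(p.writesVar 0 || p.writesVar 1 || p.writesArr 0 || p.writesArr 1 || p.writesArr 3 ||
    p.writesArr 4 || p.writesArr 5 || p.writesArr 6)

theorem Static.frame {eid nxt fst deg : ℕ → ℕ} {σ τ : Store} {p : Prog}
    (h : N.Static eid nxt fst deg σ) (hf : Frame p σ τ) (hp : keepsStatic p = true) :
    N.Static eid nxt fst deg τ := by
  simp only [keepsStatic, Bool.not_eq_true', Bool.or_eq_false_iff] at hp
  obtain ⟨⟨⟨⟨⟨⟨⟨h0, h1⟩, h2⟩, h3⟩, h4⟩, h5⟩, h6⟩, h7⟩ := hp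
  exact ⟨(hf.var _ h0).trans h.n, (hf.var _ h1).trans h.m, (hf.arr _ h2).trans h.a,
    (hf.arr _ h3).trans h.b, (hf.arr _ h4).trans h.eid, (hf.arr _ h5).trans h.nxt,
    (hf.arr _ h6).trans h.fst, (hf.arr _ h7).trans h.deg⟩

/-- Variable `2` is the loop counter, and later the front of the queue; variable `3` is the end of
the queue. -/
def bfsStartBody : Prog :=
  seq (put 11 (var 2) (get 5 (var 2))) <|
  seq (ite (sub (get 8 (var 2)) (get 7 (var 2)))
    (seq (put 9 (var 2) (const 0)) <| seq (put 10 (var 3) (var 2)) <|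
      assign 3 (add (var 3) (const 1)))
    (put 9 (var 2) (var 0))) <|
  assign 2 (add (var 2) (const 1))

/-- Variables `8`, `7`, `17` hold the current node, the scanned edge and its head. A sum of two
opposite truncated differences tests whether two numbers differ. -/
def bfsBody : Prog :=
  seq (assign 8 (get 10 (var 2))) <|
  ite (get 11 (var 8))
    (seq (assign 7 (get 3 (get 11 (var 8)))) <|
      seq (put 11 (var 8) (get 4 (get 11 (var 8)))) <|
      ite (add (sub (get 2 (var 7)) (var 8)) (sub (var 8) (get 2 (var 7)))) skip <|
      seq (assign 17 (sub (add (get 0 (var 7)) (get 1 (var 7))) (get 2 (var 7)))) <|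
      ite (sub (var 0) (get 9 (var 17))) skip <|
      seq (put 9 (var 17) (add (get 9 (var 8)) (const 1))) <|
      seq (put 10 (var 3) (var 17)) <|
      assign 3 (add (var 3) (const 1)))
    (assign 2 (add (var 2) (const 1)))

def resetBody : Prog :=
  seq (put 11 (var 2) (get 5 (var 2))) <| assign 2 (add (var 2) (const 1))

/-- Variable `4` is the root, `5` the end of the path, `6` the flag for a completed path, `7` and
`8` the scanned edge and its tail. A usable edge is reversed at once; `searchRetreat` undoes this.
-/
def searchStep : Prog :=
  seq (assign 7 (get 3 (get 11 (var 5)))) <|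
  seq (assign 8 (get 2 (var 7))) <|
  seq (put 11 (var 5) (get 4 (get 11 (var 5)))) <|
  ite (add (sub (add (get 9 (var 8)) (const 1)) (get 9 (var 5)))
      (sub (get 9 (var 5)) (add (get 9 (var 8)) (const 1)))) skip <|
  seq (put 2 (var 7) (var 5)) <|
  seq (put 7 (var 5) (sub (get 7 (var 5)) (const 1))) <|
  seq (put 7 (var 8) (add (get 7 (var 8)) (const 1))) <|
  seq (put 12 (var 8) (var 7)) <|
  ite (sub (get 7 (var 8)) (get 8 (var 8))) (assign 5 (var 8)) <|
  seq (assign 5 (var 4)) (assign 6 (const 1))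

def searchRetreat : Prog :=
  seq (assign 7 (get 12 (var 5))) <|
  seq (assign 8 (get 2 (var 7))) <|
  seq (put 2 (var 7) (var 5)) <|
  seq (put 7 (var 5) (sub (get 7 (var 5)) (const 1))) <|
  seq (put 7 (var 8) (add (get 7 (var 8)) (const 1))) <|
  assign 5 (var 8)

def searchNext : Prog :=
  seq (assign 4 (add (var 4) (const 1))) (assign 5 (var 4))

def searchBody : Prog :=
  ite (add (sub (var 5) (var 4)) (sub (var 4) (var 5)))
    (ite (get 11 (var 5)) searchStep searchRetreat)
    (ite (sub (get 7 (var 4)) (get 8 (var 4)))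
      (ite (get 11 (var 5)) searchStep searchNext) searchNext)

def bfsProg : Prog :=
  seq (assign 2 (const 0)) <| seq (assign 3 (const 0)) <|
  seq (loop (sub (var 0) (var 2)) bfsStartBody) <|
  seq (assign 2 (const 0)) <| loop (sub (var 3) (var 2)) bfsBody

def searchProg : Prog :=
  seq (assign 2 (const 0)) <|
  seq (loop (sub (var 0) (var 2)) resetBody) <|
  seq (assign 4 (const 0)) <| seq (assign 5 (const 0)) <| seq (assign 6 (const 0)) <|
  loop (sub (var 0) (var 4)) searchBody

def phaseProg : Prog := seq bfsProg searchProg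

/-! ### Correctness and running time of a phase -/

section

variable {W : ℕ} {eid nxt fst deg cap : ℕ → ℕ} {σ : Store}

/-- Here and below, the numerical factor in a credit is a generous bound for the cost of one pass.
-/
theorem wp_bfsStart (hW : 4 * (N.n + N.m) + 4 ≤ W) (hS : N.Static eid nxt fst deg σ)
    (L : N.Lists eid nxt fst) (hcap : ∀ v < N.n, cap v < W) (h8 : σ.arr 8 = cap)
    (h7 : σ.arr 7 = N.indeg (σ.arr 2)) (h2 : σ.var 2 = 0) (h3 : σ.var 3 = 0) :
    wp W (loop (sub (var 0) (var 2)) bfsStartBody) (fun τ t =>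
      N.BfsInv cap (σ.arr 2) (τ.arr 11) (τ.arr 9) (τ.arr 10) 0 (τ.var 3) ∧
        t ≤ 50 * N.n + 4) σ := by
  have hloop := wp_loop (W := W) (σ := σ) (e := sub (var 0) (var 2)) (p := bfsStartBody)
    (k := 50 * N.n)
    (fun k τ => N.BfsStart cap fst (σ.arr 2) (τ.arr 11) (τ.arr 9) (τ.arr 10) (τ.var 2) (τ.var 3) ∧
      k = 50 * (N.n - τ.var 2)) ⟨by rw [h2, h3]; exact .zero, by rw [h2]; rfl⟩ ?_
  · refine hloop.mono fun τ t hf => ?_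
    rintro ⟨k', h1, ⟨h4, h5⟩, h6⟩
    simp only [Expr.eval, (hS.frame hf rfl).n] at h6
    have := h4.i_le
    refine ⟨h4.bfsInv L (by omega), ?_⟩
    simp only [Expr.cost] at h1
    omega
  · rintro k τ hf ⟨I, rfl⟩
    have hSτ := hS.frame hf rfl
    have h8τ : τ.arr 8 = cap := (hf.arr 8 rfl).trans h8
    have h7τ : τ.arr 7 = N.indeg (σ.arr 2) := (hf.arr 7 rfl).trans h7
    have hk := I.k_le
    have hi := I.i_le
    refine ⟨by simp only [Expr.Fits, hSτ.n]; omega, fun he => ?_⟩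
    simp only [Expr.eval, hSτ.n] at he
    have hi' : τ.var 2 < N.n := by omega
    have hcapi := hcap _ hi'
    have hindeg := N.indeg_le (σ.arr 2) (τ.var 2)
    have hfst := L.fst_le _ hi'
    simp only [bfsStartBody, wp_seq, wp_assign, wp_put, wp_ite, wp_skip, Expr.eval, Expr.Fits,
      Expr.cost, Store.setVar_var_self, Store.setVar_var_ne, Store.setVar_arr, Store.setArr_var,
      Store.setArr_arr_self, Store.setArr_arr_ne, ne_eq, Nat.reduceEqDiff,
      not_false_eq_true, hSτ.n, hSτ.fst, h8τ, h7τ, OfNat.ofNat_ne_zero]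
    exact ⟨by omega, by omega, by omega,
      fun h => ⟨by omega, by omega, by omega, by omega, by omega, by omega, _, by omega,
        I.push hi' (by omega), rfl⟩,
      fun h => ⟨by omega, by omega, by omega, _, by omega, I.pass hi' (by omega), rfl⟩⟩

theorem wp_bfs (hW : 4 * (N.n + N.m) + 4 ≤ W) (hS : N.Static eid nxt fst deg σ)
    (L : N.Lists eid nxt fst) (ho : N.Ori (σ.arr 2)) (h2 : σ.var 2 = 0)
    (hI : N.BfsInv cap (σ.arr 2) (σ.arr 11) (σ.arr 9) (σ.arr 10) 0 (σ.var 3)) :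
    wp W (loop (sub (var 3) (var 2)) bfsBody) (fun τ t =>
      N.IsDist cap (τ.arr 9) (σ.arr 2) ∧ t ≤ 100 * N.n + 200 * N.m + 4) σ := by
  have hrest := N.rest_le (σ.arr 11)
  have hloop := wp_loop (W := W) (σ := σ) (e := sub (var 3) (var 2)) (p := bfsBody)
    (k := 100 * N.bfsPot (σ.arr 11) 0)
    (fun k τ => N.BfsInv cap (σ.arr 2) (τ.arr 11) (τ.arr 9) (τ.arr 10) (τ.var 2) (τ.var 3) ∧
      k = 100 * N.bfsPot (τ.arr 11) (τ.var 2)) ⟨by rwa [h2], by rw [h2]⟩ ?_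
  · refine hloop.mono fun τ t hf => ?_
    rintro ⟨k', h1, ⟨h4, h5⟩, h6⟩
    simp only [Expr.eval] at h6
    have := h4.i_le
    refine ⟨h4.isDist ho (by omega), ?_⟩
    simp only [Expr.cost] at h1
    unfold bfsPot at h1
    omega
  · rintro k τ hf ⟨I, rfl⟩
    have hSτ := hS.frame hf rfl
    have hc : τ.arr 2 = σ.arr 2 := hf.arr 2 rfl
    have hk := I.k_le
    have hik := I.i_le
    refine ⟨by simp only [Expr.Fits]; omega, fun he => ?_⟩
    simp only [Expr.eval] at he
    have hi : τ.var 2 < τ.var 3 := by omega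
    have hu := I.q_lt _ hi
    have hdu := I.q_d_lt hi
    have hcur := (I.ptr _ hu).1
    by_cases h0 : τ.arr 11 (τ.arr 10 (τ.var 2)) = 0
    · have hfin := I.finish hi h0
      simp only [bfsBody, wp_seq, wp_assign, wp_put, wp_ite, wp_skip, Expr.eval, Expr.Fits,
        Expr.cost, Store.setVar_var_self, Store.setVar_var_ne, Store.setVar_arr, Store.setArr_var,
        Store.setArr_arr_self, Store.setArr_arr_ne, ne_eq, Nat.reduceEqDiff, not_false_eq_true,
        h0, not_true_eq_false, false_implies, true_implies, true_and]
      exact ⟨by omega, by omega, by omega, _, by omega, hfin.1, rfl⟩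
    · obtain ⟨heid, hem, hown⟩ := I.half L hi h0
      have hce := ho.lt hem
      have ha := N.a_lt _ hem
      have hb := N.b_lt _ hem
      have hdle := I.le _ (ho.hd_lt hem)
      have hvn := ho.hd_lt hem
      have hnxt := L.nxt_lt _ (by omega) hcur
      have hhd : N.a (eid (τ.arr 11 (τ.arr 10 (τ.var 2)))) +
          N.b (eid (τ.arr 11 (τ.arr 10 (τ.var 2)))) -
          σ.arr 2 (eid (τ.arr 11 (τ.arr 10 (τ.var 2)))) =
          N.hd (σ.arr 2) (eid (τ.arr 11 (τ.arr 10 (τ.var 2)))) := rfl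
      simp only [bfsBody, wp_seq, wp_assign, wp_put, wp_ite, wp_skip, Expr.eval, Expr.Fits,
        Expr.cost, Store.setVar_var_self, Store.setVar_var_ne, Store.setVar_arr, Store.setArr_var,
        Store.setArr_arr_self, Store.setArr_arr_ne, ne_eq, Nat.reduceEqDiff, not_false_eq_true,
        h0, not_true_eq_false, false_implies, true_implies, and_true, hSτ.n, hSτ.a, hSτ.b,
        hSτ.eid, hSτ.nxt, hc, hhd, OfNat.ofNat_ne_zero, OfNat.ofNat_ne_one]
      refine ⟨by omega, by omega, by omega, by omega, by omega, by omega, fun h => ?_, fun h => ?_⟩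
      · have hs := I.skip L hi h0 (fun h' => absurd h' (by omega)) ho
        exact ⟨_, by omega, hs.1, rfl⟩
      · refine ⟨by omega, by omega, fun h' => ?_, fun h' => ?_⟩
        · have hs := I.skip L hi h0 (fun _ => by omega) ho
          exact ⟨_, by omega, hs.1, rfl⟩
        · have hp := I.push L hi h0 (by omega) (by omega) ho
          have hkn := hp.1
          exact ⟨by omega, by omega, by omega, by omega, by omega, _, by omega, hp.2.1, rfl⟩

theorem wp_reset (hW : 4 * (N.n + N.m) + 4 ≤ W) (hS : N.Static eid nxt fst deg σ)
    (L : N.Lists eid nxt fst) (h2 : σ.var 2 = 0) :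
    wp W (loop (sub (var 0) (var 2)) resetBody) (fun τ t =>
      (∀ v < N.n, τ.arr 11 v = fst v) ∧ t ≤ 50 * N.n + 4) σ := by
  have hloop := wp_loop (W := W) (σ := σ) (e := sub (var 0) (var 2)) (p := resetBody)
    (k := 50 * N.n)
    (fun k τ => (τ.var 2 ≤ N.n ∧ ∀ v < τ.var 2, τ.arr 11 v = fst v) ∧
      k = 50 * (N.n - τ.var 2)) ⟨by simp [h2], by rw [h2]; rfl⟩ ?_
  · refine hloop.mono fun τ t hf => ?_
    rintro ⟨k', h1, ⟨h4, h5⟩, h6⟩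
    simp only [Expr.eval, (hS.frame hf rfl).n] at h6
    simp only [Expr.cost] at h1
    exact ⟨fun v hv => h4.2 v (by omega), by omega⟩
  · rintro k τ hf ⟨⟨hi, I⟩, rfl⟩
    have hSτ := hS.frame hf rfl
    refine ⟨by simp only [Expr.Fits, hSτ.n]; omega, fun he => ?_⟩
    simp only [Expr.eval, hSτ.n] at he
    have hi' : τ.var 2 < N.n := by omega
    have hfst := L.fst_le _ hi'
    simp only [resetBody, wp_seq, wp_assign, wp_put, wp_ite, wp_skip, Expr.eval, Expr.Fits,
      Expr.cost, Store.setVar_var_self, Store.setVar_var_ne, Store.setVar_arr, Store.setArr_var,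
      Store.setArr_arr_self, Store.setArr_arr_ne, ne_eq, Nat.reduceEqDiff,
      not_false_eq_true, hSτ.n, hSτ.fst, OfNat.ofNat_ne_zero]
    refine ⟨by omega, by omega, by omega, _, ?_, ⟨by omega, fun v hv => ?_⟩, rfl⟩
    · omega
    · rcases Nat.lt_succ_iff_lt_or_eq.1 hv with hv | rfl
      · rw [Function.update_of_ne hv.ne, I v hv]
      · rw [Function.update_self]

theorem wp_search (hW : 4 * (N.n + N.m) + 4 ≤ W) (hS : N.Static eid nxt fst deg σ)
    (L : N.Lists eid nxt fst) (hcap : ∀ v < N.n, cap v < W) (h8 : σ.arr 8 = cap)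
    (h7 : σ.arr 7 = N.indeg (σ.arr 2)) (hd : ∀ v < N.n, σ.arr 9 v ≤ N.n)
    (hI : N.SearchInv cap (σ.arr 9) (σ.arr 2) (σ.arr 2) (σ.arr 11) (σ.arr 12) 0 0 0
      (N.indeg (σ.arr 2))) (h4 : σ.var 4 = 0) (h5 : σ.var 5 = 0) (h6 : σ.var 6 = 0) :
    wp W (loop (sub (var 0) (var 4)) searchBody) (fun τ t =>
      τ.arr 7 = N.indeg (τ.arr 2) ∧
      N.PhaseEnd cap (σ.arr 9) (σ.arr 2) (τ.arr 2) (τ.arr 11) (τ.var 6) ∧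
        t ≤ 200 * N.n + 800 * N.m + 4) σ := by
  have hrest := N.rest_le (σ.arr 11)
  have hloop := wp_loop (W := W) (σ := σ) (e := sub (var 0) (var 4)) (p := searchBody)
    (k := 200 * N.searchPot (σ.arr 9) (σ.arr 11) 0 0)
    (fun k τ => τ.arr 7 = N.indeg (τ.arr 2) ∧ (∃ b, N.SearchInv cap (σ.arr 9) (σ.arr 2) (τ.arr 2)
      (τ.arr 11) (τ.arr 12) (τ.var 4) (τ.var 5) (τ.var 6) b) ∧
      k = 200 * N.searchPot (σ.arr 9) (τ.arr 11) (τ.var 4) (τ.var 5))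
    ⟨h7, ⟨_, by rwa [h4, h5, h6]⟩, by rw [h4, h5]⟩ ?_
  · refine hloop.mono fun τ t hf => ?_
    rintro ⟨k', h1, ⟨h4, ⟨b, I⟩, h5⟩, h6⟩
    simp only [Expr.eval, (hS.frame hf rfl).n] at h6
    have := I.s_le
    refine ⟨h4, I.phaseEnd (by omega), ?_⟩
    simp only [Expr.cost] at h1
    unfold searchPot at h1
    omega
  · rintro k τ hf ⟨hg, ⟨b, I⟩, rfl⟩
    have hSτ := hS.frame hf rfl
    have h9 : τ.arr 9 = σ.arr 9 := hf.arr 9 rfl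
    have h8τ : τ.arr 8 = cap := (hf.arr 8 rfl).trans h8
    have hsle := I.s_le
    refine ⟨by simp only [Expr.Fits, hSτ.n]; omega, fun he => ?_⟩
    simp only [Expr.eval, hSτ.n] at he
    have hs : τ.var 4 < N.n := by omega
    have hx := I.x_lt hs
    have hcaps := hcap _ hs
    have hcapx := hcap _ hx
    have hgs := N.indeg_le (τ.arr 2) (τ.var 4)
    have hgx := N.indeg_le (τ.arr 2) (τ.var 5)
    have hcur := (I.ptr _ hx).1
    have hdx := hd _ hx
    -- In this and the next two claims, the slack of 50 steps pays for the tests in `searchBody`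
    -- that select the branch.
    have hnext : (τ.var 5 = τ.var 4 → N.indeg (τ.arr 2) (τ.var 4) ≤ cap (τ.var 4) ∨
        τ.arr 11 (τ.var 4) = 0 → wp W searchNext (fun ρ t => ∃ k', k' + t + 50 ≤
        200 * N.searchPot (σ.arr 9) (τ.arr 11) (τ.var 4) (τ.var 5) ∧ (ρ.arr 7 = N.indeg (ρ.arr 2) ∧
        (∃ b, N.SearchInv cap (σ.arr 9) (σ.arr 2) (ρ.arr 2)
      (ρ.arr 11) (ρ.arr 12) (ρ.var 4) (ρ.var 5) (ρ.var 6) b) ∧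
      k' = 200 * N.searchPot (σ.arr 9) (ρ.arr 11) (ρ.var 4) (ρ.var 5))) τ) := by
      intro hxs hdone
      have hn := I.next hs hxs hdone
      simp only [searchNext, wp_seq, wp_assign, wp_put, wp_ite, wp_skip, Expr.eval, Expr.Fits,
        Expr.cost, Store.setVar_var_self, Store.setVar_var_ne, Store.setVar_arr, Store.setArr_var,
        Store.setArr_arr_self, Store.setArr_arr_ne, ne_eq, Nat.reduceEqDiff, not_false_eq_true]
      exact ⟨by omega, by omega, _, by omega, hg, ⟨b, hn.1⟩, rfl⟩
    have hretreat : (τ.var 5 ≠ τ.var 4 → τ.arr 11 (τ.var 5) = 0 →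
        wp W searchRetreat (fun ρ t => ∃ k', k' + t + 50 ≤
        200 * N.searchPot (σ.arr 9) (τ.arr 11) (τ.var 4) (τ.var 5) ∧ (ρ.arr 7 = N.indeg (ρ.arr 2) ∧
        (∃ b, N.SearchInv cap (σ.arr 9) (σ.arr 2) (ρ.arr 2)
      (ρ.arr 11) (ρ.arr 12) (ρ.var 4) (ρ.var 5) (ρ.var 6) b) ∧
      k' = 200 * N.searchPot (σ.arr 9) (ρ.arr 11) (ρ.var 4) (ρ.var 5))) τ) := by
      intro hxs h0
      obtain ⟨hpm, hhd, hr, hpot⟩ := I.retreat hxs h0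
      have hfl := indeg_flip_eq I.ori hpm
      have hlt := indeg_tail_lt I.ori hpm
      have hcn := I.ori.lt hpm
      have hne := I.ori.hd_ne hpm
      rw [← hhd] at hfl hne
      have hu : Function.update (N.indeg (τ.arr 2)) (τ.var 5) (N.indeg (τ.arr 2) (τ.var 5) - 1)
          (τ.arr 2 (τ.arr 12 (τ.var 5))) = N.indeg (τ.arr 2) (τ.arr 2 (τ.arr 12 (τ.var 5))) :=
        Function.update_of_ne hne.symm _ _
      simp only [searchRetreat, wp_seq, wp_assign, wp_put, wp_ite, wp_skip, Expr.eval, Expr.Fits,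
        Expr.cost, Store.setVar_var_self, Store.setVar_var_ne, Store.setVar_arr, Store.setArr_var,
        Store.setArr_arr_self, Store.setArr_arr_ne, ne_eq, Nat.reduceEqDiff, not_false_eq_true,
        hg, hu, OfNat.ofNat_ne_zero, OfNat.ofNat_ne_one]
      exact ⟨by omega, by omega, by omega, by omega, by omega, by omega, by omega, by omega,
        by omega, _, by omega, hfl.symm, ⟨b, hr⟩, rfl⟩
    have hstep : ((τ.var 5 = τ.var 4 → cap (τ.var 4) < N.indeg (τ.arr 2) (τ.var 4)) →
        τ.arr 11 (τ.var 5) ≠ 0 → wp W searchStep (fun ρ t => ∃ k', k' + t + 50 ≤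
        200 * N.searchPot (σ.arr 9) (τ.arr 11) (τ.var 4) (τ.var 5) ∧ (ρ.arr 7 = N.indeg (ρ.arr 2) ∧
        (∃ b, N.SearchInv cap (σ.arr 9) (σ.arr 2) (ρ.arr 2)
      (ρ.arr 11) (ρ.arr 12) (ρ.var 4) (ρ.var 5) (ρ.var 6) b) ∧
      k' = 200 * N.searchPot (σ.arr 9) (ρ.arr 11) (ρ.var 4) (ρ.var 5))) τ) := by
      intro hroot h0
      have hnxt := L.nxt_lt _ (by omega) hcur
      have hdu := hd _ (I.ori.lt (e := eid (τ.arr 11 (τ.var 5))) (by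
        rw [L.eid_eq _ (by omega) hcur]; omega))
      have hem : eid (τ.arr 11 (τ.var 5)) < N.m := by
        rw [L.eid_eq _ (by omega) hcur]; omega
      have hun := I.ori.lt hem
      have hcapu := hcap _ hun
      by_cases htight : σ.arr 9 (τ.arr 2 (eid (τ.arr 11 (τ.var 5)))) + 1 = σ.arr 9 (τ.var 5)
      · obtain ⟨-, hhd, habs, hcont⟩ := I.advance L hs hroot h0 htight
        have hfl := indeg_flip_eq I.ori hem
        have hlt := indeg_tail_lt I.ori hem
        have hne := I.ori.hd_ne hem
        rw [← hhd] at hfl hne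
        have hu : Function.update (N.indeg (τ.arr 2)) (τ.var 5) (N.indeg (τ.arr 2) (τ.var 5) - 1)
            (τ.arr 2 (eid (τ.arr 11 (τ.var 5)))) =
            N.indeg (τ.arr 2) (τ.arr 2 (eid (τ.arr 11 (τ.var 5)))) :=
          Function.update_of_ne hne.symm _ _
        have hgu := N.indeg_le (Function.update (τ.arr 2) (eid (τ.arr 11 (τ.var 5))) (τ.var 5))
          (τ.arr 2 (eid (τ.arr 11 (τ.var 5))))
        simp only [searchStep, wp_seq, wp_assign, wp_put, wp_ite, wp_skip, Expr.eval, Expr.Fits,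
          Expr.cost, Store.setVar_var_self, Store.setVar_var_ne, Store.setVar_arr,
          Store.setArr_var, Store.setArr_arr_self, Store.setArr_arr_ne, ne_eq, Nat.reduceEqDiff,
          not_false_eq_true, hg, hu, OfNat.ofNat_ne_zero, OfNat.ofNat_ne_one, hSτ.eid, hSτ.nxt,
          h9, h8τ, htight, Nat.sub_self, Nat.add_zero, not_true_eq_false, false_implies,
          true_implies, true_and, ← hfl]
        refine ⟨by omega, by omega, by omega, by omega, by omega, by omega, by omega, by omega,
          by omega, by omega, by omega, by omega, by omega, by omega, fun h => ?_, fun h => ?_⟩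
        · obtain ⟨hc, hpot⟩ := hcont (by omega)
          exact ⟨by omega, _, by omega, ⟨b, hc⟩, rfl⟩
        · obtain ⟨hc, hpot⟩ := habs (by omega)
          exact ⟨by omega, by omega, _, by omega, hc, rfl⟩
      · have hsk := I.skip L hs hroot h0 htight
        simp only [searchStep, wp_seq, wp_assign, wp_put, wp_ite, wp_skip, Expr.eval, Expr.Fits,
          Expr.cost, Store.setVar_var_self, Store.setVar_var_ne, Store.setVar_arr,
          Store.setArr_var, Store.setArr_arr_self, Store.setArr_arr_ne, ne_eq, Nat.reduceEqDiff,
          not_false_eq_true, hg, OfNat.ofNat_ne_zero, OfNat.ofNat_ne_one, hSτ.eid, hSτ.nxt,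
          h9, h8τ]
        refine ⟨by omega, by omega, by omega, by omega, by omega, fun h => ?_, fun h => ?_⟩
        · exact ⟨_, by omega, trivial, ⟨b, hsk.1⟩, rfl⟩
        · omega
    simp only [searchBody, wp_ite, Expr.eval, Expr.Fits, Expr.cost, hg, h8τ]
    refine ⟨by omega, fun h => ⟨by omega, fun h' => ?_, fun h' => ?_⟩,
      fun h => ⟨by omega, fun h' => ⟨by omega, fun h'' => ?_, fun h'' => ?_⟩, fun h' => ?_⟩⟩
    · refine (hstep (by omega) h').mono fun ρ t _ => ?_
      rintro ⟨k', h1, h2⟩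
      exact ⟨k', by omega, h2⟩
    · refine (hretreat (by omega) h').mono fun ρ t _ => ?_
      rintro ⟨k', h1, h2⟩
      exact ⟨k', by omega, h2⟩
    · refine (hstep (by omega) h'').mono fun ρ t _ => ?_
      rintro ⟨k', h1, h2⟩
      exact ⟨k', by omega, h2⟩
    · have hxs : τ.var 5 = τ.var 4 := by omega
      refine (hnext hxs (Or.inr (by rwa [← hxs]))).mono fun ρ t _ => ?_
      rintro ⟨k', h1, h2⟩
      exact ⟨k', by omega, h2⟩
    · refine (hnext (by omega) (Or.inl (by omega))).mono fun ρ t _ => ?_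
      rintro ⟨k', h1, h2⟩
      exact ⟨k', by omega, h2⟩

theorem wp_phase (hW : 4 * (N.n + N.m) + 4 ≤ W) (hS : N.Static eid nxt fst deg σ)
    (L : N.Lists eid nxt fst) (hcap : ∀ v < N.n, cap v < W) (h8 : σ.arr 8 = cap)
    (h7 : σ.arr 7 = N.indeg (σ.arr 2)) (ho : N.Ori (σ.arr 2)) :
    wp W phaseProg (fun τ t => τ.arr 7 = N.indeg (τ.arr 2) ∧
      (∃ d cur, N.IsDist cap d (σ.arr 2) ∧
        N.PhaseEnd cap d (σ.arr 2) (τ.arr 2) cur (τ.var 6)) ∧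
      t ≤ 1100 * (N.n + N.m + 1)) σ := by
  simp only [phaseProg, bfsProg, searchProg, wp_seq, wp_assign, Expr.eval, Expr.Fits, Expr.cost]
  refine ⟨by omega, by omega, ?_⟩
  have hS1 : N.Static eid nxt fst deg ((σ.setVar 2 0).setVar 3 0) := by
    constructor <;> simp [hS.n, hS.m, hS.a, hS.b, hS.eid, hS.nxt, hS.fst, hS.deg]
  refine (wp_bfsStart hW hS1 L hcap h8 h7 (by simp) (by simp)).mono ?_
  rintro τ t1 hf1 ⟨hI, ht1⟩
  refine ⟨by omega, ?_⟩
  have hc1 : τ.arr 2 = σ.arr 2 := hf1.arr 2 rfl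
  have hS2 : N.Static eid nxt fst deg (τ.setVar 2 0) := by
    have := hS1.frame hf1 rfl
    constructor <;> simp [this.n, this.m, this.a, this.b, this.eid, this.nxt, this.fst, this.deg]
  refine (wp_bfs hW hS2 L (by simpa [hc1]) (by simp) (by simpa [hc1] using hI)).mono ?_
  rintro ρ t2 hf2 ⟨hd, ht2⟩
  have hc2 : ρ.arr 2 = σ.arr 2 := (hf2.arr 2 rfl).trans hc1
  simp only [Store.setVar_arr, hc1] at hd
  refine ⟨by omega, ?_⟩
  have hS3 : N.Static eid nxt fst deg (ρ.setVar 2 0) := by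
    have := hS2.frame hf2 rfl
    constructor <;> simp [this.n, this.m, this.a, this.b, this.eid, this.nxt, this.fst, this.deg]
  refine (wp_reset hW hS3 L (by simp)).mono ?_
  rintro κ t3 hf3 ⟨hcur, ht3⟩
  refine ⟨by omega, by omega, by omega, ?_⟩
  have hc3 : κ.arr 2 = σ.arr 2 := (hf3.arr 2 rfl).trans hc2
  have h93 : κ.arr 9 = ρ.arr 9 := hf3.arr 9 rfl
  have h83 : κ.arr 8 = cap :=
    (hf3.arr 8 rfl).trans ((hf2.arr 8 rfl).trans ((hf1.arr 8 rfl).trans h8))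
  have h73 : κ.arr 7 = N.indeg (κ.arr 2) := by
    rw [hc3]
    exact (hf3.arr 7 rfl).trans ((hf2.arr 7 rfl).trans ((hf1.arr 7 rfl).trans h7))
  have hS4 : N.Static eid nxt fst deg (((κ.setVar 4 0).setVar 5 0).setVar 6 0) := by
    have := hS3.frame hf3 rfl
    constructor <;> simp [this.n, this.m, this.a, this.b, this.eid, this.nxt, this.fst, this.deg]
  rw [← h93, ← hc3] at hd
  refine (wp_search hW hS4 L hcap h83 h73 hd.le (.start L ?_ hd.valid hcur)
    (by simp) (by simp) (by simp)).mono ?_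
  · simpa [hc3]
  rintro υ t4 - ⟨h1, h2, ht4⟩
  simp only [Store.setVar_arr] at h2
  rw [hc3] at h2 hd
  exact ⟨h1, ⟨_, _, hd, h2⟩, by omega⟩

end

end Net
end StarPartition

namespace StarPartition

set_option linter.unusedSimpArgs false

namespace Net

open StarPartition.Expr Prog Finset

variable {N : Net}

/-! ### The program of a feasibility test -/

/-- The largest indegree that is allowed at a node of degree `d` on level `j`. On the level `2 * k`,
it is `k`. On the level `2 * k - 1`, it is such that a node sees at most `k` colors. -/
def levelCap (j d : ℕ) : ℕ := if d ≤ (j + 1) / 2 then (j + 1) / 2 else j / 2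

theorem levelCap_mono {j j' : ℕ} (h : j ≤ j') (d : ℕ) : levelCap j d ≤ levelCap j' d := by
  unfold levelCap
  split_ifs <;> omega

theorem levelCap_le (j d : ℕ) : levelCap j d ≤ j := by
  unfold levelCap
  split_ifs <;> omega

variable (N) in
/-- There is an orientation that respects the capacities of level `j`. -/
def Feasible (deg : ℕ → ℕ) (j : ℕ) : Prop :=
  ∃ c, N.Ori c ∧ ∀ v < N.n, N.indeg c v ≤ levelCap j (deg v)

theorem Feasible.mono {deg : ℕ → ℕ} {j j' : ℕ} (h : N.Feasible deg j) (hj : j ≤ j') :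
    N.Feasible deg j' := by
  obtain ⟨c, h1, h2⟩ := h
  exact ⟨c, h1, fun v hv => (h2 v hv).trans (levelCap_mono hj _)⟩

/-- The loop ends after the first phase that completes no path. -/
def flowProg : Prog := seq (assign 6 (const 1)) (loop (var 6) phaseProg)

/-- The machine cannot divide: one variable counts up and the other down until they meet. This takes
linear time, which a feasibility test absorbs. -/
def halfBody : Prog :=
  seq (assign 12 (add (var 12) (const 1))) (assign 13 (sub (var 13) (const 1)))

/-- Divides variable `11` by two. -/
def halfProg : Prog :=
  seq (assign 12 (const 0)) <| seq (assign 13 (var 11)) <| loop (sub (var 13) (var 12)) halfBody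

def capBody : Prog :=
  seq (ite (sub (get 6 (var 2)) (var 12)) (put 8 (var 2) (var 13)) (put 8 (var 2) (var 12))) <|
  assign 2 (add (var 2) (const 1))

def checkBody : Prog :=
  seq (ite (sub (get 7 (var 2)) (get 8 (var 2))) (assign 14 (const 0)) skip) <|
  assign 2 (add (var 2) (const 1))

/-- Tests the feasibility of the level in variable `11`. -/
def testProg : Prog :=
  seq halfProg <|
  seq (assign 2 (const 0)) <| seq (loop (sub (var 0) (var 2)) capBody) <|
  seq flowProg <|
  seq (assign 2 (const 0)) <| seq (assign 14 (const 1)) <|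
  loop (sub (var 0) (var 2)) checkBody

/-! ### Correctness and running time of a feasibility test -/

section

variable {W : ℕ} {eid nxt fst deg cap : ℕ → ℕ} {σ : Store}

/-- Any initial orientation will do, so a test can start from the one left behind by the previous
test. -/
theorem wp_flow (hW : 4 * (N.n + N.m) + 4 ≤ W) (hS : N.Static eid nxt fst deg σ)
    (L : N.Lists eid nxt fst) (hcap : ∀ v < N.n, cap v < W) (h8 : σ.arr 8 = cap)
    (h7 : σ.arr 7 = N.indeg (σ.arr 2)) (ho : N.Ori (σ.arr 2)) {D M : ℕ} (hD : D ≤ N.n)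
    (hM : N.CutBound D M) :
    wp W flowProg (fun τ t => τ.arr 7 = N.indeg (τ.arr 2) ∧ N.Ori (τ.arr 2) ∧
      ((∃ v < N.n, cap v < N.indeg (τ.arr 2) v) →
        ∀ c, N.Ori c → ∃ v < N.n, cap v < N.indeg c v) ∧
      t ≤ 1200 * ((D + M + 1) * (N.n + N.m + 1)) + 4) σ := by
  simp only [flowProg, wp_seq, wp_assign, Expr.eval, Expr.Fits, Expr.cost]
  refine ⟨by omega, ?_⟩
  have hloop := wp_loop (W := W) (σ := σ.setVar 6 1) (e := var 6) (p := phaseProg)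
    (k := (D + M + 1) * (1200 * (N.n + N.m + 1)))
    (fun k τ => τ.arr 7 = N.indeg (τ.arr 2) ∧ N.Ori (τ.arr 2) ∧ τ.var 6 ≤ 1 ∧
      ((τ.var 6 ≠ 0 ∧ ∃ r, N.Remaining cap D M r (τ.arr 2) ∧ k = r * (1200 * (N.n + N.m + 1))) ∨
      (τ.var 6 = 0 ∧ ((∃ v < N.n, cap v < N.indeg (τ.arr 2) v) →
        ∀ c, N.Ori c → ∃ v < N.n, cap v < N.indeg c v))))
    ⟨h7, ho, by simp, Or.inl ⟨by simp, _, .start cap D M _, rfl⟩⟩ ?_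
  · refine hloop.mono fun τ t hf => ?_
    rintro ⟨k', h1, ⟨h2, h3, -, h4⟩, h6⟩
    simp only [Expr.eval] at h6
    refine ⟨h2, h3, ?_, ?_⟩
    · rcases h4 with h4 | h4
      · exact absurd h6 h4.1
      · exact h4.2
    · simp only [Expr.cost] at h1
      have : (D + M + 1) * (1200 * (N.n + N.m + 1)) = 1200 * ((D + M + 1) * (N.n + N.m + 1)) := by
        ring
      omega
  · rintro k τ hf ⟨h1, h2, h3, h4⟩
    have hS1 : N.Static eid nxt fst deg (σ.setVar 6 1) := by
      constructor <;> simp [hS.n, hS.m, hS.a, hS.b, hS.eid, hS.nxt, hS.fst, hS.deg]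
    refine ⟨by simp only [Expr.Fits]; omega, fun he => ?_⟩
    simp only [Expr.eval] at he
    rcases h4 with ⟨-, r, hr, rfl⟩ | h4
    swap
    · exact absurd h4.1 he
    refine (wp_phase hW (hS1.frame hf rfl) L hcap ((hf.arr 8 rfl).trans h8) h1 h2).mono ?_
    rintro ρ t - ⟨h5, ⟨d, cur, hd, hp⟩, ht⟩
    simp only [Expr.cost]
    by_cases habs : ρ.var 6 = 0
    · obtain ⟨r', rfl⟩ : ∃ r', r = r' + 1 := ⟨r - 1, by have := hr.pos; omega⟩
      refine ⟨0, ?_, h5, hp.ori, hp.abs_le, Or.inr ⟨habs, fun hex c hc => ?_⟩⟩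
      · rw [add_one_mul]
        omega
      · rw [habs] at hp
        exact hp.exists_gt hd hex hc
    · obtain ⟨r', rfl, hr'⟩ := hr.step hD hM h2 hd hp habs
      refine ⟨_, ?_, h5, hp.ori, hp.abs_le, Or.inl ⟨habs, r', hr', rfl⟩⟩
      rw [add_one_mul]
      omega

theorem wp_half {z : ℕ} (hz : z < W) (h11 : σ.var 11 = z) (hW : 4 ≤ W) :
    wp W halfProg (fun τ t => τ.var 12 = (z + 1) / 2 ∧ τ.var 13 = z / 2 ∧ t ≤ 20 * z + 10) σ := by
  simp only [halfProg, wp_seq, wp_assign, Expr.eval, Expr.Fits, Expr.cost, ne_eq, Nat.reduceEqDiff,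
    not_false_eq_true, Store.setVar_var_ne, h11]
  refine ⟨by omega, by omega, ?_⟩
  have hloop := wp_loop (W := W) (σ := (σ.setVar 12 0).setVar 13 z) (e := sub (var 13) (var 12))
    (p := halfBody) (k := 20 * z)
    (fun k τ => τ.var 12 + τ.var 13 = z ∧ τ.var 12 ≤ τ.var 13 + 1 ∧ k = 20 * τ.var 13) ?_ ?_
  · refine hloop.mono fun τ t hf => ?_
    rintro ⟨k', h1, ⟨h2, h3, h4⟩, h5⟩
    simp only [Expr.eval, Expr.cost] at h1 h5
    omega
  · simp
  · rintro k τ hf ⟨h2, h3, rfl⟩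
    refine ⟨by simp only [Expr.Fits]; omega, fun he => ?_⟩
    simp only [Expr.eval] at he
    simp only [halfBody, wp_seq, wp_assign, wp_put, wp_ite, wp_skip, Expr.eval, Expr.Fits,
      Expr.cost, Store.setVar_var_self, Store.setVar_var_ne, Store.setVar_arr, Store.setArr_var,
      Store.setArr_arr_self, Store.setArr_arr_ne, ne_eq, Nat.reduceEqDiff, not_false_eq_true]
    exact ⟨by omega, by omega, _, by omega, by omega, by omega, rfl⟩

theorem wp_cap (hW : 4 * (N.n + N.m) + 4 ≤ W) (hS : N.Static eid nxt fst deg σ)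
    (hdeg : ∀ v < N.n, deg v ≤ 2 * N.m) {z : ℕ} (hz : z < W) (h2 : σ.var 2 = 0)
    (h12 : σ.var 12 = (z + 1) / 2) (h13 : σ.var 13 = z / 2) :
    wp W (loop (sub (var 0) (var 2)) capBody) (fun τ t =>
      (∀ v < N.n, τ.arr 8 v = levelCap z (deg v)) ∧ t ≤ 50 * N.n + 4) σ := by
  have hloop := wp_loop (W := W) (σ := σ) (e := sub (var 0) (var 2)) (p := capBody)
    (k := 50 * N.n)
    (fun k τ => (τ.var 2 ≤ N.n ∧ ∀ v < τ.var 2, τ.arr 8 v = levelCap z (deg v)) ∧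
      k = 50 * (N.n - τ.var 2)) ⟨by simp [h2], by rw [h2]; rfl⟩ ?_
  · refine hloop.mono fun τ t hf => ?_
    rintro ⟨k', h1, ⟨h4, h5⟩, h6⟩
    simp only [Expr.eval, (hS.frame hf rfl).n] at h6
    simp only [Expr.cost] at h1
    exact ⟨fun v hv => h4.2 v (by omega), by omega⟩
  · rintro k τ hf ⟨⟨hi, I⟩, rfl⟩
    have hSτ := hS.frame hf rfl
    have h12τ := (hf.var 12 rfl).trans h12
    have h13τ := (hf.var 13 rfl).trans h13
    refine ⟨by simp only [Expr.Fits, hSτ.n]; omega, fun he => ?_⟩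
    simp only [Expr.eval, hSτ.n] at he
    have hi' : τ.var 2 < N.n := by omega
    have hdi := hdeg _ hi'
    simp only [capBody, wp_seq, wp_assign, wp_put, wp_ite, wp_skip, Expr.eval, Expr.Fits,
      Expr.cost, Store.setVar_var_self, Store.setVar_var_ne, Store.setVar_arr, Store.setArr_var,
      Store.setArr_arr_self, Store.setArr_arr_ne, ne_eq, Nat.reduceEqDiff,
      not_false_eq_true, hSτ.n, hSτ.deg, h12τ, h13τ, OfNat.ofNat_ne_zero]
    refine ⟨by omega, fun h => ?_, fun h => ?_⟩
    · refine ⟨by omega, by omega, by omega, _, ?_, ⟨by omega, fun v hv => ?_⟩, rfl⟩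
      · omega
      · rcases Nat.lt_succ_iff_lt_or_eq.1 hv with hv | rfl
        · rw [Function.update_of_ne hv.ne, I v hv]
        · rw [Function.update_self, levelCap, if_neg (by omega)]
    · refine ⟨by omega, by omega, by omega, _, ?_, ⟨by omega, fun v hv => ?_⟩, rfl⟩
      · omega
      · rcases Nat.lt_succ_iff_lt_or_eq.1 hv with hv | rfl
        · rw [Function.update_of_ne hv.ne, I v hv]
        · rw [Function.update_self, levelCap, if_pos (by omega)]

theorem wp_check (hW : 4 * (N.n + N.m) + 4 ≤ W) (hS : N.Static eid nxt fst deg σ)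
    (hcap : ∀ v < N.n, σ.arr 8 v < W) (h7 : σ.arr 7 = N.indeg (σ.arr 2))
    (h2 : σ.var 2 = 0) (h14 : σ.var 14 = 1) :
    wp W (loop (sub (var 0) (var 2)) checkBody) (fun τ t => τ.var 14 ≤ 1 ∧
      (τ.var 14 ≠ 0 ↔ ∀ v < N.n, N.indeg (σ.arr 2) v ≤ σ.arr 8 v) ∧ t ≤ 50 * N.n + 4) σ := by
  have hloop := wp_loop (W := W) (σ := σ) (e := sub (var 0) (var 2)) (p := checkBody)
    (k := 50 * N.n)
    (fun k τ => (τ.var 2 ≤ N.n ∧ τ.var 14 ≤ 1 ∧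
      (τ.var 14 ≠ 0 ↔ ∀ v < τ.var 2, N.indeg (σ.arr 2) v ≤ σ.arr 8 v)) ∧
      k = 50 * (N.n - τ.var 2)) ⟨by simp [h2, h14], by rw [h2]; rfl⟩ ?_
  · refine hloop.mono fun τ t hf => ?_
    rintro ⟨k', h1, ⟨⟨h4, h4', h4''⟩, h5⟩, h6⟩
    simp only [Expr.eval, (hS.frame hf rfl).n] at h6
    simp only [Expr.cost] at h1
    have h7 : τ.var 2 = N.n := by omega
    rw [h7] at h4''
    exact ⟨h4', h4'', by omega⟩
  · rintro k τ hf ⟨⟨hi, I, I'⟩, rfl⟩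
    have hSτ := hS.frame hf rfl
    have h7τ := (hf.arr 7 rfl).trans h7
    have h8τ := hf.arr 8 rfl
    refine ⟨by simp only [Expr.Fits, hSτ.n]; omega, fun he => ?_⟩
    simp only [Expr.eval, hSτ.n] at he
    have hi' : τ.var 2 < N.n := by omega
    have hci := hcap _ hi'
    have hgi := N.indeg_le (σ.arr 2) (τ.var 2)
    simp only [checkBody, wp_seq, wp_assign, wp_put, wp_ite, wp_skip, Expr.eval, Expr.Fits,
      Expr.cost, Store.setVar_var_self, Store.setVar_var_ne, Store.setVar_arr, Store.setArr_var,
      Store.setArr_arr_self, Store.setArr_arr_ne, ne_eq, Nat.reduceEqDiff,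
      not_false_eq_true, hSτ.n, hSτ.deg, h7τ, h8τ, OfNat.ofNat_ne_zero]
    refine ⟨by omega, fun h => ?_, fun h => ?_⟩
    · refine ⟨by omega, by omega, _, ?_, ⟨by omega, by omega, ?_⟩, rfl⟩
      · omega
      · simp only [not_true_eq_false, false_iff, not_forall]
        exact ⟨τ.var 2, by omega, by omega⟩
    · refine ⟨by omega, _, ?_, ⟨by omega, by omega, ?_⟩, rfl⟩
      · omega
      · rw [← ne_eq, I']
        refine ⟨fun hall v hv => ?_, fun hall v hv => hall v (by omega)⟩
        rcases Nat.lt_succ_iff_lt_or_eq.1 hv with hv | rfl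
        · exact hall v hv
        · omega

theorem wp_test (hW : 4 * (N.n + N.m) + 4 ≤ W) (hS : N.Static eid nxt fst deg σ)
    (L : N.Lists eid nxt fst) (hdeg : ∀ v < N.n, deg v ≤ 2 * N.m)
    (h7 : σ.arr 7 = N.indeg (σ.arr 2)) (ho : N.Ori (σ.arr 2)) {D M : ℕ} (hD : D ≤ N.n)
    (hM : N.CutBound D M) {z : ℕ} (hz : z ≤ 4 * N.m) (h11 : σ.var 11 = z) :
    wp W testProg (fun τ t => τ.arr 7 = N.indeg (τ.arr 2) ∧ N.Ori (τ.arr 2) ∧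
      (τ.var 14 ≤ 1) ∧ (τ.var 14 ≠ 0 → ∀ v < N.n, N.indeg (τ.arr 2) v ≤ levelCap z (deg v)) ∧
      (τ.var 14 = 0 → ¬ N.Feasible deg z) ∧
      t ≤ 1500 * ((D + M + 1) * (N.n + N.m + 1))) σ := by
  simp only [testProg, wp_seq]
  refine (wp_half (by omega) h11 (by omega)).mono ?_
  rintro τ t1 hf1 ⟨h12, h13, ht1⟩
  have hS1 : N.Static eid nxt fst deg (τ.setVar 2 0) := by
    have := hS.frame hf1 rfl
    constructor <;> simp [this.n, this.m, this.a, this.b, this.eid, this.nxt, this.fst, this.deg]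
  simp only [wp_assign, Expr.eval, Expr.Fits, Expr.cost]
  refine ⟨by omega, ?_⟩
  refine (wp_cap hW hS1 hdeg (show z < W by omega) (by simp) (by simpa using h12)
    (by simpa using h13)).mono ?_
  rintro ρ t2 hf2 ⟨h8, ht2⟩
  have hS2 := hS1.frame hf2 rfl
  have hc2 : ρ.arr 2 = σ.arr 2 := (hf2.arr 2 rfl).trans (hf1.arr 2 rfl)
  have h72 : ρ.arr 7 = N.indeg (ρ.arr 2) := by
    rw [hc2]
    exact (hf2.arr 7 rfl).trans ((hf1.arr 7 rfl).trans h7)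
  have hcap : ∀ v < N.n, ρ.arr 8 v < W := by
    intro v hv
    rw [h8 v hv]
    have := levelCap_le z (deg v)
    omega
  refine (wp_flow hW hS2 L hcap rfl h72 (by rwa [hc2]) hD hM).mono ?_
  rintro κ t3 hf3 ⟨h73, ho3, hex, ht3⟩
  have h83 : κ.arr 8 = ρ.arr 8 := hf3.arr 8 rfl
  have hS3 : N.Static eid nxt fst deg ((κ.setVar 2 0).setVar 14 1) := by
    have := hS2.frame hf3 rfl
    constructor <;> simp [this.n, this.m, this.a, this.b, this.eid, this.nxt, this.fst, this.deg]
  refine ⟨by omega, by omega, ?_⟩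
  refine (wp_check hW hS3 (by simpa [h83] using hcap) h73 (by simp) (by simp)).mono ?_
  rintro υ t4 hf4 ⟨h14, hiff, ht4⟩
  have hc4 : υ.arr 2 = κ.arr 2 := hf4.arr 2 rfl
  simp only [Store.setVar_arr, h83] at hiff
  rw [hc4]
  refine ⟨(hf4.arr 7 rfl).trans h73, ho3, h14, fun h v hv => ?_, fun h => ?_, ?_⟩
  · rw [← h8 v hv]
    exact hiff.1 h v hv
  · rintro ⟨c, hc, hle⟩
    have h5 : ¬ ∀ v < N.n, N.indeg (κ.arr 2) v ≤ ρ.arr 8 v := fun h' => hiff.2 h' h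
    push Not at h5
    obtain ⟨v, hv, h6⟩ := hex h5 c hc
    have := hle v hv
    rw [h8 v hv] at h6
    omega
  · have h5 : N.n + N.m + 1 ≤ (D + M + 1) * (N.n + N.m + 1) := Nat.le_mul_of_pos_left _ (by omega)
    omega

end

end Net
end StarPartition

namespace StarPartition

set_option linter.unusedSimpArgs false

namespace Net

open StarPartition.Expr Prog Finset

variable {N : Net}

/-! ### The initialization -/

/-- The number of `e < k` with `f e = v`. -/
def count (f : ℕ → ℕ) (k v : ℕ) : ℕ := #{e ∈ range k | f e = v}

theorem count_le (f : ℕ → ℕ) (k v : ℕ) : count f k v ≤ k :=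
  (card_filter_le _ _).trans (card_range _).le

theorem count_succ (f : ℕ → ℕ) (k : ℕ) :
    count f (k + 1) = Function.update (count f k) (f k) (count f k (f k) + 1) := by
  funext v
  unfold count
  rw [range_add_one, filter_insert]
  by_cases h : f k = v
  · rw [if_pos h, card_insert_of_notMem (by simp), h, Function.update_self]
  · rw [if_neg h, Function.update_of_ne (Ne.symm h)]

variable (N) in
def degree (v : ℕ) : ℕ := count N.a N.m v + count N.b N.m v

theorem degree_le (v : ℕ) : N.degree v ≤ 2 * N.m := by
  have := count_le N.a N.m v
  have := count_le N.b N.m v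
  unfold degree
  omega

theorem indeg_le_degree {c : ℕ → ℕ} (ho : N.Ori c) (v : ℕ) : N.indeg c v ≤ N.degree v := by
  unfold indeg degree count
  refine (card_le_card ?_).trans (card_union_le _ _)
  intro e
  simp only [mem_filter, mem_union, mem_range]
  rintro ⟨he, h⟩
  rcases ho.hd_eq he with h1 | h1
  · exact Or.inr ⟨he, by omega⟩
  · exact Or.inl ⟨he, by omega⟩

theorem own_odd (e : ℕ) : N.own (2 * e + 1) = N.a e := by
  unfold own
  rw [if_pos (by omega)]
  congr 1
  omega

theorem own_even (e : ℕ) : N.own (2 * e + 1 + 1) = N.b e := by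
  unfold own
  rw [if_neg (by omega)]
  congr 1
  omega

/-- The new half-edge is larger than all earlier ones, so prepending it keeps the lists decreasing.
-/
theorem ListsUpTo.push {k : ℕ} {eid nxt fst : ℕ → ℕ} (L : N.ListsUpTo k eid nxt fst)
    {v e : ℕ} (hv : N.own (k + 1) = v) (hvn : v < N.n) (he : e = k / 2) :
    N.ListsUpTo (k + 1) (Function.update eid (k + 1) e) (Function.update nxt (k + 1) (fst v))
      (Function.update fst v (k + 1)) := by
  refine ⟨fun h h1 h2 => ?_, fun h h1 h2 => ?_, fun h h1 h2 h3 => ?_, fun h h1 h2 h' h3 h4 => ?_,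
    fun w hw => ?_, fun w hw h1 => ?_, fun w hw h h1 h2 => ?_⟩
  · rcases h2.lt_or_eq with h2 | rfl
    · rw [Function.update_of_ne h2.ne]
      exact L.eid_eq h h1 (by omega)
    · rw [Function.update_self, he]
      rfl
  · rcases h2.lt_or_eq with h2 | rfl
    · rw [Function.update_of_ne h2.ne]
      exact L.nxt_lt h h1 (by omega)
    · rw [Function.update_self]
      exact Nat.lt_succ_of_le (L.fst_le v hvn)
  · rcases h2.lt_or_eq with h2 | rfl
    · rw [Function.update_of_ne h2.ne] at h3 ⊢
      exact L.own_nxt h h1 (by omega) h3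
    · rw [Function.update_self] at h3 ⊢
      rw [L.own_fst v hvn h3, hv]
  · rcases h2.lt_or_eq with h2 | rfl
    · rw [Function.update_of_ne h2.ne] at h3
      exact L.nxt_gap h h1 (by omega) h' h3 h4
    · rw [Function.update_self] at h3
      rw [hv]
      exact L.fst_gap v hvn h' h3 (by omega)
  · by_cases hwv : w = v
    · rw [hwv, Function.update_self]
    · rw [Function.update_of_ne hwv]
      exact (L.fst_le w hw).trans (by omega)
  · by_cases hwv : w = v
    · rw [hwv, Function.update_self, hv]
    · rw [Function.update_of_ne hwv] at h1 ⊢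
      exact L.own_fst w hw h1
  · by_cases hwv : w = v
    · rw [hwv, Function.update_self] at h1
      omega
    · rw [Function.update_of_ne hwv] at h1
      rcases h2.lt_or_eq with h2 | rfl
      · exact L.fst_gap w hw h h1 (by omega)
      · rw [hv]
        exact Ne.symm hwv

/-- Every edge is first directed from its first to its second endpoint, so the indegrees count
second endpoints. -/
def setupBody : Prog :=
  seq (put 2 (var 2) (get 0 (var 2))) <|
  seq (put 7 (get 1 (var 2)) (add (get 7 (get 1 (var 2))) (const 1))) <|
  seq (put 6 (get 0 (var 2)) (add (get 6 (get 0 (var 2))) (const 1))) <|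
  seq (put 6 (get 1 (var 2)) (add (get 6 (get 1 (var 2))) (const 1))) <|
  seq (assign 16 (add (var 16) (const 1))) <|
  seq (put 3 (var 16) (var 2)) <|
  seq (put 4 (var 16) (get 5 (get 0 (var 2)))) <|
  seq (put 5 (get 0 (var 2)) (var 16)) <|
  seq (assign 16 (add (var 16) (const 1))) <|
  seq (put 3 (var 16) (var 2)) <|
  seq (put 4 (var 16) (get 5 (get 1 (var 2)))) <|
  seq (put 5 (get 1 (var 2)) (var 16)) <|
  assign 2 (add (var 2) (const 1))

def maxBody : Prog :=
  seq (ite (sub (get 6 (var 2)) (var 15)) (assign 15 (get 6 (var 2))) skip) <|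
  assign 2 (add (var 2) (const 1))

/-- One step of the binary search between the levels in the variables `9` and `10`. -/
def levelBody : Prog :=
  seq (assign 11 (sub (var 10) (var 9))) <| seq halfProg <|
  seq (assign 11 (add (var 9) (var 12))) <| seq testProg <|
  ite (var 14) (assign 10 (var 11)) (assign 9 (var 11))

/-- If there are edges, variable `9` is an infeasible and `10` a feasible level, until they are
adjacent. The final test is needed because the memory may hold the orientation of a failed test. -/
def levelsProg : Prog :=
  seq (assign 9 (const 0)) <| seq (assign 10 (add (var 15) (var 15))) <|
  seq (loop (sub (sub (var 10) (var 9)) (const 1)) levelBody) <|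
  seq (assign 11 (var 10)) testProg

def mainProg : Prog :=
  seq (loop (sub (var 1) (var 2)) setupBody) <|
  seq (assign 2 (const 0)) <| seq (loop (sub (var 0) (var 2)) maxBody) levelsProg

section

variable {W : ℕ} {eid nxt fst deg cap : ℕ → ℕ} {σ : Store}

variable (N) in
/-- The memory at the start. -/
structure Start (σ : Store) : Prop where
  n : σ.var 0 = N.n
  m : σ.var 1 = N.m
  a : σ.arr 0 = N.a
  b : σ.arr 1 = N.b
  var : ∀ x, 2 ≤ x → σ.var x = 0
  arr : ∀ a, 2 ≤ a → σ.arr a = fun _ => 0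

theorem wp_setup (hW : 4 * (N.n + N.m) + 4 ≤ W) (hS : N.Start σ) :
    wp W (loop (sub (var 1) (var 2)) setupBody) (fun τ t =>
      (∃ eid nxt fst, N.Static eid nxt fst N.degree τ ∧ N.Lists eid nxt fst) ∧
      τ.arr 7 = N.indeg (τ.arr 2) ∧ N.Ori (τ.arr 2) ∧ t ≤ 100 * N.m + 4) σ := by
  have hloop := wp_loop (W := W) (σ := σ) (e := sub (var 1) (var 2)) (p := setupBody)
    (k := 100 * N.m)
    (fun k τ => (τ.var 2 ≤ N.m ∧ τ.var 16 = 2 * τ.var 2 ∧ (∀ e < τ.var 2, τ.arr 2 e = N.a e) ∧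
      τ.arr 7 = count N.b (τ.var 2) ∧
      (τ.arr 6 = fun v => count N.a (τ.var 2) v + count N.b (τ.var 2) v) ∧
      N.ListsUpTo (2 * τ.var 2) (τ.arr 3) (τ.arr 4) (τ.arr 5)) ∧ k = 100 * (N.m - τ.var 2)) ?_ ?_
  · refine hloop.mono fun τ t hf => ?_
    rintro ⟨k', h1, ⟨⟨h2, h3, h4, h5, h6, h7⟩, h8⟩, h9⟩
    have hm := (hf.var 1 rfl).trans hS.m
    simp only [Expr.eval, hm] at h9
    have h10 : τ.var 2 = N.m := by omega
    rw [h10] at h4 h5 h6 h7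
    refine ⟨⟨_, _, _, ⟨(hf.var 0 rfl).trans hS.n, hm, (hf.arr 0 rfl).trans hS.a,
      (hf.arr 1 rfl).trans hS.b, rfl, rfl, rfl, h6⟩, h7⟩, ?_, fun e he => Or.inl (h4 e he), ?_⟩
    · rw [h5]
      funext v
      unfold count indeg
      congr 1
      refine filter_congr fun e he => ?_
      rw [hd, h4 e (mem_range.1 he), Nat.add_sub_cancel_left]
    · simp only [Expr.cost] at h1
      omega
  · rw [hS.var 2 (by omega), hS.var 16 (by omega), hS.arr 7 (by omega), hS.arr 6 (by omega),
      hS.arr 3 (by omega), hS.arr 4 (by omega), hS.arr 5 (by omega)]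
    refine ⟨⟨Nat.zero_le _, rfl, by simp, by funext v; simp [count], by funext v; simp [count],
      ⟨?_, ?_, ?_, ?_, ?_, ?_, ?_⟩⟩, rfl⟩ <;> intros <;> omega
  · rintro k τ hf ⟨⟨h2, h3, h4, h5, h6, h7⟩, rfl⟩
    have hn := (hf.var 0 rfl).trans hS.n
    have hm := (hf.var 1 rfl).trans hS.m
    have ha := (hf.arr 0 rfl).trans hS.a
    have hb := (hf.arr 1 rfl).trans hS.b
    refine ⟨by simp only [Expr.Fits, hm]; omega, fun he => ?_⟩
    simp only [Expr.eval, hm] at he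
    have hi : τ.var 2 < N.m := by omega
    have ha' := N.a_lt _ hi
    have hb' := N.b_lt _ hi
    have hne := N.ne _ hi
    have ha1 := count_le N.a (τ.var 2) (N.a (τ.var 2))
    have ha2 := count_le N.b (τ.var 2) (N.a (τ.var 2))
    have hb1 := count_le N.a (τ.var 2) (N.b (τ.var 2))
    have hb2 := count_le N.b (τ.var 2) (N.b (τ.var 2))
    have hL1 := h7.push (own_odd _) ha' (e := τ.var 2) (by omega)
    have hL2 := hL1.push (own_even _) hb' (e := τ.var 2) (by omega)
    have hf1 := h7.fst_le _ ha'
    have hf2 := hL1.fst_le _ hb'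
    have hu : Function.update (fun v => count N.a (τ.var 2) v + count N.b (τ.var 2) v)
        (N.a (τ.var 2)) (count N.a (τ.var 2) (N.a (τ.var 2)) +
          count N.b (τ.var 2) (N.a (τ.var 2)) + 1) (N.b (τ.var 2)) =
        count N.a (τ.var 2) (N.b (τ.var 2)) + count N.b (τ.var 2) (N.b (τ.var 2)) :=
      Function.update_of_ne hne.symm _ _
    simp only [setupBody, wp_seq, wp_assign, wp_put, wp_ite, wp_skip, Expr.eval, Expr.Fits,
      Expr.cost, Store.setVar_var_self, Store.setVar_var_ne, Store.setVar_arr, Store.setArr_var,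
      Store.setArr_arr_self, Store.setArr_arr_ne, ne_eq, Nat.reduceEqDiff, not_false_eq_true,
      ha, hb, h3, h5, h6, hu, OfNat.ofNat_ne_zero, OfNat.ofNat_ne_one, OfNat.zero_ne_ofNat,
      OfNat.one_ne_ofNat]
    refine ⟨by omega, by omega, by omega, by omega, by omega, by omega, by omega, by omega,
      by omega, by omega, by omega, by omega, by omega, by omega, by omega, by omega, by omega,
      by omega, by omega, by omega, by omega, by omega, by omega, _, ?_,
      ⟨by omega, by omega, fun e he => ?_, ?_, ?_, hL2⟩, rfl⟩
    · omega
    · rcases Nat.lt_succ_iff_lt_or_eq.1 he with he | rfl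
      · rw [Function.update_of_ne he.ne, h4 e he]
      · rw [Function.update_self]
    · rw [count_succ]
    · rw [count_succ, count_succ]
      funext v
      simp only [Function.update_apply]
      split_ifs <;> subst_vars <;> omega

theorem wp_max (hW : 4 * (N.n + N.m) + 4 ≤ W) (hS : N.Static eid nxt fst deg σ)
    (hdeg : ∀ v < N.n, deg v ≤ 2 * N.m) (h2 : σ.var 2 = 0) (h15 : σ.var 15 = 0) :
    wp W (loop (sub (var 0) (var 2)) maxBody) (fun τ t => (∀ v < N.n, deg v ≤ τ.var 15) ∧
      (τ.var 15 = 0 ∨ ∃ v < N.n, deg v = τ.var 15) ∧ t ≤ 50 * N.n + 4) σ := by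
  have hloop := wp_loop (W := W) (σ := σ) (e := sub (var 0) (var 2)) (p := maxBody)
    (k := 50 * N.n)
    (fun k τ => (τ.var 2 ≤ N.n ∧ (∀ v < τ.var 2, deg v ≤ τ.var 15) ∧
      (τ.var 15 = 0 ∨ ∃ v < N.n, deg v = τ.var 15)) ∧ k = 50 * (N.n - τ.var 2))
    ⟨by simp [h2, h15], by rw [h2]; rfl⟩ ?_
  · refine hloop.mono fun τ t hf => ?_
    rintro ⟨k', h1, ⟨⟨h4, h4', h4''⟩, h5⟩, h6⟩
    simp only [Expr.eval, (hS.frame hf rfl).n] at h6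
    simp only [Expr.cost] at h1
    exact ⟨fun v hv => h4' v (by omega), h4'', by omega⟩
  · rintro k τ hf ⟨⟨hi, I, I'⟩, rfl⟩
    have hSτ := hS.frame hf rfl
    refine ⟨by simp only [Expr.Fits, hSτ.n]; omega, fun he => ?_⟩
    simp only [Expr.eval, hSτ.n] at he
    have hi' : τ.var 2 < N.n := by omega
    have hdi := hdeg _ hi'
    have h15 : τ.var 15 ≤ 2 * N.m := by
      rcases I' with h | ⟨v, hv, h⟩
      · omega
      · rw [← h]
        exact hdeg v hv
    simp only [maxBody, wp_seq, wp_assign, wp_put, wp_ite, wp_skip, Expr.eval, Expr.Fits,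
      Expr.cost, Store.setVar_var_self, Store.setVar_var_ne, Store.setVar_arr, Store.setArr_var,
      Store.setArr_arr_self, Store.setArr_arr_ne, ne_eq, Nat.reduceEqDiff,
      not_false_eq_true, hSτ.n, hSτ.deg, OfNat.ofNat_ne_zero]
    refine ⟨by omega, fun h => ?_, fun h => ?_⟩
    · refine ⟨by omega, by omega, _, ?_, ⟨by omega, fun v hv => ?_, Or.inr ⟨_, hi', rfl⟩⟩, rfl⟩
      · omega
      · rcases Nat.lt_succ_iff_lt_or_eq.1 hv with hv | rfl
        · have := I v hv
          omega
        · exact le_rfl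
    · refine ⟨by omega, _, ?_, ⟨by omega, fun v hv => ?_, I'⟩, rfl⟩
      · omega
      · rcases Nat.lt_succ_iff_lt_or_eq.1 hv with hv | rfl
        · exact I v hv
        · omega

theorem not_feasible_zero (hm : 0 < N.m) (deg : ℕ → ℕ) : ¬ N.Feasible deg 0 := by
  rintro ⟨c, h1, h2⟩
  have h3 := h2 _ (h1.hd_lt hm)
  have h4 : 0 < N.indeg c (N.hd c 0) := card_pos.2 ⟨0, by simp [hm]⟩
  have := levelCap_le 0 (deg (N.hd c 0))
  omega

theorem wp_levels (hW : 4 * (N.n + N.m) + 4 ≤ W) (hS : N.Static eid nxt fst N.degree σ)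
    (L : N.Lists eid nxt fst) (h7 : σ.arr 7 = N.indeg (σ.arr 2)) (ho : N.Ori (σ.arr 2))
    {D M r : ℕ} (hD : D ≤ N.n) (hM : N.CutBound D M) (hmax : ∀ v < N.n, N.degree v ≤ σ.var 15)
    (h15 : σ.var 15 = 0 ∨ ∃ v < N.n, N.degree v = σ.var 15) (hr : 2 * σ.var 15 ≤ 2 ^ r) :
    wp W levelsProg (fun τ t => N.Ori (τ.arr 2) ∧
      (∃ z, (∀ v < N.n, N.indeg (τ.arr 2) v ≤ levelCap z (N.degree v)) ∧
        ∀ j < z, ¬ N.Feasible N.degree j) ∧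
      t ≤ (r + 1) * (2000 * ((D + M + 1) * (N.n + N.m + 1))) + 50) σ := by
  have hX : N.n + N.m + 1 ≤ (D + M + 1) * (N.n + N.m + 1) := Nat.le_mul_of_pos_left _ (by omega)
  set X := (D + M + 1) * (N.n + N.m + 1) with hXdef
  have hmx : σ.var 15 ≤ 2 * N.m := by
    rcases h15 with h | ⟨v, hv, h⟩
    · omega
    · rw [← h]
      exact N.degree_le v
  have hdeg : ∀ v < N.n, N.degree v ≤ 2 * N.m := fun v _ => N.degree_le v
  simp only [levelsProg, wp_seq, wp_assign, Expr.eval, Expr.Fits, Expr.cost, ne_eq,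
    Nat.reduceEqDiff, not_false_eq_true, Store.setVar_var_ne]
  refine ⟨by omega, by omega, ?_⟩
  have hS1 : N.Static eid nxt fst N.degree ((σ.setVar 9 0).setVar 10 (σ.var 15 + σ.var 15)) := by
    constructor <;> simp [hS.n, hS.m, hS.a, hS.b, hS.eid, hS.nxt, hS.fst, hS.deg]
  have hloop := wp_loop (W := W) (σ := (σ.setVar 9 0).setVar 10 (σ.var 15 + σ.var 15))
    (e := sub (sub (var 10) (var 9)) (const 1)) (p := levelBody) (k := r * (2000 * X))
    (fun k τ => τ.arr 7 = N.indeg (τ.arr 2) ∧ N.Ori (τ.arr 2) ∧ τ.var 9 ≤ τ.var 10 ∧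
      τ.var 10 ≤ 4 * N.m ∧ (τ.var 9 < τ.var 10 ∨ τ.var 10 = 0) ∧
      N.Feasible N.degree (τ.var 10) ∧ (τ.var 9 < τ.var 10 → ¬ N.Feasible N.degree (τ.var 9)) ∧
      ∃ r, τ.var 10 - τ.var 9 ≤ 2 ^ r ∧ k = r * (2000 * X)) ?_ ?_
  · refine hloop.mono fun τ t hf => ?_
    rintro ⟨k', ht, ⟨I1, I2, I3, I4, I5, I6, I7, -⟩, h9⟩
    simp only [Expr.eval, Expr.cost] at h9 ht
    refine ⟨by omega, ?_⟩
    have hS2 : N.Static eid nxt fst N.degree (τ.setVar 11 (τ.var 10)) := by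
      have := hS1.frame hf rfl
      constructor <;> simp [this.n, this.m, this.a, this.b, this.eid, this.nxt, this.fst, this.deg]
    refine (wp_test hW hS2 L hdeg I1 I2 hD hM I4 (by simp)).mono ?_
    rintro ρ t2 - ⟨-, ho2, h14, h3, h4, ht2⟩
    refine ⟨ho2, ⟨τ.var 10, h3 fun h => h4 h I6, fun j hj hfe => ?_⟩, ?_⟩
    · exact I7 (by omega) (hfe.mono (by omega))
    · rw [add_one_mul]
      omega
  · refine ⟨by simpa using h7, by simpa using ho, by simp, by simp; omega, by simp; omega,
      ⟨σ.arr 2, ho, fun v hv => ?_⟩, fun h => ?_, r, ?_, rfl⟩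
    · refine ((indeg_le_degree ho v).trans (hmax v hv)).trans ?_
      simp only [levelCap, Store.setVar_var_self]
      split_ifs <;> omega
    · simp only [ne_eq, Nat.reduceEqDiff, not_false_eq_true, Store.setVar_var_ne,
        Store.setVar_var_self] at h ⊢
      exact not_feasible_zero (by omega) _
    · simp only [ne_eq, Nat.reduceEqDiff, not_false_eq_true, Store.setVar_var_ne,
        Store.setVar_var_self]
      omega
  · rintro k τ hf ⟨I1, I2, I3, I4, I5, I6, I7, r, hr, rfl⟩
    have hS2 := hS1.frame hf rfl
    refine ⟨by simp only [Expr.Fits]; omega, fun he => ?_⟩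
    simp only [Expr.eval] at he
    obtain ⟨r, rfl⟩ : ∃ s, r = s + 1 := by
      refine ⟨r - 1, ?_⟩
      have : r ≠ 0 := by
        rintro rfl
        omega
      omega
    -- The probe lies half the gap, rounded up, above the lower level, so both remaining gaps are at
    -- most half the old bound on the gap.
    rw [pow_succ] at hr
    simp only [levelBody, wp_seq, wp_assign, Expr.eval, Expr.Fits, Expr.cost]
    refine ⟨by omega, ?_⟩
    refine (wp_half (z := τ.var 10 - τ.var 9) (by omega) (by simp) (by omega)).mono ?_
    rintro ρ t1 hf1 ⟨h12, h13, ht1⟩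
    have h9 : ρ.var 9 = τ.var 9 := by rw [hf1.var 9 rfl]; simp
    have h10 : ρ.var 10 = τ.var 10 := by rw [hf1.var 10 rfl]; simp
    have hc1 : ρ.arr 2 = τ.arr 2 := hf1.arr 2 rfl
    refine ⟨by omega, ?_⟩
    have hS3 : N.Static eid nxt fst N.degree (ρ.setVar 11 (ρ.var 9 + ρ.var 12)) := by
      have : N.Static eid nxt fst N.degree ρ := by
        refine Static.frame ?_ hf1 rfl
        constructor <;> simp [hS2.n, hS2.m, hS2.a, hS2.b, hS2.eid, hS2.nxt, hS2.fst, hS2.deg]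
      constructor <;> simp [this.n, this.m, this.a, this.b, this.eid, this.nxt, this.fst, this.deg]
    refine (wp_test hW hS3 L hdeg ?_ ?_ hD hM (z := ρ.var 9 + ρ.var 12) (by omega)
      (by simp)).mono ?_
    · simp only [Store.setVar_arr, hc1]
      exact (hf1.arr 7 rfl).trans I1
    · simpa [hc1] using I2
    rintro κ t2 hf2 ⟨h7', ho2, h14, hok, hno, ht2⟩
    have h9' : κ.var 9 = τ.var 9 := by rw [hf2.var 9 rfl]; simpa using h9
    have h10' : κ.var 10 = τ.var 10 := by rw [hf2.var 10 rfl]; simpa using h10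
    have h11' : κ.var 11 = τ.var 9 + (τ.var 10 - τ.var 9 + 1) / 2 := by
      rw [hf2.var 11 rfl]
      simp [h9, h12]
    rw [h9, h12, ← h11'] at hok hno
    simp only [wp_ite, wp_assign, Expr.eval, Expr.Fits, Expr.cost]
    refine ⟨by omega, fun h => ⟨by omega, ?_⟩, fun h => ⟨by omega, ?_⟩⟩ <;>
    simp only [ne_eq, Nat.reduceEqDiff, not_false_eq_true, Store.setVar_var_ne,
        Store.setVar_var_self, Store.setVar_arr, h9', h10']
    · refine ⟨_, ?_, h7', ho2, by omega, by omega, by omega, ⟨_, ho2, hok h⟩,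
        fun _ => I7 (by omega), r, by omega, rfl⟩
      rw [add_one_mul]
      omega
    · refine ⟨_, ?_, h7', ho2, by omega, by omega, by omega, I6, fun _ => hno h, r, by omega, rfl⟩
      rw [add_one_mul]
      omega

theorem wp_main (hW : 4 * (N.n + N.m) + 4 ≤ W) (hS : N.Start σ) {D M r Δ : ℕ} (hD : D ≤ N.n)
    (hM : N.CutBound D M) (hΔ : ∀ v < N.n, N.degree v ≤ Δ) (hr : 2 * Δ ≤ 2 ^ r) :
    wp W mainProg (fun τ t => N.Ori (τ.arr 2) ∧
      (∃ z, (∀ v < N.n, N.indeg (τ.arr 2) v ≤ levelCap z (N.degree v)) ∧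
        ∀ j < z, ¬ N.Feasible N.degree j) ∧
      t ≤ (r + 2) * (2000 * ((D + M + 1) * (N.n + N.m + 1)))) σ := by
  have hX : N.n + N.m + 1 ≤ (D + M + 1) * (N.n + N.m + 1) := Nat.le_mul_of_pos_left _ (by omega)
  simp only [mainProg, wp_seq]
  refine (wp_setup hW hS).mono ?_
  rintro τ t1 hf1 ⟨⟨eid, nxt, fst, hS1, L⟩, h7, ho, ht1⟩
  simp only [wp_assign, Expr.eval, Expr.Fits, Expr.cost]
  refine ⟨by omega, ?_⟩
  have hS2 : N.Static eid nxt fst N.degree (τ.setVar 2 0) := by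
    constructor <;> simp [hS1.n, hS1.m, hS1.a, hS1.b, hS1.eid, hS1.nxt, hS1.fst, hS1.deg]
  refine (wp_max hW hS2 (fun v _ => N.degree_le v) (by simp) ?_).mono ?_
  · simp only [ne_eq, Nat.reduceEqDiff, not_false_eq_true, Store.setVar_var_ne]
    exact (hf1.var 15 rfl).trans (hS.var 15 (by omega))
  rintro ρ t2 hf2 ⟨h1, h2, ht2⟩
  have hc : ρ.arr 2 = τ.arr 2 := hf2.arr 2 rfl
  have h7' : ρ.arr 7 = N.indeg (ρ.arr 2) := by
    rw [hc]
    exact (hf2.arr 7 rfl).trans h7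
  have h15 : ρ.var 15 ≤ Δ := by
    rcases h2 with h | ⟨v, hv, h⟩
    · omega
    · rw [← h]
      exact hΔ v hv
  refine (wp_levels hW (hS2.frame hf2 rfl) L h7' (by rwa [hc]) hD hM h1 h2
    (r := r) (by omega)).mono ?_
  rintro κ t3 - ⟨h3, h4, ht3⟩
  refine ⟨h3, h4, ?_⟩
  have : (r + 2) * (2000 * ((D + M + 1) * (N.n + N.m + 1))) =
      (r + 1) * (2000 * ((D + M + 1) * (N.n + N.m + 1))) +
        2000 * ((D + M + 1) * (N.n + N.m + 1)) := by ring
  omega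

end

end Net
end StarPartition

namespace StarPartition
namespace Net

open Finset

variable {N : Net}

/-! ### Small cuts between levels -/

/-- A valid labelling rises by at most one along an edge, so an edge entering the level set starts
exactly one level below. -/
theorem cut_level_le {c l : ℕ → ℕ} (ho : N.Ori c) (hl : N.Valid l c) (i : ℕ) :
    N.cut {v ∈ range N.n | i ≤ l v} c ≤
      #{e ∈ range N.m | l (c e) + 1 = i ∧ l (N.hd c e) = i} := by
  refine card_le_card fun e => ?_
  simp only [mem_filter, mem_range, not_and, not_le]
  rintro ⟨he, ⟨h1, h2⟩, h3⟩
  have := h3 (ho.lt he)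
  have := hl e he
  exact ⟨he, by omega, by omega⟩

/-- Pigeonhole: the edges between consecutive levels are disjoint for different levels. -/
theorem cutBound_of_lt_mul {D M : ℕ} (h : N.m < D * (M + 1)) : N.CutBound D M := by
  intro c l ho hl
  by_contra hcon
  push Not at hcon
  have h1 : ∑ i ∈ Icc 1 D, #{e ∈ range N.m | l (c e) + 1 = i ∧ l (N.hd c e) = i} ≤ N.m := by
    rw [← card_biUnion]
    · refine (card_le_card ?_).trans (card_range N.m).le
      intro e
      simp only [mem_biUnion, mem_filter]
      rintro ⟨i, -, h, -⟩
      exact h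
    · intro i _ j _ hij
      rw [Function.onFun, disjoint_filter]
      omega
  have h2 : ∑ i ∈ Icc 1 D, (M + 1) ≤
      ∑ i ∈ Icc 1 D, #{e ∈ range N.m | l (c e) + 1 = i ∧ l (N.hd c e) = i} := by
    refine sum_le_sum fun i hi => ?_
    rw [mem_Icc] at hi
    exact (hcon i hi.1 hi.2).trans_le (cut_level_le ho hl i)
  rw [sum_const, Nat.card_Icc, smul_eq_mul, Nat.add_sub_cancel] at h2
  omega

variable (N) in
/-- There are no parallel edges. -/
def Simple : Prop := ∀ e < N.m, ∀ e' < N.m, s(N.a e, N.b e) = s(N.a e', N.b e') → e = e'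

theorem Ori.mk_eq {c : ℕ → ℕ} (ho : N.Ori c) {e : ℕ} (he : e < N.m) :
    s(c e, N.hd c e) = s(N.a e, N.b e) := by
  rcases ho.hd_eq he with ⟨h1, h2⟩ | ⟨h1, h2⟩ <;> rw [h1, h2]
  exact Sym2.eq_swap

theorem cut_le_mul (hs : N.Simple) {c l : ℕ → ℕ} (ho : N.Ori c) (i : ℕ) :
    #{e ∈ range N.m | l (c e) + 1 = i ∧ l (N.hd c e) = i} ≤
      #{v ∈ range N.n | l v + 1 = i} * #{v ∈ range N.n | l v = i} := by
  rw [← card_product]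
  refine card_le_card_of_injOn (fun e => (c e, N.hd c e)) (fun e he => ?_) fun e he e' he' h => ?_
  · simp only [coe_filter, mem_range, Set.mem_ofPred_eq] at he
    simp only [coe_product, coe_filter, mem_range, Set.mem_prod, Set.mem_ofPred_eq]
    exact ⟨⟨ho.lt he.1, he.2.1⟩, ho.hd_lt he.1, he.2.2⟩
  · simp only [coe_filter, mem_range, Set.mem_ofPred_eq] at he he'
    simp only [Prod.mk.injEq] at h
    refine hs e he.1 e' he'.1 ?_
    rw [← ho.mk_eq he.1, ← ho.mk_eq he'.1, h.1, h.2]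

theorem sum_level_le (l : ℕ → ℕ) (k : ℕ) (S : Finset ℕ) :
    ∑ i ∈ S, #{v ∈ range N.n | l v + k = i} ≤ N.n := by
  rw [← card_biUnion]
  · refine (card_le_card ?_).trans (card_range N.n).le
    intro e
    simp only [mem_biUnion, mem_filter]
    rintro ⟨i, -, h, -⟩
    exact h
  · intro i _ j _ hij
    rw [Function.onFun, disjoint_filter]
    omega

/-- If consecutive levels of sizes x and y have more than M edges between them, then (x + y)² ≥ 4xy
≥ 4(M + 1), so D(x + y) > 2n. Summed over the D cuts this contradicts that each node is counted at
most twice. -/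
theorem cutBound_of_sq_lt (hs : N.Simple) {D M : ℕ} (hD : 1 ≤ D)
    (h : N.n ^ 2 < D ^ 2 * (M + 1)) : N.CutBound D M := by
  intro c l ho hl
  by_contra hcon
  push Not at hcon
  have h1 : ∀ i ∈ Icc 1 D, 2 * N.n <
      D * (#{v ∈ range N.n | l v + 1 = i} + #{v ∈ range N.n | l v + 0 = i}) := by
    intro i hi
    rw [mem_Icc] at hi
    have h2 := (hcon i hi.1 hi.2).trans_le ((cut_level_le ho hl i).trans (cut_le_mul hs ho i))
    simp only [Nat.add_zero]
    set x := #{v ∈ range N.n | l v + 1 = i}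
    set y := #{v ∈ range N.n | l v = i}
    have h3 : 4 * (x * y) ≤ (x + y) ^ 2 := by
      zify
      nlinarith [sq_nonneg ((x : ℤ) - y)]
    refine lt_of_pow_lt_pow_left₀ 2 (Nat.zero_le _) ?_
    calc (2 * N.n) ^ 2 = 4 * N.n ^ 2 := by ring
      _ < 4 * (D ^ 2 * (M + 1)) := by omega
      _ = D ^ 2 * (4 * (M + 1)) := by ring
      _ ≤ D ^ 2 * (x + y) ^ 2 := Nat.mul_le_mul_left _ (by omega)
      _ = (D * (x + y)) ^ 2 := by ring
  have h2 := sum_lt_sum_of_nonempty (s := Icc 1 D) ⟨1, by simp [hD]⟩ h1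
  rw [sum_const, Nat.card_Icc, smul_eq_mul, Nat.add_sub_cancel, ← mul_sum, sum_add_distrib] at h2
  have h3 := sum_level_le (N := N) l 1 (Icc 1 D)
  have h4 := sum_level_le (N := N) l 0 (Icc 1 D)
  have h5 := Nat.lt_of_mul_lt_mul_left h2
  omega

/-- The number of phases is at most `4 * min (n ^ (2 / 3)) (m ^ (1 / 2))`. -/
theorem exists_cutBound (hs : N.Simple) (hn : 0 < N.n) (hm : 0 < N.m) (hmn : N.m < N.n * N.n) :
    ∃ D M, D ≤ N.n ∧ N.CutBound D M ∧ ((D + M + 1 : ℕ) : ℝ) ≤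
      4 * min ((N.n : ℝ) ^ (2 / 3 : ℝ)) ((N.m : ℝ) ^ (1 / 2 : ℝ)) := by
  have hn1 : (1 : ℝ) ≤ N.n := by exact_mod_cast hn
  have hm1 : (1 : ℝ) ≤ N.m := by exact_mod_cast hm
  rcases le_total ((N.n : ℝ) ^ (2 / 3 : ℝ)) ((N.m : ℝ) ^ (1 / 2 : ℝ)) with h | h
  · rw [min_eq_left h]
    set x := (N.n : ℝ) ^ (2 / 3 : ℝ) with hx
    have hx1 : 1 ≤ x := Real.one_le_rpow hn1 (by norm_num)
    have hxn : x ≤ N.n := by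
      calc x ≤ (N.n : ℝ) ^ (1 : ℝ) := Real.rpow_le_rpow_of_exponent_le hn1 (by norm_num)
        _ = N.n := Real.rpow_one _
    have hx3 : x ^ 3 = (N.n : ℝ) ^ 2 := by
      rw [hx, ← Real.rpow_natCast, ← Real.rpow_mul (by positivity), ← Real.rpow_natCast]
      norm_num
    have h1 : x ≤ ⌈x⌉₊ := Nat.le_ceil x
    have h2 : x < ⌊x⌋₊ + 1 := Nat.lt_floor_add_one x
    have h3 : (⌈x⌉₊ : ℝ) < x + 1 := Nat.ceil_lt_add_one (by positivity)
    have h4 : (⌊x⌋₊ : ℝ) ≤ x := Nat.floor_le (by positivity)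
    -- With x = n^(2/3), D² (M + 1) > x³ = n².
    refine ⟨⌈x⌉₊, ⌊x⌋₊, Nat.ceil_le.2 hxn, cutBound_of_sq_lt hs (Nat.one_le_ceil_iff.2
      (by positivity)) ?_, ?_⟩
    · have : (N.n : ℝ) ^ 2 < (⌈x⌉₊ : ℝ) ^ 2 * (⌊x⌋₊ + 1) := by
        rw [← hx3]
        calc x ^ 3 = x ^ 2 * x := by ring
          _ < x ^ 2 * (⌊x⌋₊ + 1) := by gcongr
          _ ≤ (⌈x⌉₊ : ℝ) ^ 2 * (⌊x⌋₊ + 1) := by gcongr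
      exact_mod_cast this
    · push_cast
      linarith
  · rw [min_eq_right h, ← Real.sqrt_eq_rpow]
    have h1 : (Nat.sqrt N.m : ℝ) ≤ √N.m := Real.nat_sqrt_le_real_sqrt
    have h2 : 1 ≤ √(N.m : ℝ) := Real.one_le_sqrt.2 hm1
    refine ⟨Nat.sqrt N.m + 1, Nat.sqrt N.m, Nat.sqrt_lt.2 hmn,
      cutBound_of_lt_mul (Nat.lt_succ_sqrt _), ?_⟩
    push_cast
    linarith

end Net
end StarPartition

namespace StarPartition

/-! ### Optimal colorings from minimal levels -/

section

variable {V : Type*} {G : SimpleGraph V}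

namespace Orientation

variable (Λ : Orientation G) (v : V)

theorem setOf_arc_subset : {u | Λ.arc u v} ⊆ G.neighborSet v :=
  fun u hu => (Λ.adj_of_arc u v hu).symm

variable [Fintype V]

theorem le_maxIndegree : Λ.indegree v ≤ Λ.maxIndegree := Finset.le_sup (Finset.mem_univ v)

variable [DecidableRel G.Adj]

theorem degree_eq_ncard : G.degree v = (G.neighborSet v).ncard := by
  rw [← SimpleGraph.card_neighborSet_eq_degree, Set.ncard_eq_toFinset_card', Set.toFinset_card]

theorem indegree_le_degree : Λ.indegree v ≤ G.degree v := by
  rw [degree_eq_ncard]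
  exact Set.ncard_le_ncard (Λ.setOf_arc_subset v) (Set.toFinite _)

theorem indegree_lt_degree_iff : Λ.indegree v < G.degree v ↔ ∃ u, Λ.arc v u := by
  constructor
  · intro h
    rw [degree_eq_ncard] at h
    obtain ⟨u, hu, hv⟩ := Set.exists_mem_notMem_of_ncard_lt_ncard h (Set.toFinite _)
    rcases Λ.arc_or_arc v u hu with h1 | h1
    · exact ⟨u, h1⟩
    · exact absurd h1 hv
  · rintro ⟨u, hu⟩
    rw [degree_eq_ncard]
    refine Set.ncard_lt_ncard ⟨Λ.setOf_arc_subset v, fun h => ?_⟩ (Set.toFinite _)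
    exact Λ.not_arc_of_arc v u hu (h (Λ.adj_of_arc v u hu))

end Orientation

namespace StarColoring

theorem image_color (C : StarColoring G) (v : V) :
    C.color '' {e : G.edgeSet | v ∈ (e : Sym2 V)} =
      {u | C.toOrientation.arc u v} ∪ {u | u = v ∧ ∃ w, C.toOrientation.arc v w} := by
  ext u
  simp only [Set.mem_image, Set.mem_ofPred_eq, Set.mem_union]
  constructor
  · rintro ⟨⟨e, he⟩, hv, rfl⟩
    obtain ⟨w, rfl⟩ := Sym2.mem_iff_exists.1 hv
    have h1 := C.color_mem ⟨s(v, w), he⟩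
    rcases Sym2.mem_iff.1 h1 with h2 | h2
    · exact Or.inr ⟨h2, w, he, h2⟩
    · left
      have hwv : G.Adj w v := SimpleGraph.Adj.symm he
      have h3 : (⟨s(v, w), he⟩ : G.edgeSet) = ⟨s(w, v), hwv⟩ := Subtype.ext Sym2.eq_swap
      rw [h2]
      exact ⟨hwv, by rw [← h3]; exact h2⟩
  · rintro (⟨h, h1⟩ | ⟨rfl, w, h, h1⟩)
    · exact ⟨⟨s(u, v), h⟩, Sym2.mem_mk_right u v, h1⟩
    · exact ⟨⟨s(u, w), h⟩, Sym2.mem_mk_left u w, h1⟩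

theorem numColors_le_starNumber [Fintype V] (C : StarColoring G) (v : V) :
    C.numColors v ≤ C.starNumber :=
  Finset.le_sup (Finset.mem_univ v)

variable [Fintype V] [DecidableRel G.Adj] (C : StarColoring G) (v : V)

/-- Incoming edges show the pairwise distinct in-neighbours; all outgoing edges together show only
`v`. -/
theorem numColors_eq : C.numColors v = C.toOrientation.indegree v +
    if C.toOrientation.indegree v < G.degree v then 1 else 0 := by
  rw [numColors, image_color, Set.ncard_union_eq ?_ (Set.toFinite _) (Set.toFinite _)]
  · rw [Orientation.indegree]
    congr 1
    have h := C.toOrientation.indegree_lt_degree_iff v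
    rw [Orientation.indegree] at h
    split_ifs with h1
    · have h2 : {u | u = v ∧ ∃ w, C.toOrientation.arc v w} = {v} := by
        ext u
        simp [h.1 h1]
      rw [h2, Set.ncard_singleton]
    · rw [h] at h1
      simp [h1]
  · rw [Set.disjoint_left]
    rintro u hu ⟨rfl, -⟩
    exact C.toOrientation.not_arc_of_arc u u hu hu

theorem indegree_le_numColors : C.toOrientation.indegree v ≤ C.numColors v := by
  rw [numColors_eq]
  omega

theorem numColors_le_degree : C.numColors v ≤ G.degree v := by
  have := C.toOrientation.indegree_le_degree v
  rw [numColors_eq]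
  split_ifs <;> omega

theorem maxIndegree_le_starNumber : C.toOrientation.maxIndegree ≤ C.starNumber :=
  Finset.sup_mono_fun fun v _ => C.indegree_le_numColors v

end StarColoring

theorem Orientation.exists_starColoring (Λ : Orientation G) :
    ∃ C : StarColoring G, C.toOrientation = Λ := by
  have h : ∀ e : G.edgeSet, ∃ u v, (e : Sym2 V) = s(u, v) ∧ Λ.arc u v := by
    rintro ⟨e, he⟩
    induction e using Sym2.ind with
    | _ u v =>
      rcases Λ.arc_or_arc u v he with h | h
      · exact ⟨u, v, rfl, h⟩
      · exact ⟨v, u, Sym2.eq_swap, h⟩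
  choose t hd h1 h2 using h
  refine ⟨⟨t, fun e => by rw [h1 e]; exact Sym2.mem_mk_left _ _⟩, ?_⟩
  obtain ⟨arc, h3, h4, h5⟩ := Λ
  simp only [StarColoring.toOrientation, Orientation.mk.injEq]
  ext u v
  constructor
  · rintro ⟨h, h6⟩
    have h7 := h1 ⟨s(u, v), h⟩
    rw [h6] at h7
    have h8 := h2 ⟨s(u, v), h⟩
    rw [h6] at h8
    rcases Sym2.eq_iff.1 h7 with ⟨-, h9⟩ | ⟨h9, h10⟩
    · rw [h9]
      exact h8
    · exact absurd h10.symm h.ne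
  · intro h
    refine ⟨h3 u v h, ?_⟩
    have h7 := h1 ⟨s(u, v), h3 u v h⟩
    have h8 := h2 ⟨s(u, v), h3 u v h⟩
    rcases Sym2.eq_iff.1 h7 with ⟨h9, -⟩ | ⟨h9, h10⟩
    · exact h9.symm
    · rw [← h9, ← h10] at h8
      exact absurd h8 (h5 u v h)

open Net in
/-- A coloring on the smallest feasible level is optimal for both problems. -/
theorem StarColoring.isOptimal_of_level [Fintype V] [DecidableRel G.Adj] {κ : V → ℕ}
    (hκ : ∀ v, G.degree v ≤ κ v) (C : StarColoring G) (j : ℕ)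
    (hC : ∀ v, C.toOrientation.indegree v ≤ levelCap j (G.degree v))
    (hmin : ∀ i < j, ¬ ∃ C : StarColoring G,
      ∀ v, C.toOrientation.indegree v ≤ levelCap i (G.degree v)) :
    C.IsOptimal κ ∧ C.toOrientation.IsOptimal κ ∧ minMaxInd G κ ≤ minMaxStar G κ ∧
      minMaxStar G κ ≤ minMaxInd G κ + 1 := by
  have hval : C.Valid κ := fun v => (C.numColors_le_degree v).trans (hκ v)
  have hval' : C.toOrientation.Valid κ :=
    fun v => (C.toOrientation.indegree_le_degree v).trans (hκ v)
  have hind : C.toOrientation.maxIndegree ≤ (j + 1) / 2 := by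
    refine Finset.sup_le fun v _ => (hC v).trans ?_
    unfold levelCap
    split_ifs <;> omega
  have hind' : ∀ Λ : Orientation G, (j + 1) / 2 ≤ Λ.maxIndegree := by
    intro Λ
    by_contra hlt
    obtain ⟨C', rfl⟩ := Λ.exists_starColoring
    -- An orientation with maximum indegree k lives on level 2k.
    refine hmin (2 * C'.toOrientation.maxIndegree) (by omega) ⟨C', fun v => ?_⟩
    have := C'.toOrientation.le_maxIndegree v
    unfold levelCap
    split_ifs <;> omega
  have hk : C.toOrientation.maxIndegree = (j + 1) / 2 := le_antisymm hind (hind' _)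
  have hstar : C.starNumber ≤ C.toOrientation.maxIndegree + 1 := by
    refine Finset.sup_le fun v _ => ?_
    have := C.toOrientation.le_maxIndegree v
    rw [C.numColors_eq]
    split_ifs <;> omega
  have hstar' : ∀ C' : StarColoring G, C.starNumber ≤ C'.starNumber := by
    intro C'
    -- Level `0` has no odd level below it; a coloring on it has no arcs, hence no colors.
    by_cases hj : j = 0
    · subst hj
      refine (Finset.sup_le fun v _ => ?_).trans (Nat.zero_le _)
      have h0 : ∀ v, C.toOrientation.indegree v = 0 := fun v =>
        Nat.le_zero.1 ((hC v).trans (levelCap_le 0 _))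
      rw [C.numColors_eq, h0, if_neg]
      rw [← h0 v, C.toOrientation.indegree_lt_degree_iff]
      rintro ⟨u, hu⟩
      have h1 := h0 u
      rw [Orientation.indegree, Set.ncard_eq_zero (Set.toFinite _)] at h1
      exact Set.notMem_empty v (h1 ▸ hu)
    have h1 := (hind' C'.toOrientation).trans C'.maxIndegree_le_starNumber
    rcases Nat.even_or_odd' j with ⟨k, rfl | rfl⟩
    · by_contra hlt
      -- Since `C` shows at most k + 1 colors at a node, a better coloring shows at most k, which
      -- puts it on level 2k - 1.
      refine hmin (2 * k - 1) (by omega) ⟨C', fun v => ?_⟩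
      have h2 := C'.numColors_le_starNumber v
      have h3 := C'.toOrientation.indegree_le_degree v
      rw [C'.numColors_eq] at h2
      unfold levelCap
      split_ifs at h2 ⊢ <;> omega
    -- On level 2k + 1 no node sees more than k + 1 colors, and k + 1 is already a lower bound for
    -- the maximum indegree.
    · refine (Finset.sup_le fun v _ => ?_).trans h1
      have h2 := hC v
      have h3 := C.numColors_le_degree v
      have h4 := C.numColors_eq v
      unfold levelCap at h2
      split_ifs at h2 h4 <;> omega
  have h1 : (C.starNumber : ℕ∞) = minMaxStar G κ :=
    le_antisymm (le_iInf fun C' => by exact_mod_cast hstar' C'.1)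
      (iInf_le (fun C : {C : StarColoring G // C.Valid κ} => (C.1.starNumber : ℕ∞)) ⟨C, hval⟩)
  have h2 : (C.toOrientation.maxIndegree : ℕ∞) = minMaxInd G κ :=
    le_antisymm (le_iInf fun Λ => by rw [hk]; exact_mod_cast hind' Λ.1)
      (iInf_le (fun Λ : {Λ : Orientation G // Λ.Valid κ} => (Λ.1.maxIndegree : ℕ∞))
        ⟨C.toOrientation, hval'⟩)
  refine ⟨⟨hval, h1⟩, ⟨hval', h2⟩, ?_, ?_⟩
  · rw [← h1, ← h2]
    exact_mod_cast C.maxIndegree_le_starNumber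
  · rw [← h1, ← h2]
    exact_mod_cast hstar

open Net in
theorem exists_isOptimal [Fintype V] [DecidableRel G.Adj] {κ : V → ℕ}
    (hκ : ∀ v, G.degree v ≤ κ v) :
    (∃ C : StarColoring G, C.IsOptimal κ ∧ C.toOrientation.IsOptimal κ) ∧
      minMaxInd G κ ≤ minMaxStar G κ ∧ minMaxStar G κ ≤ minMaxInd G κ + 1 := by
  classical
  have hex : ∃ j, ∃ C : StarColoring G,
      ∀ v, C.toOrientation.indegree v ≤ levelCap j (G.degree v) := by
    refine ⟨2 * G.maxDegree, ⟨fun e => (e : Sym2 V).out.1, fun e => Sym2.out_fst_mem _⟩,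
      fun v => ?_⟩
    refine (Orientation.indegree_le_degree _ v).trans ?_
    have := G.degree_le_maxDegree v
    unfold levelCap
    split_ifs <;> omega
  obtain ⟨C, hC⟩ := Nat.find_spec hex
  obtain ⟨h1, h2, h3⟩ := C.isOptimal_of_level hκ _ hC fun i hi => Nat.find_min hex hi
  exact ⟨⟨C, h1, h2⟩, h3⟩

end

end StarPartition

namespace StarPartition

/-! ### Edge lists of graphs -/

section

variable {n : ℕ} {G : SimpleGraph (Fin n)} {L : List (Fin n × Fin n)}

theorem mk_val_eq_iff {x y z w : Fin n} :
    s((x : ℕ), (y : ℕ)) = s((z : ℕ), (w : ℕ)) ↔ s(x, y) = s(z, w) := by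
  simp only [Sym2.eq_iff, Fin.ext_iff]

namespace IsEdgeList

theorem inj (hL : IsEdgeList G L) {i j : ℕ} (hi : i < L.length) (hj : j < L.length)
    (h : s((L[i]).1, (L[i]).2) = s((L[j]).1, (L[j]).2)) : i = j := by
  refine (hL.1.getElem_inj_iff (hi := by simpa using hi) (hj := by simpa using hj)).1 ?_
  simpa using h

theorem adj (hL : IsEdgeList G L) {i : ℕ} (hi : i < L.length) : G.Adj (L[i]).1 (L[i]).2 :=
  (hL.2 s((L[i]).1, (L[i]).2)).1 (List.mem_map.2 ⟨L[i], List.getElem_mem hi, rfl⟩)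

theorem exists_index (hL : IsEdgeList G L) {e : Sym2 (Fin n)} (he : e ∈ G.edgeSet) :
    ∃ (i : ℕ) (hi : i < L.length), s((L[i]).1, (L[i]).2) = e := by
  obtain ⟨p, hp, rfl⟩ := List.mem_map.1 ((hL.2 e).2 he)
  obtain ⟨i, hi, rfl⟩ := List.getElem_of_mem hp
  exact ⟨i, hi, rfl⟩

theorem length_eq (hL : IsEdgeList G L) [DecidableRel G.Adj] : L.length = G.edgeFinset.card := by
  have h : (L.map fun p => s(p.1, p.2)).toFinset = G.edgeFinset := by
    ext e
    rw [List.mem_toFinset, hL.2, SimpleGraph.mem_edgeFinset]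
  rw [← h, List.toFinset_card_of_nodup hL.1, List.length_map]

/-- The edge list as a network. -/
def net (hL : IsEdgeList G L) : Net where
  n := n
  m := L.length
  a i := (L.map fun p => (p.1 : ℕ)).getD i 0
  b i := (L.map fun p => (p.2 : ℕ)).getD i 0
  a_lt i hi := by simp [hi]
  b_lt i hi := by simp [hi]
  ne i hi := by simpa [hi, Fin.ext_iff] using (hL.adj hi).ne

variable (hL : IsEdgeList G L)

theorem net_a {i : ℕ} (hi : i < L.length) : hL.net.a i = ((L[i]).1 : ℕ) := by simp [net, hi]

theorem net_b {i : ℕ} (hi : i < L.length) : hL.net.b i = ((L[i]).2 : ℕ) := by simp [net, hi]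

theorem net_simple : hL.net.Simple := by
  intro i hi j hj h
  rw [hL.net_a hi, hL.net_b hi, hL.net_a hj, hL.net_b hj] at h
  exact hL.inj hi hj (mk_val_eq_iff.1 h)

/-- `c i` is the color of the `i`-th edge. -/
def Represents (L : List (Fin n × Fin n)) (c : ℕ → ℕ) (C : StarColoring G) : Prop :=
  ∀ (i : ℕ) (hi : i < L.length) (e : G.edgeSet),
    (e : Sym2 (Fin n)) = s((L[i]).1, (L[i]).2) → c i = (C.color e : ℕ)

include hL in
theorem exists_coloring {c : ℕ → ℕ} (hc : hL.net.Ori c) :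
    ∃ C : StarColoring G, Represents L c C := by
  have h : ∀ e : G.edgeSet, ∃ v : Fin n, v ∈ (e : Sym2 (Fin n)) ∧
      ∀ (i : ℕ) (hi : i < L.length), (e : Sym2 (Fin n)) = s((L[i]).1, (L[i]).2) →
        c i = (v : ℕ) := by
    rintro ⟨e, he⟩
    obtain ⟨i, hi, rfl⟩ := hL.exists_index he
    have h1 := hc i hi
    rw [hL.net_a hi, hL.net_b hi] at h1
    rcases h1 with h1 | h1
    · refine ⟨_, Sym2.mem_mk_left _ _, fun j hj h => ?_⟩
      rw [← hL.inj hi hj h, h1]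
    · refine ⟨_, Sym2.mem_mk_right _ _, fun j hj h => ?_⟩
      rw [← hL.inj hi hj h, h1]
  choose f h1 h2 using h
  exact ⟨⟨f, h1⟩, fun i hi e he => h2 e i hi he⟩

include hL in
theorem exists_ori (C : StarColoring G) : ∃ c, hL.net.Ori c ∧ Represents L c C := by
  refine ⟨fun i => if hi : i < L.length then
    (C.color ⟨s((L[i]).1, (L[i]).2), hL.adj hi⟩ : ℕ) else 0, fun i hi => ?_, fun i hi e he => ?_⟩
  · have hi' : i < L.length := hi
    have h1 := Sym2.mem_iff.1 (C.color_mem ⟨s((L[i]).1, (L[i]).2), hL.adj hi'⟩)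
    rw [hL.net_a hi', hL.net_b hi']
    dsimp only
    rw [dif_pos hi']
    rcases h1 with h1 | h1 <;> rw [h1]
    exacts [Or.inl rfl, Or.inr rfl]
  · simp only [hi, dite_true]
    congr 2
    exact Subtype.ext he.symm

-- The bijection sends the index of an edge with head `v` to its tail; it is injective because no
-- edge is listed twice.
include hL in
theorem indegree_eq {c : ℕ → ℕ} {C : StarColoring G} (hc : hL.net.Ori c)
    (h : Represents L c C) (v : Fin n) : C.toOrientation.indegree v = hL.net.indeg c v := by
  unfold Orientation.indegree Net.indeg
  rw [← Set.ncard_coe_finset]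
  symm
  have hmk : ∀ (i : ℕ) (hi : i < L.length) (hi' : i < hL.net.m), hL.net.hd c i = v →
      s((⟨c i, hc.lt hi'⟩ : Fin n), v) = s((L[i]).1, (L[i]).2) := by
    intro i hi hi' hv
    have h1 := hc.mk_eq hi'
    rw [hL.net_a hi, hL.net_b hi, hv] at h1
    exact mk_val_eq_iff.1 h1
  refine Set.ncard_congr (fun i hi => ⟨c i, hc.lt (Finset.mem_range.1 (Finset.mem_filter.1 hi).1)⟩)
    (fun i hi => ?_) (fun i j hi hj hij => ?_) fun u hu => ?_
  · simp only [Finset.coe_filter, Finset.mem_range, Set.mem_ofPred_eq] at hi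
    have hi1 : i < L.length := hi.1
    have h1 := hmk i hi1 hi.1 hi.2
    have h2 : s((⟨c i, hc.lt hi.1⟩ : Fin n), v) ∈ G.edgeSet := by
      rw [h1]
      exact hL.adj hi1
    exact ⟨h2, Fin.ext (h i hi1 ⟨_, h2⟩ h1).symm⟩
  · simp only [Finset.coe_filter, Finset.mem_range, Set.mem_ofPred_eq] at hi hj
    have h1 := hmk i hi.1 hi.1 hi.2
    have h2 := hmk j hj.1 hj.1 hj.2
    have h3 : (⟨c i, hc.lt hi.1⟩ : Fin n) = ⟨c j, hc.lt hj.1⟩ := hij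
    rw [h3] at h1
    exact hL.inj hi.1 hj.1 (h1.symm.trans h2)
  · obtain ⟨hadj, hcol⟩ := hu
    obtain ⟨i, hi, h1⟩ := hL.exists_index (e := s(u, v)) hadj
    have h2 := h i hi ⟨s(u, v), hadj⟩ h1.symm
    rw [hcol] at h2
    have h3 : hL.net.hd c i = v := by
      have h4 := hc.mk_eq (e := i) hi
      rw [hL.net_a hi, hL.net_b hi, h2] at h4
      exact Sym2.congr_right.1 (h4.trans (mk_val_eq_iff.2 h1))
    refine ⟨i, ?_, Fin.ext h2⟩
    simp only [Finset.coe_filter, Finset.mem_range, Set.mem_ofPred_eq]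
    exact ⟨hi, h3⟩

theorem degree_eq [DecidableRel G.Adj] (v : Fin n) : hL.net.degree v = G.degree v := by
  rw [← SimpleGraph.card_incidenceFinset_eq_degree, Net.degree, Net.count, Net.count,
    ← Finset.card_union_of_disjoint]
  · have hlt : ∀ i ∈ {e ∈ Finset.range hL.net.m | hL.net.a e = v} ∪
        {e ∈ Finset.range hL.net.m | hL.net.b e = v}, i < L.length := by
      intro i hi
      simp only [Finset.mem_union, Finset.mem_filter, Finset.mem_range] at hi
      exact hi.elim (fun h => h.1) fun h => h.1
    refine Finset.card_bij (fun i hi => s((L[i]'(hlt i hi)).1, (L[i]'(hlt i hi)).2))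
      (fun i hi => ?_) (fun i hi j hj hij => ?_) fun e he => ?_
    · have hi1 := hlt i hi
      simp only [Finset.mem_union, Finset.mem_filter, Finset.mem_range] at hi
      rw [SimpleGraph.mem_incidenceFinset]
      refine ⟨hL.adj hi1, ?_⟩
      rw [hL.net_a hi1, hL.net_b hi1] at hi
      rw [Sym2.mem_iff, Fin.ext_iff, Fin.ext_iff]
      omega
    · exact hL.inj (hlt i hi) (hlt j hj) hij
    · rw [SimpleGraph.mem_incidenceFinset] at he
      obtain ⟨i, hi, rfl⟩ := hL.exists_index he.1
      have h1 := Sym2.mem_iff.1 he.2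
      rw [Fin.ext_iff, Fin.ext_iff] at h1
      refine ⟨i, ?_, rfl⟩
      simp only [Finset.mem_union, Finset.mem_filter, Finset.mem_range]
      rw [hL.net_a hi, hL.net_b hi]
      have hi' : i < hL.net.m := hi
      omega
  · rw [Finset.disjoint_filter]
    intro i hi h1 h2
    exact hL.net.ne i (Finset.mem_range.1 hi) (h1.trans h2.symm)

theorem start_input : hL.net.Start (input n L) where
  n := rfl
  m := rfl
  a := rfl
  b := rfl
  var x hx := by
    simp only [input]
    rw [if_neg (by omega), if_neg (by omega)]
  arr a ha := by
    funext i
    simp only [input]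
    rw [if_neg (by omega), if_neg (by omega)]

open Net in
include hL in
theorem isOptimal_of_level [DecidableRel G.Adj] {c : ℕ → ℕ} {C : StarColoring G}
    (hc : hL.net.Ori c) (hC : Represents L c C) {z : ℕ}
    (hz : ∀ v < hL.net.n, hL.net.indeg c v ≤ levelCap z (hL.net.degree v))
    (hmin : ∀ j < z, ¬ hL.net.Feasible hL.net.degree j) {κ : Fin n → ℕ}
    (hκ : ∀ v, G.degree v ≤ κ v) : C.IsOptimal κ ∧ C.toOrientation.IsOptimal κ := by
  have h := C.isOptimal_of_level hκ z (fun v => ?_) fun j hj ⟨C', hC'⟩ => hmin j hj ?_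
  · exact ⟨h.1, h.2.1⟩
  · rw [hL.indegree_eq hc hC, ← hL.degree_eq]
    exact hz v v.2
  · obtain ⟨c', hc', hr⟩ := hL.exists_ori C'
    refine ⟨c', hc', fun v hv => ?_⟩
    have := hC' ⟨v, hv⟩
    rwa [hL.indegree_eq hc' hr, ← hL.degree_eq] at this

end IsEdgeList

end

/-! ### The running time -/

/-- For Δ ≥ 2 the additive constants are absorbed, because log Δ ≥ log 2. -/
theorem clog_le_log {Δ : ℕ} (hΔ : 2 ≤ Δ) :
    ((Nat.clog 2 (2 * Δ) + 2 : ℕ) : ℝ) ≤ 10 * Real.log Δ := by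
  have h1 := Nat.pow_pred_clog_lt_self one_lt_two (x := 2 * Δ) (by omega)
  have h2 : 0 < Nat.clog 2 (2 * Δ) := Nat.clog_pos one_lt_two (by omega)
  obtain ⟨r, hr⟩ : ∃ r, Nat.clog 2 (2 * Δ) = r + 1 := ⟨_, (Nat.succ_pred_eq_of_pos h2).symm⟩
  rw [hr, Nat.pred_succ] at h1
  rw [hr]
  have h3 : ((2 : ℝ) ^ r) ≤ 2 * Δ := by exact_mod_cast h1.le
  have hΔ' : (2 : ℝ) ≤ Δ := by exact_mod_cast hΔ
  have h4 := Real.log_le_log (by positivity) h3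
  rw [Real.log_pow, Real.log_mul (by norm_num) (by positivity)] at h4
  have h5 := Real.log_le_log (by norm_num) hΔ'
  have h6 := Real.log_two_gt_d9
  push_cast
  nlinarith

theorem exists_run {n : ℕ} {G : SimpleGraph (Fin n)} [DecidableRel G.Adj]
    {L : List (Fin n × Fin n)} (hG : G.Connected) (hL : IsEdgeList G L) :
    ∃ τ t, Exec ((n + G.edgeFinset.card + 2) ^ 3) Net.mainProg (input n L) τ t ∧
      (t : ℝ) ≤ 320000 * max 1 (Real.log G.maxDegree * G.edgeFinset.card *
        min ((n : ℝ) ^ (2 / 3 : ℝ)) ((G.edgeFinset.card : ℝ) ^ (1 / 2 : ℝ))) ∧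
      hL.net.Ori (τ.arr 2) ∧
      ∃ z, (∀ v < hL.net.n, hL.net.indeg (τ.arr 2) v ≤ Net.levelCap z (hL.net.degree v)) ∧
        ∀ j < z, ¬ hL.net.Feasible hL.net.degree j := by
  have hlen := hL.length_eq
  rw [← hlen]
  have hn : 0 < n := by
    obtain ⟨v⟩ := hG.nonempty
    exact v.pos
  have hnm : n ≤ L.length + 1 := by
    have h := hG.card_vert_le_card_edgeSet_add_one
    rw [Nat.card_eq_fintype_card, Fintype.card_fin, Nat.card_eq_fintype_card,
      ← SimpleGraph.edgeFinset_card, ← hlen] at h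
    exact h
  have hmn : L.length < n * n := by
    have h := G.card_edgeFinset_le_card_choose_two
    rw [← hlen, Fintype.card_fin, Nat.choose_two_right] at h
    have h1 : n * (n - 1) / 2 ≤ n * (n - 1) := Nat.div_le_self _ _
    have h2 : n * (n - 1) < n * n := Nat.mul_lt_mul_of_pos_left (by omega) hn
    omega
  have hW : 4 * (hL.net.n + hL.net.m) + 4 ≤ (n + L.length + 2) ^ 3 := by
    change 4 * (n + L.length) + 4 ≤ _
    have h1 : 2 ^ 2 ≤ (n + L.length + 2) ^ 2 := Nat.pow_le_pow_left (by omega) 2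
    have h2 := Nat.mul_le_mul_right (n + L.length + 2) h1
    rw [pow_succ _ 2]
    omega
  have hdeg : ∀ v < hL.net.n, hL.net.degree v ≤ G.maxDegree := fun v hv => by
    have := G.degree_le_maxDegree ⟨v, hv⟩
    rwa [← hL.degree_eq] at this
  rcases Nat.lt_or_ge G.maxDegree 2 with hΔ | hΔ
  -- Degrees at most 1 give 2m ≤ n, and connectivity gives n ≤ m + 1. Only boundedly many steps
  -- remain, covered by `max 1`.
  · have hm : L.length ≤ 1 := by
      have h1 := G.sum_degrees_eq_twice_card_edges
      have h2 : ∑ v, G.degree v ≤ ∑ v : Fin n, 1 :=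
        Finset.sum_le_sum fun v _ => (G.degree_le_maxDegree v).trans (by omega)
      rw [Finset.sum_const, Finset.card_univ, Fintype.card_fin, smul_eq_mul, mul_one, h1,
        ← hlen] at h2
      omega
    obtain ⟨τ, t, h1, h2, h3, h4⟩ := Net.wp_main (D := 1) (M := 1) (r := 1) hW hL.start_input hn
      (Net.cutBound_of_lt_mul (by change L.length < _; omega)) hdeg (by omega)
    refine ⟨τ, t, h1, ?_, h2, h3⟩
    have h5 : t ≤ 320000 := by
      refine h4.trans ?_
      change (1 + 2) * (2000 * ((1 + 1 + 1) * (n + L.length + 1))) ≤ _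
      omega
    calc (t : ℝ) ≤ 320000 * 1 := by rw [mul_one]; exact_mod_cast h5
      _ ≤ _ := by gcongr; exact le_max_left _ _
  · have hm : 0 < L.length := by
      by_contra h0
      have h1 : n ≤ 1 := by omega
      have h2 : G.maxDegree ≤ 0 := by
        refine G.maxDegree_le_of_forall_degree_le 0 fun v => ?_
        have := G.degree_lt_card_verts v
        rw [Fintype.card_fin] at this
        omega
      omega
    obtain ⟨D, M, hD, hM, hDM⟩ := Net.exists_cutBound hL.net_simple hn hm hmn
    obtain ⟨τ, t, h1, h2, h3, h4⟩ := Net.wp_main (r := Nat.clog 2 (2 * G.maxDegree)) hW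
      hL.start_input hD hM hdeg (Nat.le_pow_clog one_lt_two _)
    refine ⟨τ, t, h1, ?_, h2, h3⟩
    change ((D + M + 1 : ℕ) : ℝ) ≤
      4 * min ((n : ℝ) ^ (2 / 3 : ℝ)) ((L.length : ℝ) ^ (1 / 2 : ℝ)) at hDM
    change t ≤ _ * (2000 * ((D + M + 1) * (n + L.length + 1))) at h4
    set x := min ((n : ℝ) ^ (2 / 3 : ℝ)) ((L.length : ℝ) ^ (1 / 2 : ℝ))
    have h5 := clog_le_log hΔ
    -- Connectivity makes the number of nodes at most m + 1, so a phase takes O(m) steps.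
    have h6 : ((n + L.length + 1 : ℕ) : ℝ) ≤ 4 * L.length := by
      have : n + L.length + 1 ≤ 4 * L.length := by omega
      exact_mod_cast this
    have h7 : 0 ≤ x := by positivity
    have h8 : 0 ≤ Real.log G.maxDegree := Real.log_natCast_nonneg _
    calc (t : ℝ) ≤ ((Nat.clog 2 (2 * G.maxDegree) + 2 : ℕ) : ℝ) *
          (2000 * (((D + M + 1 : ℕ) : ℝ) * ((n + L.length + 1 : ℕ) : ℝ))) := by exact_mod_cast h4
      _ ≤ (10 * Real.log G.maxDegree) * (2000 * ((4 * x) * (4 * L.length))) := by gcongr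
      _ = 320000 * (Real.log G.maxDegree * L.length * x) := by ring
      _ ≤ _ := by gcongr; exact le_max_right _ _

end StarPartition

theorem mainTheorem9 :
    (∀ (V : Type*) [Fintype V] (G : SimpleGraph V) [DecidableRel G.Adj] (κ : V → ℕ),
      G.Connected → (∀ v, G.degree v ≤ κ v) →
        (∃ C : StarPartition.StarColoring G, C.IsOptimal κ ∧ C.toOrientation.IsOptimal κ) ∧
        StarPartition.minMaxInd G κ ≤ StarPartition.minMaxStar G κ ∧
        StarPartition.minMaxStar G κ ≤ StarPartition.minMaxInd G κ + 1) ∧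
    ∃ (p : StarPartition.Prog) (c : ℕ) (K : ℝ),
      ∀ (n : ℕ) (G : SimpleGraph (Fin n)) [DecidableRel G.Adj] (L : List (Fin n × Fin n)),
        G.Connected → StarPartition.IsEdgeList G L →
        ∃ (τ : StarPartition.Store) (t : ℕ) (C : StarPartition.StarColoring G),
          StarPartition.Exec ((n + G.edgeFinset.card + 2) ^ c) p (StarPartition.input n L) τ t ∧
          (t : ℝ) ≤ K * max 1 (Real.log G.maxDegree * G.edgeFinset.card *
            min ((n : ℝ) ^ (2 / 3 : ℝ)) ((G.edgeFinset.card : ℝ) ^ (1 / 2 : ℝ))) ∧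
          StarPartition.Outputs τ L C ∧
          ∀ κ : Fin n → ℕ, (∀ v, G.degree v ≤ κ v) →
            C.IsOptimal κ ∧ C.toOrientation.IsOptimal κ := by
  refine ⟨fun V _ G _ κ _ hκ => StarPartition.exists_isOptimal hκ,
    StarPartition.Net.mainProg, 3, 320000, fun n G _ L hG hL => ?_⟩
  obtain ⟨τ, t, h1, h2, h3, z, h4, h5⟩ := StarPartition.exists_run hG hL
  obtain ⟨C, hC⟩ := hL.exists_coloring h3
  exact ⟨τ, t, C, h1, h2, hC, fun κ hκ => hL.isOptimal_of_level h3 hC h4 h5 hκ⟩
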